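/- Let $n\ge 1$ and let $\Sigma\subset\mathbb H^{n+1}$ be a (smooth) embedded hypersurface equipped with a continuous unit normal vector field $N$. Let $B(v)=-\nabla_vN$ be its shape operator, where $\nabla$ is the Levi-Civita connection of $\mathbb H^{n+1}$; the principal curvatures are the eigenvalues $\lambda_1,\dots,\lambda_n$ of $B$, and the mean curvature is $H=\operatorname{tr}B$. A hypersurface has weakly small curvature if all its principal curvatures satisfy $|\lambda_i|\le 1$ at every point, and it is minimal if $H\equiv 0$. Suppose that $\Sigma$ has weakly small curvature and consider $$F_\Sigma:\Sigma\times\mathbb R\to\mathbb H^{n+1},\qquad F_\Sigma(x,t)=\exp_x(tN(x)),\qquad \Sigma_t:=F_\Sigma(\Sigma\times\{t\}).$$ 1. If $\Sigma$ is geodesically convex (any two points of $\Sigma$ are joined by a geodesic of the first fundamental form of $\Sigma$), then $F_\Sigma$ is a diffeomorphism onto its image, which is open in $\mathbb H^{n+1}$, and for every $t\in\mathbb R$, $\Sigma_t$ is an embedded hypersurface of weakly small curvature. 2. If $\Sigma$ is nonempty, connected and complete (for its first fundamental form), then $F_\Sigma$ is a diffeomorphism onto $\mathbb H^{n+1}$,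 and for every $t\in\mathbb R$, $\Sigma_t$ is a properly embedded hypersurface of weakly small curvature. 3. If $\Sigma$ is minimal, then for every $t\in\mathbb R$ the mean curvature of $\Sigma_t$ (that is, of the immersion $x\mapsto F_\Sigma(x,t)$), computed with respect to the unit normal vector field pointing in the direction where $t$ increases, at every point either vanishes or has the same sign as $-t$, and the set of points where it does not have the same sign as $-t$ has measure zero (with the convention that the sign of $0$ is $0$). -/

import Mathlib

open scoped Manifold ContDiff Topology ENNReal RealInnerProductSpace

noncomputable section

/-- Minkowski space `ℝ^{1,d}`; the first coordinate is the timelike one. -/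
abbrev Minkowski (d : ℕ) : Type := ℝ × EuclideanSpace ℝ (Fin d)

/-- The Lorentzian inner product of signature `(d, 1)`. -/
def mink {d : ℕ} (x y : Minkowski d) : ℝ := ⟪x.2, y.2⟫ - x.1 * y.1

theorem mink_comm {d : ℕ} (x y : Minkowski d) : mink x y = mink y x := by
  simp only [mink, real_inner_comm, mul_comm]

theorem mink_add_right {d : ℕ} (x y z : Minkowski d) :
    mink x (y + z) = mink x y + mink x z := by
  simp only [mink, Prod.snd_add, Prod.fst_add, inner_add_right]; ring

theorem mink_smul_right {d : ℕ} (c : ℝ) (x y : Minkowski d) :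
    mink x (c • y) = c * mink x y := by
  simp only [mink, Prod.smul_snd, Prod.smul_fst, inner_smul_right, smul_eq_mul]; ring

theorem mink_add_left {d : ℕ} (x y z : Minkowski d) :
    mink (x + y) z = mink x z + mink y z := by
  rw [mink_comm, mink_add_right, mink_comm z x, mink_comm z y]

theorem mink_smul_left {d : ℕ} (c : ℝ) (x y : Minkowski d) :
    mink (c • x) y = c * mink x y := by
  rw [mink_comm, mink_smul_right, mink_comm]

/-- Hyperbolic space `ℍ^d` in the hyperboloid model: the upper sheet of `⟨x, x⟩ = -1`. -/
def Hyp (d : ℕ) : Type := {x : Minkowski d // mink x x = -1 ∧ 0 < x.1}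

namespace Hyp

variable {d : ℕ}

instance : TopologicalSpace (Hyp d) := instTopologicalSpaceSubtype

instance : CoeOut (Hyp d) (Minkowski d) := ⟨Subtype.val⟩

theorem fst_eq (x : Hyp d) : x.1.1 = √(1 + ‖x.1.2‖ ^ 2) := by
  have h := x.2.1
  have h0 := x.2.2
  rw [mink, real_inner_self_eq_norm_sq] at h
  rw [eq_comm, Real.sqrt_eq_iff_mul_self_eq (by positivity) h0.le]
  linarith

/-- The global coordinate system of `ℍ^d`: orthogonal projection to the spacelike coordinates. -/
def chartHomeomorph (d : ℕ) : Hyp d ≃ₜ EuclideanSpace ℝ (Fin d) where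
  toFun x := x.1.2
  invFun y := ⟨(√(1 + ‖y‖ ^ 2), y), by
    have h : (0 : ℝ) < 1 + ‖y‖ ^ 2 := by positivity
    refine ⟨?_, Real.sqrt_pos.2 h⟩
    simp only [mink, real_inner_self_eq_norm_sq, Real.mul_self_sqrt h.le]
    ring⟩
  left_inv x := Subtype.ext (Prod.ext (fst_eq x).symm rfl)
  right_inv _ := rfl
  continuous_toFun := continuous_snd.comp continuous_subtype_val
  continuous_invFun := Continuous.subtype_mk (by fun_prop) _

/-- The base point `(1, 0)`. -/
def x₀ (d : ℕ) : Hyp d := (chartHomeomorph d).symm 0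

/-- The smooth structure of `ℍ^d`. -/
instance : ChartedSpace (EuclideanSpace ℝ (Fin d)) (Hyp d) :=
  (chartHomeomorph d).toOpenPartialHomeomorph.singletonChartedSpace rfl

instance : IsManifold (𝓡 d) ∞ (Hyp d) :=
  (chartHomeomorph d).toOpenPartialHomeomorph.isManifold_singleton rfl

/-- The inclusion of `ℍ^d` into Minkowski space is smooth. -/
theorem contMDiff_coe :
    ContMDiff (𝓡 d) 𝓘(ℝ, Minkowski d) ∞ (fun x : Hyp d => (x : Minkowski d)) := by
  have h1 : ContMDiff (𝓡 d) (𝓡 d) ∞ (chartHomeomorph d) := by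
    have h := contMDiffOn_chart (I := 𝓡 d) (n := ∞) (M := Hyp d) (x := x₀ d)
    exact contMDiffOn_univ.1 h
  have h2 : ContDiff ℝ ∞ (fun y : EuclideanSpace ℝ (Fin d) => (√(1 + ‖y‖ ^ 2), y)) := by
    refine ContDiff.prodMk (ContDiff.sqrt ?_ fun y => ?_) contDiff_id
    · exact contDiff_const.add (contDiff_norm_sq ℝ)
    · positivity
  have h3 : (fun x : Hyp d => (x : Minkowski d)) =
      (fun y : EuclideanSpace ℝ (Fin d) => (√(1 + ‖y‖ ^ 2), y)) ∘ chartHomeomorph d :=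
    funext fun x => Prod.ext (fst_eq x) rfl
  rw [h3]
  exact h2.contMDiff.comp h1

/-- The tangent space `T_x ℍ^d`, the Lorentz-orthogonal complement of `x`. The hyperbolic metric
is the restriction of `mink` to it. -/
def tangent (x : Hyp d) : Submodule ℝ (Minkowski d) where
  carrier := {v | mink (x : Minkowski d) v = 0}
  add_mem' {a b} ha hb := by
    simp only [Set.mem_ofPred_eq] at ha hb ⊢
    rw [mink_add_right, ha, hb, add_zero]
  zero_mem' := by simp [mink]
  smul_mem' c a ha := by
    simp only [Set.mem_ofPred_eq] at ha ⊢
    rw [mink_smul_right, ha, mul_zero]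

/-- The orthogonal projection of Minkowski space onto `T_x ℍ^d`. The Levi-Civita connection of
`ℍ^d` is the flat derivative of Minkowski space followed by this projection. -/
def proj (x w : Minkowski d) : Minkowski d := w + mink w x • x

/-- The hyperbolic norm of a tangent vector. -/
def tnorm (v : Minkowski d) : ℝ := √(mink v v)

theorem tangent_fst_sq_le (x : Hyp d) (v : Minkowski d) (hv : v ∈ tangent x) :
    v.1 ^ 2 ≤ (x.1.1 ^ 2 - 1) * mink v v := by
  have h1 : ⟪x.1.2, v.2⟫ - x.1.1 * v.1 = 0 := hv
  have h2 := x.2.1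
  have h3 := real_inner_mul_inner_self_le x.1.2 v.2
  simp only [mink] at h2 ⊢
  have h4 : ⟪x.1.2, v.2⟫ = x.1.1 * v.1 := by linarith
  have h5 : ⟪x.1.2, x.1.2⟫ = x.1.1 * x.1.1 - 1 := by linarith
  rw [h4, h5] at h3
  nlinarith

theorem one_le_fst (x : Hyp d) : 1 ≤ x.1.1 := by
  rw [fst_eq]
  exact Real.one_le_sqrt.2 (by nlinarith [sq_nonneg ‖x.1.2‖])

theorem mink_self_nonneg (x : Hyp d) (v : Minkowski d) (hv : v ∈ tangent x) : 0 ≤ mink v v := by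
  have h1 := tangent_fst_sq_le x v hv
  have h2 := one_le_fst x
  rcases h2.eq_or_lt with h | h
  · have h3 : v.1 = 0 := by rw [← h] at h1; nlinarith
    simp only [mink, h3, mul_zero, sub_zero]
    exact real_inner_self_nonneg
  · by_contra hneg
    nlinarith [sq_nonneg v.1, mul_pos (show 0 < x.1.1 ^ 2 - 1 by nlinarith) (not_le.1 hneg |> neg_pos.2)]

theorem tnorm_sq (x : Hyp d) (v : Minkowski d) (hv : v ∈ tangent x) : tnorm v ^ 2 = mink v v :=
  Real.sq_sqrt (mink_self_nonneg x v hv)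

theorem mink_exp (x : Hyp d) (v : Minkowski d) (hv : v ∈ tangent x) (a b : ℝ) :
    mink (a • (x : Minkowski d) + b • v) (a • (x : Minkowski d) + b • v) =
      b ^ 2 * mink v v - a ^ 2 := by
  have h : mink (x : Minkowski d) v = 0 := hv
  have h' : mink v (x : Minkowski d) = 0 := by rw [mink_comm, h]
  simp only [mink_add_left, mink_add_right, mink_smul_left, mink_smul_right, x.2.1, h, h']
  ring

theorem eq_zero_of_mink_self (x : Hyp d) (v : Minkowski d) (hv : v ∈ tangent x)
    (h : mink v v = 0) : v = 0 := by
  have h1 := tangent_fst_sq_le x v hv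
  rw [h, mul_zero] at h1
  have h2 : v.1 = 0 := by nlinarith
  have h3 : v.2 = 0 := by
    rw [mink, h2, mul_zero, sub_zero, inner_self_eq_zero] at h
    exact h
  exact Prod.ext h2 h3

theorem exp_mem (x : Hyp d) (v : Minkowski d) (hv : v ∈ tangent x) :
    let w := Real.cosh (tnorm v) • (x : Minkowski d) + (Real.sinh (tnorm v) / tnorm v) • v
    mink w w = -1 ∧ 0 < w.1 := by
  intro w
  have hr := tnorm_sq x v hv
  have hcs := Real.cosh_sq (tnorm v)
  rcases eq_or_ne (tnorm v) 0 with h0 | h0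
  · have hw : w = x := by simp [w, h0]
    rw [hw]
    exact x.2
  · refine ⟨?_, ?_⟩
    · rw [mink_exp x v hv, ← hr, div_pow, div_mul_cancel₀ _ (pow_ne_zero 2 h0), hcs]
      ring
    · have hpos : 0 < tnorm v := lt_of_le_of_ne (Real.sqrt_nonneg _) h0.symm
      have h1 := tangent_fst_sq_le x v hv
      rw [← hr] at h1
      have hx := one_le_fst x
      have h2 : |v.1| ≤ x.1.1 * tnorm v := by
        apply abs_le_of_sq_le_sq _ (by positivity)
        nlinarith [sq_nonneg (tnorm v)]
      have hs : 0 < Real.sinh (tnorm v) := Real.sinh_pos_iff.2 hpos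
      have h3 : -(x.1.1 * tnorm v) ≤ v.1 := (abs_le.1 h2).1
      have h4 : Real.sinh (tnorm v) / tnorm v * (-(x.1.1 * tnorm v)) ≤
          Real.sinh (tnorm v) / tnorm v * v.1 := mul_le_mul_of_nonneg_left h3 (by positivity)
      have h5 : Real.sinh (tnorm v) / tnorm v * (-(x.1.1 * tnorm v)) =
          -(Real.sinh (tnorm v) * x.1.1) := by field_simp
      have h6 : Real.sinh (tnorm v) < Real.cosh (tnorm v) := Real.sinh_lt_cosh _
      have h7 : Real.sinh (tnorm v) * x.1.1 < Real.cosh (tnorm v) * x.1.1 :=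
        mul_lt_mul_of_pos_right h6 (by linarith)
      show 0 < Real.cosh (tnorm v) * x.1.1 + Real.sinh (tnorm v) / tnorm v * v.1
      linarith

/-- The exponential map of `ℍ^d`, `exp_x(v) = cosh |v| x + (sinh |v| / |v|) v`. -/
def exp (x : Hyp d) (v : tangent x) : Hyp d :=
  ⟨Real.cosh (tnorm (v : Minkowski d)) • (x : Minkowski d) +
      (Real.sinh (tnorm (v : Minkowski d)) / tnorm (v : Minkowski d)) • (v : Minkowski d),
    exp_mem x v v.2⟩

/-- For a tangent vector `v` at `x`, the curve `s ↦ exp_x(s v)` starts at `x` with velocity `v`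
and has vanishing covariant acceleration: it is the geodesic with initial velocity `v`. -/
theorem exp_geodesic (x : Hyp d) (v : tangent x) :
    let c : ℝ → Minkowski d := fun s => (exp x (s • v) : Hyp d)
    c 0 = x ∧ deriv c 0 = v ∧ ∀ s, proj (c s) (deriv (deriv c) s) = 0 := by
  intro c
  set r := tnorm (v : Minkowski d) with hr
  have hr2 : r ^ 2 = mink (v : Minkowski d) v := tnorm_sq x v v.2
  rcases eq_or_ne r 0 with h0 | h0
  · have hv : (v : Minkowski d) = 0 :=
      eq_zero_of_mink_self x v v.2 (by rw [← hr2, h0]; simp)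
    have hc : c = fun _ => (x : Minkowski d) := by
      funext s
      simp [c, exp, hv, tnorm, mink]
    simp [hc, hv, proj, mink]
  · have hpos : 0 ≤ r := Real.sqrt_nonneg _
    have hc : c = fun s => Real.cosh (s * r) • (x : Minkowski d) +
        (Real.sinh (s * r) / r) • (v : Minkowski d) := by
      funext s
      have hn : tnorm (s • (v : Minkowski d)) = |s| * r := by
        rw [hr, tnorm, tnorm, mink_smul_left, mink_smul_right, ← mul_assoc,
          Real.sqrt_mul (mul_self_nonneg s), Real.sqrt_mul_self_eq_abs]
      have hcs : Real.cosh (|s| * r) = Real.cosh (s * r) := by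
        rcases abs_choice s with h | h <;> simp [h]
      have hsn : Real.sinh (|s| * r) / (|s| * r) * s = Real.sinh (s * r) / r := by
        rcases eq_or_ne s 0 with rfl | hs
        · simp
        · rcases abs_choice s with h | h <;> rw [h]
          · field_simp
          · rw [neg_mul, Real.sinh_neg]; field_simp
      simp only [c, exp, Submodule.coe_smul, hn, hcs, smul_smul, hsn]
    have hd1 : deriv c = fun s => (Real.sinh (s * r) * r) • (x : Minkowski d) +
        Real.cosh (s * r) • (v : Minkowski d) := by
      funext s
      have hm : HasDerivAt (fun s : ℝ => s * r) r s := by simpa using (hasDerivAt_id s).mul_const r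
      rw [hc]
      have hh := (hm.cosh.smul_const (x : Minkowski d)).add
        ((hm.sinh.div_const r).smul_const (v : Minkowski d))
      rw [mul_div_cancel_right₀ _ h0] at hh
      exact hh.deriv
    have hd2 : deriv (deriv c) = fun s => r ^ 2 • c s := by
      funext s
      have hm : HasDerivAt (fun s : ℝ => s * r) r s := by simpa using (hasDerivAt_id s).mul_const r
      rw [hd1, hc]
      have hh := ((hm.sinh.mul_const r).smul_const (x : Minkowski d)).add
        (hm.cosh.smul_const (v : Minkowski d))
      refine hh.deriv.trans ?_
      rw [smul_add, smul_smul, smul_smul]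
      congr 2
      · ring
      · field_simp
    refine ⟨by simp [hc], by simp [hd1], fun s => ?_⟩
    have hcc : mink (c s) (c s) = -1 := (exp x (s • v)).2.1
    rw [hd2, proj, mink_smul_left, hcc]
    module

end Hyp

section Hypersurface

variable {n d : ℕ} {M : Type*} [TopologicalSpace M] [ChartedSpace (EuclideanSpace ℝ (Fin n)) M]

/-- The differential at `x` of a map from the manifold `M` to Minkowski space. For
`f : M → ℍ^d` the differential of `x ↦ (f x : Minkowski d)` is `df` followed by the inclusion of
the tangent space of `ℍ^d`. -/
def dif (f : M → Minkowski d) (x : M) : TangentSpace (𝓡 n) x →ₗ[ℝ] Minkowski d :=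
  (mfderiv (𝓡 n) 𝓘(ℝ, Minkowski d) f x : TangentSpace (𝓡 n) x →L[ℝ] Minkowski d).toLinearMap

/-- The differential of `ι : M → ℍ^d`, as a map to Minkowski space. -/
def tmap (ι : M → Hyp d) (x : M) : TangentSpace (𝓡 n) x →ₗ[ℝ] Minkowski d :=
  dif (fun y => (ι y : Minkowski d)) x

/-- The covariant derivative `∇_v W` in `ℍ^d` of a vector field `W` along `ι : M → ℍ^d`. -/
def covDeriv (ι : M → Hyp d) (W : (x : M) → Hyp.tangent (ι x)) (x : M)
    (v : TangentSpace (𝓡 n) x) : Minkowski d :=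
  Hyp.proj (ι x) (dif (fun y => (W y : Minkowski d)) x v)

variable (n)

/-- `N` is a continuous unit normal vector field of the hypersurface `ι : M → ℍ^d`. -/
structure IsUnitNormal (ι : M → Hyp d) (N : (x : M) → Hyp.tangent (ι x)) : Prop where
  continuous : Continuous fun x => (N x : Minkowski d)
  unit : ∀ x, mink (N x : Minkowski d) (N x) = 1
  normal : ∀ (x : M) (v : TangentSpace (𝓡 n) x), mink (N x : Minkowski d) (tmap ι x v) = 0

open Classical in
/-- The shape operator `B` of the hypersurface `ι : M → ℍ^d` with respect to the unit normal `N`: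
the endomorphism of `T_x M` such that `dι (B v) = -∇_v N`. -/
def shapeOperator (ι : M → Hyp d) (N : (x : M) → Hyp.tangent (ι x)) (x : M) :
    TangentSpace (𝓡 n) x →ₗ[ℝ] TangentSpace (𝓡 n) x :=
  if h : ∃ B : TangentSpace (𝓡 n) x →ₗ[ℝ] TangentSpace (𝓡 n) x,
      ∀ v, tmap ι x (B v) = -covDeriv ι N x v
  then h.choose else 0

theorem shapeOperator_eq (ι : M → Hyp d) (N : (x : M) → Hyp.tangent (ι x)) (x : M)
    (hinj : Function.Injective (tmap (n := n) ι x))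
    (B : TangentSpace (𝓡 n) x →ₗ[ℝ] TangentSpace (𝓡 n) x)
    (hB : ∀ v, tmap ι x (B v) = -covDeriv ι N x v) : shapeOperator n ι N x = B := by
  have h : ∃ B : TangentSpace (𝓡 n) x →ₗ[ℝ] TangentSpace (𝓡 n) x,
      ∀ v, tmap ι x (B v) = -covDeriv ι N x v := ⟨B, hB⟩
  rw [shapeOperator, dif_pos h]
  exact LinearMap.ext fun v => hinj ((h.choose_spec v).trans (hB v).symm)

/-- The principal curvatures, i.e. the eigenvalues of the shape operator, lie in `[-1, 1]`. -/
def WeaklySmallCurvature (ι : M → Hyp d) (N : (x : M) → Hyp.tangent (ι x)) : Prop :=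
  ∀ (x : M) (c : ℝ), Module.End.HasEigenvalue (shapeOperator n ι N x) c → |c| ≤ 1

/-- The mean curvature, i.e. the trace of the shape operator. -/
def meanCurvature (ι : M → Hyp d) (N : (x : M) → Hyp.tangent (ι x)) (x : M) : ℝ :=
  LinearMap.trace ℝ (TangentSpace (𝓡 n) x) (shapeOperator n ι N x)

def IsMinimal (ι : M → Hyp d) (N : (x : M) → Hyp.tangent (ι x)) : Prop :=
  ∀ x, meanCurvature n ι N x = 0

/-- On the open set `s`, `γ` is a geodesic of the first fundamental form of `ι : M → ℍ^d`: the
tangential part of the acceleration of `ι ∘ γ` in `ℍ^d` vanishes. -/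
def IsGeodesicOn (ι : M → Hyp d) (γ : ℝ → M) (s : Set ℝ) : Prop :=
  ContMDiffOn 𝓘(ℝ, ℝ) (𝓡 n) ∞ γ s ∧
    ∀ t ∈ s, ∀ v : TangentSpace (𝓡 n) (γ t),
      mink (Hyp.proj (ι (γ t)) (deriv (deriv fun r => (ι (γ r) : Minkowski d)) t))
        (tmap ι (γ t) v) = 0

/-- Any two points are joined by a geodesic of the first fundamental form. -/
def IsGeodesicallyConvex (ι : M → Hyp d) : Prop :=
  ∀ x y : M, ∃ (γ : ℝ → M) (s : Set ℝ), IsOpen s ∧ Set.Icc 0 1 ⊆ s ∧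
    IsGeodesicOn n ι γ s ∧ γ 0 = x ∧ γ 1 = y

/-- The norm on the tangent spaces of `M` given by the first fundamental form. -/
@[reducible] def inducedENorm (ι : M → Hyp d) (x : M) : ENorm (TangentSpace (𝓡 n) x) :=
  ⟨fun v => ENNReal.ofReal (Hyp.tnorm (tmap ι x v))⟩

/-- The Riemannian distance of the first fundamental form. -/
def intrinsicEDist (ι : M → Hyp d) (x y : M) : ℝ≥0∞ :=
  letI : ∀ z : M, ENorm (TangentSpace (𝓡 n) z) := inducedENorm n ι
  Manifold.riemannianEDist (𝓡 n) x y

/-- The first fundamental form is complete: Cauchy sequences for its distance converge. -/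
def IsCompleteHypersurface (ι : M → Hyp d) : Prop :=
  ∀ u : ℕ → M,
    (∀ ε : ℝ≥0∞, 0 < ε → ∃ K, ∀ i ≥ K, ∀ j ≥ K, intrinsicEDist n ι (u i) (u j) < ε) →
      ∃ x, Filter.Tendsto u Filter.atTop (𝓝 x)

/-- The normal exponential map `F(x, t) = exp_x(t N(x))`. -/
def normalExp (ι : M → Hyp d) (N : (x : M) → Hyp.tangent (ι x)) (p : M × ℝ) : Hyp d :=
  Hyp.exp (ι p.1) (p.2 • N p.1)

/-- The parametrization `ι_t(x) = F(x, t)` of the equidistant hypersurface `Σ_t`. -/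
def equidistant (ι : M → Hyp d) (N : (x : M) → Hyp.tangent (ι x)) (t : ℝ) (x : M) : Hyp d :=
  normalExp ι N (x, t)

/-- `N'` is the unit normal of `Σ_t` pointing in the direction where `t` increases. -/
def IsForwardUnitNormal (ι : M → Hyp d) (N : (x : M) → Hyp.tangent (ι x)) (t : ℝ)
    (N' : (x : M) → Hyp.tangent (equidistant ι N t x)) : Prop :=
  IsUnitNormal n (equidistant ι N t) N' ∧
    ∀ x, HasDerivAt (fun s => (equidistant ι N s x : Minkowski d)) (N' x : Minkowski d) t

/-- A subset of an `n`-manifold has measure zero if it has Lebesgue measure zero in all charts. -/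
def IsNullSet (A : Set M) : Prop :=
  ∀ e ∈ IsManifold.maximalAtlas (𝓡 n) ∞ M, MeasureTheory.volume (e '' (A ∩ e.source)) = 0

end Hypersurface

end

open scoped Manifold ContDiff Topology ENNReal RealInnerProductSpace

noncomputable section

section MinkowskiAlgebra

variable {d : ℕ}

@[simp] theorem mink_neg_right (x y : Minkowski d) : mink x (-y) = -mink x y := by
  simpa using mink_smul_right (-1) x y

@[simp] theorem mink_neg_left (x y : Minkowski d) : mink (-x) y = -mink x y := by
  rw [mink_comm, mink_neg_right, mink_comm]

theorem mink_sub_right (x y z : Minkowski d) : mink x (y - z) = mink x y - mink x z := by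
  rw [sub_eq_add_neg, mink_add_right, mink_neg_right, sub_eq_add_neg]

theorem mink_sub_left (x y z : Minkowski d) : mink (x - y) z = mink x z - mink y z := by
  rw [mink_comm, mink_sub_right, mink_comm z x, mink_comm z y]

@[simp] theorem mink_zero_right (x : Minkowski d) : mink x 0 = 0 := by simp [mink]

@[simp] theorem mink_zero_left (x : Minkowski d) : mink 0 x = 0 := by simp [mink]

/-- The Lorentzian inner product as a continuous bilinear map. -/
def minkL (d : ℕ) : Minkowski d →L[ℝ] Minkowski d →L[ℝ] ℝ :=
  LinearMap.toContinuousBilinearMap (LinearMap.mk₂ ℝ mink mink_add_left mink_smul_left mink_add_right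
    mink_smul_right)

@[simp] theorem minkL_apply (x y : Minkowski d) : minkL d x y = mink x y := rfl

theorem contDiff_mink {m : WithTop ℕ∞} :
    ContDiff ℝ m fun z : Minkowski d × Minkowski d => mink z.1 z.2 :=
  (minkL d).isBoundedBilinearMap.contDiff

theorem HasFDerivAt.mink {E : Type*} [NormedAddCommGroup E] [NormedSpace ℝ E]
    {f g : E → Minkowski d} {f' g' : E →L[ℝ] Minkowski d} {x : E} (hf : HasFDerivAt f f' x)
    (hg : HasFDerivAt g g' x) :
    HasFDerivAt (fun y => mink (f y) (g y))
      (((minkL d) (f x)).comp g' + ((minkL d).flip (g x)).comp f') x := by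
  have h := (minkL d).hasFDerivAt_of_bilinear hf hg
  refine h.congr_fderiv ?_
  ext v
  simp [mink_comm]

theorem HasDerivAt.mink {f g : ℝ → Minkowski d} {f' g' : Minkowski d} {x : ℝ}
    (hf : HasDerivAt f f' x) (hg : HasDerivAt g g' x) :
    HasDerivAt (fun y => mink (f y) (g y)) (mink (f x) g' + mink f' (g x)) x := by
  have h := (hf.hasFDerivAt.mink hg.hasFDerivAt).hasDerivAt
  simpa [mink_smul_right, mink_smul_left] using h

theorem finrank_minkowski : Module.finrank ℝ (Minkowski d) = d + 1 := by
  simp [Module.finrank_prod, add_comm]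

variable {V : Type*} [AddCommGroup V] [Module ℝ V] [FiniteDimensional ℝ V]

/-- A point of hyperbolic space, a unit normal and the tangent space of a hypersurface span
Minkowski space. -/
theorem exists_frame_decomposition {n : ℕ} (hV : Module.finrank ℝ V = n) (p : Hyp (n + 1))
    {ν : Minkowski (n + 1)} (hν : mink ν ν = 1) (hpν : mink (p : Minkowski (n + 1)) ν = 0)
    {L : V →ₗ[ℝ] Minkowski (n + 1)} (hL : Function.Injective L)
    (hpL : ∀ v, mink (p : Minkowski (n + 1)) (L v) = 0) (hνL : ∀ v, mink ν (L v) = 0)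
    (w : Minkowski (n + 1)) :
    ∃ v, w = (-mink (p : Minkowski (n + 1)) w) • (p : Minkowski (n + 1)) + mink ν w • ν + L v := by
  have hp := p.2.1
  set q : Minkowski (n + 1) := p.1
  let T : (ℝ × ℝ × V) →ₗ[ℝ] Minkowski (n + 1) :=
    (LinearMap.toSpanSingleton ℝ _ q).coprod ((LinearMap.toSpanSingleton ℝ _ ν).coprod L)
  have hT : ∀ a b v, T (a, b, v) = a • q + (b • ν + L v) := fun a b v => rfl
  have h1 : ∀ a b v, mink q (T (a, b, v)) = -a := fun a b v => by
    simp [hT, mink_add_right, mink_smul_right, hp, hpν, hpL]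
  have h2 : ∀ a b v, mink ν (T (a, b, v)) = b := fun a b v => by
    simp [hT, mink_add_right, mink_smul_right, mink_comm ν q, hν, hpν, hνL]
  have hinj : Function.Injective T := by
    rw [← LinearMap.ker_eq_bot, LinearMap.ker_eq_bot']
    rintro ⟨a, b, v⟩ h
    have ha : a = 0 := by simpa [h] using h1 a b v
    have hb : b = 0 := by simpa [h, eq_comm] using h2 a b v
    subst ha hb
    have hv : L v = 0 := by simpa [hT] using h
    rw [hL (hv.trans (map_zero L).symm)]
    rfl
  have hsurj : Function.Surjective T := by
    refine (LinearMap.injective_iff_surjective_of_finrank_eq_finrank ?_).1 hinj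
    rw [finrank_minkowski, Module.finrank_prod, Module.finrank_prod, hV]
    simp; ring
  obtain ⟨⟨a, b, v⟩, rfl⟩ := hsurj w
  exact ⟨v, by rw [h1, h2, neg_neg, hT, add_assoc]⟩

/-- A self-adjoint endomorphism with respect to a positive definite symmetric bilinear form is
diagonalizable in an orthonormal basis. -/
theorem exists_orthonormal_eigenbasis {n : ℕ} (hV : Module.finrank ℝ V = n)
    (g : V →ₗ[ℝ] V →ₗ[ℝ] ℝ) (hsymm : ∀ v w, g v w = g w v) (hpos : ∀ v, 0 ≤ g v v)
    (hdef : ∀ v, g v v = 0 → v = 0) (B : V →ₗ[ℝ] V) (hB : ∀ v w, g (B v) w = g v (B w)) :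
    ∃ (b : Module.Basis (Fin n) ℝ V) (lam : Fin n → ℝ), (∀ i, B (b i) = lam i • b i) ∧
      ∀ i j, g (b i) (b j) = if i = j then 1 else 0 := by
  let c : InnerProductSpace.Core ℝ V :=
    { inner := fun v w => g v w
      conj_inner_symm := fun v w => by simp [hsymm v w]
      re_inner_nonneg := fun v => by simpa using hpos v
      add_left := fun u v w => by simp
      smul_left := fun u v r => by simp
      definite := hdef }
  let : NormedAddCommGroup V := c.toNormedAddCommGroup
  let : InnerProductSpace ℝ V := InnerProductSpace.ofCore c.toCore
  have hS : B.IsSymmetric := fun v w => hB v w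
  refine ⟨(hS.eigenvectorBasis hV).toBasis, hS.eigenvalues hV, fun i => ?_, fun i j => ?_⟩
  · simpa using hS.apply_eigenvectorBasis hV i
  · have h := orthonormal_iff_ite.1 (hS.eigenvectorBasis hV).orthonormal i j
    rw [OrthonormalBasis.coe_toBasis]
    exact h

end MinkowskiAlgebra

section CoordinatePatch

variable {n : ℕ}

/-- A parametrized piece of a hypersurface of `ℍ^{n+1}` over the open set `V`, with a unit normal
field `ν`. -/
structure IsHypersurfacePatch (V : Set (EuclideanSpace ℝ (Fin n)))
    (f ν : EuclideanSpace ℝ (Fin n) → Minkowski (n + 1)) : Prop where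
  isOpen : IsOpen V
  contDiffOn : ContDiffOn ℝ ∞ f V
  mem_hyp : ∀ u ∈ V, mink (f u) (f u) = -1 ∧ 0 < (f u).1
  injective : ∀ u ∈ V, Function.Injective (fderiv ℝ f u)
  continuousOn_normal : ContinuousOn ν V
  unit : ∀ u ∈ V, mink (ν u) (ν u) = 1
  tangent : ∀ u ∈ V, mink (f u) (ν u) = 0
  normal : ∀ u ∈ V, ∀ v, mink (ν u) (fderiv ℝ f u v) = 0

namespace IsHypersurfacePatch

variable {V : Set (EuclideanSpace ℝ (Fin n))}
  {f ν : EuclideanSpace ℝ (Fin n) → Minkowski (n + 1)} {u : EuclideanSpace ℝ (Fin n)}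

theorem hasFDerivAt (h : IsHypersurfacePatch V f ν) (hu : u ∈ V) :
    HasFDerivAt f (fderiv ℝ f u) u :=
  ((h.contDiffOn.contDiffAt (h.isOpen.mem_nhds hu)).differentiableAt (by simp)).hasFDerivAt

theorem mink_fderiv (h : IsHypersurfacePatch V f ν) (hu : u ∈ V) (v : EuclideanSpace ℝ (Fin n)) :
    mink (f u) (fderiv ℝ f u v) = 0 := by
  have h1 := (h.hasFDerivAt hu).mink (h.hasFDerivAt hu)
  have h2 : HasFDerivAt (fun y => mink (f y) (f y)) (0 : EuclideanSpace ℝ (Fin n) →L[ℝ] ℝ) u := by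
    refine (hasFDerivAt_const (-1 : ℝ) u).congr_of_eventuallyEq ?_
    filter_upwards [h.isOpen.mem_nhds hu] with y hy using (h.mem_hyp y hy).1
  have h3 := DFunLike.congr_fun (h1.unique h2) v
  simp [mink_comm] at h3
  linarith [mink_comm (f u) (fderiv ℝ f u v)]

theorem exists_decomposition (h : IsHypersurfacePatch V f ν) (hu : u ∈ V) (w : Minkowski (n + 1)) :
    ∃ v, w = (-mink (f u) w) • f u + mink (ν u) w • ν u + fderiv ℝ f u v :=
  exists_frame_decomposition (V := EuclideanSpace ℝ (Fin n)) (by simp) ⟨f u, h.mem_hyp u hu⟩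
    (h.unit u hu) (h.tangent u hu) (L := (fderiv ℝ f u).toLinearMap) (h.injective u hu)
    (h.mink_fderiv hu) (h.normal u hu) w

theorem eq_zero_of_mink_self (h : IsHypersurfacePatch V f ν) (hu : u ∈ V)
    {v : EuclideanSpace ℝ (Fin n)} (hv : mink (fderiv ℝ f u v) (fderiv ℝ f u v) = 0) : v = 0 := by
  have h1 := Hyp.eq_zero_of_mink_self ⟨f u, h.mem_hyp u hu⟩ _ (h.mink_fderiv hu v) hv
  exact h.injective u hu (h1.trans (map_zero _).symm)

/-- The linear functionals that determine the normal, as a map into a fixed space. -/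
def normalEquation (ν₀ : Minkowski (n + 1))
    (f : EuclideanSpace ℝ (Fin n) → Minkowski (n + 1)) (u : EuclideanSpace ℝ (Fin n)) :
    Minkowski (n + 1) →L[ℝ] ℝ × ℝ × (EuclideanSpace ℝ (Fin n) →L[ℝ] ℝ) :=
  (ContinuousLinearMap.inl ℝ ℝ _).comp (minkL (n + 1) (f u)) +
    ((ContinuousLinearMap.inr ℝ ℝ _).comp ((ContinuousLinearMap.inl ℝ ℝ _).comp (minkL (n + 1) ν₀)) +
    (ContinuousLinearMap.inr ℝ ℝ _).comp ((ContinuousLinearMap.inr ℝ ℝ _).comp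
      (((ContinuousLinearMap.compL ℝ (EuclideanSpace ℝ (Fin n)) (Minkowski (n + 1)) ℝ).flip
        (fderiv ℝ f u)).comp (minkL (n + 1)))))

theorem normalEquation_apply (ν₀ : Minkowski (n + 1))
    (f : EuclideanSpace ℝ (Fin n) → Minkowski (n + 1)) (u : EuclideanSpace ℝ (Fin n))
    (w : Minkowski (n + 1)) :
    normalEquation ν₀ f u w =
      (mink (f u) w, mink ν₀ w, (minkL (n + 1) w).comp (fderiv ℝ f u)) := by
  simp [normalEquation]

theorem contDiffOn_normalEquation (h : IsHypersurfacePatch V f ν) (ν₀ : Minkowski (n + 1)) :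
    ContDiffOn ℝ ∞ (normalEquation ν₀ f) V := by
  have h1 := h.contDiffOn
  have h2 : ContDiffOn ℝ ∞ (fderiv ℝ f) V := h1.fderiv_of_isOpen h.isOpen (by simp)
  have h3 : ContDiffOn ℝ ∞ (fun u => minkL (n + 1) (f u)) V :=
    (minkL (n + 1)).contDiff.comp_contDiffOn h1
  have h4 : ContDiffOn ℝ ∞ (fun u => (ContinuousLinearMap.compL ℝ (EuclideanSpace ℝ (Fin n))
      (Minkowski (n + 1)) ℝ).flip (fderiv ℝ f u)) V :=
    (ContinuousLinearMap.contDiff _).comp_contDiffOn h2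
  exact (contDiffOn_const.clm_comp h3).add (contDiffOn_const.add
    (contDiffOn_const.clm_comp (contDiffOn_const.clm_comp (h4.clm_comp contDiffOn_const))))

theorem exists_equiv_normalEquation (h : IsHypersurfacePatch V f ν) (hu : u ∈ V) :
    ∃ A : Minkowski (n + 1) ≃L[ℝ] ℝ × ℝ × (EuclideanSpace ℝ (Fin n) →L[ℝ] ℝ),
      (A : Minkowski (n + 1) →L[ℝ] _) = normalEquation (ν u) f u := by
  have hinj : Function.Injective (normalEquation (ν u) f u).toLinearMap := by
    rw [← LinearMap.ker_eq_bot, LinearMap.ker_eq_bot']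
    intro w hw
    have hw' : normalEquation (ν u) f u w = 0 := hw
    rw [normalEquation_apply, Prod.mk_eq_zero, Prod.mk_eq_zero] at hw'
    obtain ⟨h1, h2, h3⟩ := hw'
    obtain ⟨v, hv⟩ := h.exists_decomposition hu w
    rw [h1, h2] at hv
    have hv' : w = fderiv ℝ f u v := by simpa using hv
    have h4 := DFunLike.congr_fun h3 v
    have h5 : mink (fderiv ℝ f u v) (fderiv ℝ f u v) = 0 := by
      rw [hv'] at h4
      simpa using h4
    rw [hv', h.eq_zero_of_mink_self hu h5, map_zero]
  have hdim : Module.finrank ℝ (Minkowski (n + 1)) =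
      Module.finrank ℝ (ℝ × ℝ × (EuclideanSpace ℝ (Fin n) →L[ℝ] ℝ)) := by
    have h1 : Module.finrank ℝ (EuclideanSpace ℝ (Fin n) →L[ℝ] ℝ) = n := by
      rw [← (LinearMap.toContinuousLinearMap (𝕜 := ℝ) (E := EuclideanSpace ℝ (Fin n))
        (F' := ℝ)).finrank_eq]
      exact Subspace.dual_finrank_eq.trans (by simp)
    rw [finrank_minkowski, Module.finrank_prod, Module.finrank_prod, h1]
    simp
    ring
  refine ⟨(LinearEquiv.ofInjectiveOfFinrankEq _ hinj hdim).toContinuousLinearEquiv, ?_⟩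
  exact ContinuousLinearMap.ext fun w => rfl

/-- A continuous unit normal field is smooth. -/
theorem contDiffOn_normal (h : IsHypersurfacePatch V f ν) : ContDiffOn ℝ ∞ ν V := by
  intro u₀ hu₀
  refine ContDiffAt.contDiffWithinAt ?_
  have hV := h.isOpen.mem_nhds hu₀
  obtain ⟨A, hA⟩ := h.exists_equiv_normalEquation hu₀
  have hsmooth : ContDiffAt ℝ ∞ (normalEquation (ν u₀) f) u₀ :=
    (h.contDiffOn_normalEquation _).contDiffAt hV
  let W := fun u => (normalEquation (ν u₀) f u).inverse (0, 1, 0)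
  have hinverse : ContDiffAt ℝ ∞ ContinuousLinearMap.inverse (normalEquation (ν u₀) f u₀) := by
    rw [← hA]
    exact contDiffAt_map_inverse A
  have hW : ContDiffAt ℝ ∞ W u₀ :=
    (hinverse.comp u₀ hsmooth).clm_apply contDiffAt_const
  have hφ : ContinuousAt (fun u => mink (ν u₀) (ν u)) u₀ :=
    (minkL (n + 1) (ν u₀)).continuous.continuousAt.comp
      (f := ν) (h.continuousOn_normal.continuousAt hV)
  have hφ₀ : 0 < mink (ν u₀) (ν u₀) := by rw [h.unit u₀ hu₀]; exact one_pos
  have hinv : ∀ᶠ u in 𝓝 u₀, normalEquation (ν u₀) f u ∈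
      Set.range (ContinuousLinearEquiv.toContinuousLinearMap (σ₁₂ := RingHom.id ℝ)
        (M₁ := Minkowski (n + 1)) (M₂ := ℝ × ℝ × (EuclideanSpace ℝ (Fin n) →L[ℝ] ℝ))) := by
    refine hsmooth.continuousAt ?_
    rw [← hA]
    exact A.nhds
  have key : ∀ᶠ u in 𝓝 u₀, ν u = (√(mink (W u) (W u)))⁻¹ • W u := by
    filter_upwards [hinv, hφ.eventually (lt_mem_nhds hφ₀), hV] with u ⟨e, he⟩ hpos hu
    set c := mink (ν u₀) (ν u)
    have h1 : normalEquation (ν u₀) f u (ν u) = c • ((0, 1, 0) : ℝ × ℝ × _) := by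
      rw [normalEquation_apply]
      ext v
      · simp [h.tangent u hu]
      · simp [c]
      · simp [h.normal u hu]
    have h2 : ν u = c • W u := by
      simp only [W]
      rw [← he, ContinuousLinearMap.inverse_equiv, ← map_smul, ← h1, ← he]
      simp
    have h3 : c ^ 2 * mink (W u) (W u) = 1 := by
      have := h.unit u hu
      rw [h2, mink_smul_left, mink_smul_right] at this
      linarith
    have h4 : mink (W u) (W u) = c⁻¹ ^ 2 := by
      field_simp
      linarith
    rw [h4, Real.sqrt_sq (by positivity), inv_inv]
    exact h2
  have hW₀ : mink (W u₀) (W u₀) ≠ 0 := by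
    intro h0
    have h1 := key.self_of_nhds
    have h2 := h.unit u₀ hu₀
    rw [h0] at h1
    rw [h1] at h2
    simp at h2
  refine ContDiffAt.congr_of_eventuallyEq ?_ key
  have h5 : ContDiffAt ℝ ∞ (fun u => mink (W u) (W u)) u₀ :=
    contDiff_mink.contDiffAt.comp u₀ (hW.prodMk hW)
  refine ContDiffAt.smul (ContDiffAt.inv (h5.sqrt hW₀) ?_) hW
  have h1 := key.self_of_nhds
  have h2 := h.unit u₀ hu₀
  intro h3
  rw [h3] at h1
  rw [h1] at h2
  simp at h2

end IsHypersurfacePatch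

end CoordinatePatch

namespace IsHypersurfacePatch

variable {n : ℕ} {V : Set (EuclideanSpace ℝ (Fin n))}
  {f ν : EuclideanSpace ℝ (Fin n) → Minkowski (n + 1)} {u : EuclideanSpace ℝ (Fin n)}

theorem hasFDerivAt_normal (h : IsHypersurfacePatch V f ν) (hu : u ∈ V) :
    HasFDerivAt ν (fderiv ℝ ν u) u :=
  ((h.contDiffOn_normal.contDiffAt (h.isOpen.mem_nhds hu)).differentiableAt (by simp)).hasFDerivAt

theorem mink_normal_fderiv_normal (h : IsHypersurfacePatch V f ν) (hu : u ∈ V)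
    (v : EuclideanSpace ℝ (Fin n)) : mink (ν u) (fderiv ℝ ν u v) = 0 := by
  have h1 := (h.hasFDerivAt_normal hu).mink (h.hasFDerivAt_normal hu)
  have h2 : HasFDerivAt (fun y => mink (ν y) (ν y)) (0 : EuclideanSpace ℝ (Fin n) →L[ℝ] ℝ) u := by
    refine (hasFDerivAt_const (1 : ℝ) u).congr_of_eventuallyEq ?_
    filter_upwards [h.isOpen.mem_nhds hu] with y hy using h.unit y hy
  have h3 := DFunLike.congr_fun (h1.unique h2) v
  simp [mink_comm] at h3
  linarith [mink_comm (ν u) (fderiv ℝ ν u v)]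

theorem mink_fderiv_normal (h : IsHypersurfacePatch V f ν) (hu : u ∈ V)
    (v : EuclideanSpace ℝ (Fin n)) : mink (f u) (fderiv ℝ ν u v) = 0 := by
  have h1 := (h.hasFDerivAt hu).mink (h.hasFDerivAt_normal hu)
  have h2 : HasFDerivAt (fun y => mink (f y) (ν y)) (0 : EuclideanSpace ℝ (Fin n) →L[ℝ] ℝ) u := by
    refine (hasFDerivAt_const (0 : ℝ) u).congr_of_eventuallyEq ?_
    filter_upwards [h.isOpen.mem_nhds hu] with y hy using h.tangent y hy
  have h3 := DFunLike.congr_fun (h1.unique h2) v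
  simpa [mink_comm (fderiv ℝ f u v), h.normal u hu] using h3

theorem contDiffOn_fderiv (h : IsHypersurfacePatch V f ν) : ContDiffOn ℝ ∞ (fderiv ℝ f) V :=
  h.contDiffOn.fderiv_of_isOpen h.isOpen (by simp)

theorem mink_fderiv_fderiv_normal_comm (h : IsHypersurfacePatch V f ν) (hu : u ∈ V)
    (v w : EuclideanSpace ℝ (Fin n)) :
    mink (fderiv ℝ f u v) (fderiv ℝ ν u w) = mink (fderiv ℝ f u w) (fderiv ℝ ν u v) := by
  have hV := h.isOpen.mem_nhds hu
  have hD : HasFDerivAt (fderiv ℝ f) (fderiv ℝ (fderiv ℝ f) u) u :=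
    ((h.contDiffOn_fderiv.contDiffAt hV).differentiableAt (by simp)).hasFDerivAt
  have key : ∀ v w, mink (fderiv ℝ f u v) (fderiv ℝ ν u w) +
      mink (ν u) (fderiv ℝ (fderiv ℝ f) u w v) = 0 := by
    intro v w
    have h1 := (h.hasFDerivAt_normal hu).mink (hD.clm_apply (hasFDerivAt_const v u))
    have h2 : HasFDerivAt (fun y => mink (ν y) (fderiv ℝ f y v))
        (0 : EuclideanSpace ℝ (Fin n) →L[ℝ] ℝ) u := by
      refine (hasFDerivAt_const (0 : ℝ) u).congr_of_eventuallyEq ?_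
      filter_upwards [hV] with y hy using h.normal y hy v
    have h3 := DFunLike.congr_fun (h1.unique h2) w
    simp at h3
    linarith [mink_comm (fderiv ℝ f u v) (fderiv ℝ ν u w)]
  have hs : IsSymmSndFDerivAt ℝ f u :=
    (h.contDiffOn.contDiffAt hV).isSymmSndFDerivAt (by
      rw [minSmoothness_of_isRCLikeNormedField]
      exact WithTop.coe_le_coe.2 (le_top : (2 : ℕ∞) ≤ ⊤))
  have h1 := key v w
  have h2 := key w v
  rw [hs w v] at h1
  linarith

end IsHypersurfacePatch

section Manifold

variable {n d : ℕ} {M : Type*} [TopologicalSpace M] [ChartedSpace (EuclideanSpace ℝ (Fin n)) M]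

instance (x : M) : FiniteDimensional ℝ (TangentSpace (𝓡 n) x) :=
  inferInstanceAs (FiniteDimensional ℝ (EuclideanSpace ℝ (Fin n)))

theorem finrank_tangentSpace (x : M) : Module.finrank ℝ (TangentSpace (𝓡 n) x) = n :=
  (finrank_euclideanSpace_fin : Module.finrank ℝ (EuclideanSpace ℝ (Fin n)) = n)

/-- A chart of the maximal atlas as a partial diffeomorphism. -/
def chartPartialDiffeomorph {e : OpenPartialHomeomorph M (EuclideanSpace ℝ (Fin n))}
    (he : e ∈ IsManifold.maximalAtlas (𝓡 n) ∞ M) :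
    PartialDiffeomorph (𝓡 n) (𝓡 n) M (EuclideanSpace ℝ (Fin n)) ∞ where
  toPartialEquiv := e.toPartialEquiv
  open_source := e.open_source
  open_target := e.open_target
  contMDiffOn_toFun := contMDiffOn_of_mem_maximalAtlas he
  contMDiffOn_invFun := contMDiffOn_symm_of_mem_maximalAtlas he

theorem exists_equiv_dif {e : OpenPartialHomeomorph M (EuclideanSpace ℝ (Fin n))}
    (he : e ∈ IsManifold.maximalAtlas (𝓡 n) ∞ M) {u : EuclideanSpace ℝ (Fin n)}
    (hu : u ∈ e.target) :
    ∃ A : EuclideanSpace ℝ (Fin n) ≃L[ℝ] TangentSpace (𝓡 n) (e.symm u),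
      ∀ {d : ℕ} (f : M → Minkowski d), MDifferentiableAt (𝓡 n) 𝓘(ℝ, Minkowski d) f (e.symm u) →
        ∀ w, dif f (e.symm u) (A w) = fderiv ℝ (f ∘ e.symm) u w := by
  have h1 : IsLocalDiffeomorphAt (𝓡 n) (𝓡 n) ∞ e.symm u :=
    ⟨(chartPartialDiffeomorph he).symm, hu, Set.eqOn_refl _ _⟩
  refine ⟨h1.mfderivToContinuousLinearEquiv (by simp), fun {d} f hf w => ?_⟩
  rw [← mfderiv_eq_fderiv, mfderiv_comp u hf (h1.mdifferentiableAt (by simp))]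
  rfl

/-- The coordinate projection from Minkowski space to hyperbolic space. -/
def Hyp.ofSnd {d : ℕ} (w : Minkowski d) : Hyp d := (Hyp.chartHomeomorph d).symm w.2

theorem Hyp.ofSnd_coe {d : ℕ} (x : Hyp d) : Hyp.ofSnd (x : Minkowski d) = x :=
  (Hyp.chartHomeomorph d).symm_apply_apply x

theorem Hyp.contMDiff_chartHomeomorph (d : ℕ) :
    ContMDiff (𝓡 d) (𝓡 d) ∞ (Hyp.chartHomeomorph d) :=
  contMDiffOn_univ.1 (contMDiffOn_chart (I := 𝓡 d) (n := ∞) (M := Hyp d) (x := Hyp.x₀ d))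

theorem Hyp.contMDiff_chartHomeomorph_symm (d : ℕ) :
    ContMDiff (𝓡 d) (𝓡 d) ∞ (Hyp.chartHomeomorph d).symm :=
  contMDiffOn_univ.1 (contMDiffOn_chart_symm (I := 𝓡 d) (n := ∞) (M := Hyp d) (x := Hyp.x₀ d))

theorem Hyp.contMDiff_ofSnd (d : ℕ) :
    ContMDiff 𝓘(ℝ, Minkowski d) (𝓡 d) ∞ (Hyp.ofSnd (d := d)) :=
  (Hyp.contMDiff_chartHomeomorph_symm d).comp contDiff_snd.contMDiff

theorem contMDiff_hyp_iff {f : M → Hyp d} :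
    ContMDiff (𝓡 n) (𝓡 d) ∞ f ↔
      ContMDiff (𝓡 n) 𝓘(ℝ, Minkowski d) ∞ (fun x => (f x : Minkowski d)) := by
  refine ⟨fun h => Hyp.contMDiff_coe.comp h, fun h => ?_⟩
  have h1 := (Hyp.contMDiff_ofSnd d).comp h
  have h2 : Hyp.ofSnd ∘ (fun x => (f x : Minkowski d)) = f := funext fun x => Hyp.ofSnd_coe _
  rwa [h2] at h1

/-- The differential of an immersion into hyperbolic space is injective. -/
theorem tmap_injective_of_isImmersion [IsManifold (𝓡 n) ∞ M] {ι : M → Hyp d}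
    (hι : Manifold.IsImmersion (𝓡 n) (𝓡 d) ∞ ι) (x : M) :
    Function.Injective (tmap (n := n) ι x) := by
  obtain ⟨F, _, _, φ, ψ, hx, hfx, hφ, hψ, hsub, A, hA⟩ := hι.isImmersionAt x
  have hι' : MDifferentiableAt (𝓡 n) 𝓘(ℝ, Minkowski d) (fun y => (ι y : Minkowski d)) x :=
    ((Hyp.contMDiff_coe.comp hι.contMDiff).mdifferentiable (by simp)) x
  have hr : MDifferentiableAt 𝓘(ℝ, Minkowski d) (𝓡 d) (Hyp.ofSnd (d := d)) (ι x : Minkowski d) :=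
    (Hyp.contMDiff_ofSnd d).mdifferentiable (by simp) _
  have hψ' : MDifferentiableAt (𝓡 d) (𝓡 d) ψ (Hyp.ofSnd (ι x : Minkowski d)) := by
    rw [Hyp.ofSnd_coe]
    exact (contMDiffAt_of_mem_maximalAtlas hψ hfx).mdifferentiableAt (by simp)
  let P : EuclideanSpace ℝ (Fin d) →L[ℝ] EuclideanSpace ℝ (Fin n) :=
    (ContinuousLinearMap.fst ℝ (EuclideanSpace ℝ (Fin n)) F).comp (A.symm : _ →L[ℝ] _)
  have hP : MDifferentiableAt (𝓡 d) (𝓡 n) P (ψ (Hyp.ofSnd (ι x : Minkowski d))) :=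
    P.mdifferentiableAt
  have hG := hP.comp (ι x : Minkowski d) (hψ'.comp (ι x : Minkowski d) hr)
  have heq : (P ∘ ψ ∘ Hyp.ofSnd) ∘ (fun y => (ι y : Minkowski d)) =ᶠ[𝓝 x] φ := by
    filter_upwards [φ.open_source.mem_nhds hx] with y hy
    have h1 := hA (x := φ y) (by simpa using φ.map_source hy)
    simp only [Function.comp_apply, OpenPartialHomeomorph.extend_coe,
      OpenPartialHomeomorph.extend_coe_symm, modelWithCornersSelf_coe, modelWithCornersSelf_coe_symm,
      id, φ.left_inv hy] at h1
    simp [P, Hyp.ofSnd_coe, h1]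
  have h1 : IsLocalDiffeomorphAt (𝓡 n) (𝓡 n) ∞ φ x :=
    ⟨chartPartialDiffeomorph hφ, hx, Set.eqOn_refl _ _⟩
  have h2 : mfderiv (𝓡 n) (𝓡 n) φ x =
      (mfderiv 𝓘(ℝ, Minkowski d) (𝓡 n) (P ∘ ψ ∘ Hyp.ofSnd) (ι x : Minkowski d)).comp
        (mfderiv (𝓡 n) 𝓘(ℝ, Minkowski d) (fun y => (ι y : Minkowski d)) x) := by
    rw [← heq.mfderiv_eq]
    exact mfderiv_comp x hG hι'
  intro v w hvw
  have hvw' : mfderiv (𝓡 n) 𝓘(ℝ, Minkowski d) (fun y => (ι y : Minkowski d)) x v =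
    mfderiv (𝓡 n) 𝓘(ℝ, Minkowski d) (fun y => (ι y : Minkowski d)) x w := hvw
  apply (h1.mfderivToContinuousLinearEquiv (by simp)).injective
  show mfderiv (𝓡 n) (𝓡 n) φ x v = mfderiv (𝓡 n) (𝓡 n) φ x w
  rw [h2]
  exact congrArg
    (mfderiv 𝓘(ℝ, Minkowski d) (𝓡 n) (P ∘ ψ ∘ Hyp.ofSnd) (ι x : Minkowski d)) hvw'

end Manifold

section Hypersurface

variable {n : ℕ} {M : Type*} [TopologicalSpace M] [ChartedSpace (EuclideanSpace ℝ (Fin n)) M]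

variable (n) in
/-- An immersed hypersurface of `ℍ^{n+1}` with a unit normal field. -/
structure IsImmersedHypersurface (ι : M → Hyp (n + 1)) (N : (x : M) → Hyp.tangent (ι x)) :
    Prop where
  contMDiff : ContMDiff (𝓡 n) (𝓡 (n + 1)) ∞ ι
  injective_tmap : ∀ x, Function.Injective (tmap (n := n) ι x)
  isUnitNormal : IsUnitNormal n ι N

namespace IsImmersedHypersurface

variable {ι : M → Hyp (n + 1)} {N : (x : M) → Hyp.tangent (ι x)}

theorem contMDiff_coe (h : IsImmersedHypersurface n ι N) :
    ContMDiff (𝓡 n) 𝓘(ℝ, Minkowski (n + 1)) ∞ (fun x => (ι x : Minkowski (n + 1))) :=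
  Hyp.contMDiff_coe.comp h.contMDiff

theorem mdifferentiable (h : IsImmersedHypersurface n ι N) :
    MDifferentiable (𝓡 n) 𝓘(ℝ, Minkowski (n + 1)) (fun x => (ι x : Minkowski (n + 1))) :=
  h.contMDiff_coe.mdifferentiable (by simp)

theorem isHypersurfacePatch (h : IsImmersedHypersurface n ι N)
    {e : OpenPartialHomeomorph M (EuclideanSpace ℝ (Fin n))}
    (he : e ∈ IsManifold.maximalAtlas (𝓡 n) ∞ M) :
    IsHypersurfacePatch e.target ((fun x => (ι x : Minkowski (n + 1))) ∘ e.symm)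
      ((fun x => (N x : Minkowski (n + 1))) ∘ e.symm) where
  isOpen := e.open_target
  contDiffOn := contMDiffOn_iff_contDiffOn.1
    (h.contMDiff_coe.comp_contMDiffOn (contMDiffOn_symm_of_mem_maximalAtlas he))
  mem_hyp u _ := (ι (e.symm u)).2
  injective u hu := by
    obtain ⟨A, hA⟩ := exists_equiv_dif he hu
    intro v w hvw
    rw [← hA _ (h.mdifferentiable _), ← hA _ (h.mdifferentiable _)] at hvw
    exact A.injective (h.injective_tmap _ hvw)
  continuousOn_normal := h.isUnitNormal.continuous.comp_continuousOn e.continuousOn_symm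
  unit u _ := h.isUnitNormal.unit _
  tangent u _ := (N (e.symm u)).2
  normal u hu v := by
    obtain ⟨A, hA⟩ := exists_equiv_dif he hu
    rw [← hA _ (h.mdifferentiable _)]
    exact h.isUnitNormal.normal _ _

variable [IsManifold (𝓡 n) ∞ M]

theorem contMDiff_normal (h : IsImmersedHypersurface n ι N) :
    ContMDiff (𝓡 n) 𝓘(ℝ, Minkowski (n + 1)) ∞ (fun x => (N x : Minkowski (n + 1))) := by
  intro x
  let e := chartAt (EuclideanSpace ℝ (Fin n)) x
  have he : e ∈ IsManifold.maximalAtlas (𝓡 n) ∞ M := IsManifold.chart_mem_maximalAtlas x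
  have hx : x ∈ e.source := mem_chart_source _ x
  have h1 := (contMDiffOn_iff_contDiffOn.2 (h.isHypersurfacePatch he).contDiffOn_normal).comp
    (contMDiffOn_of_mem_maximalAtlas he) e.mapsTo
  refine (h1.congr fun y hy => ?_).contMDiffAt (e.open_source.mem_nhds hx)
  exact congrArg (fun z => (N z : Minkowski (n + 1))) (e.left_inv hy).symm

theorem mdifferentiable_normal (h : IsImmersedHypersurface n ι N) :
    MDifferentiable (𝓡 n) 𝓘(ℝ, Minkowski (n + 1)) (fun x => (N x : Minkowski (n + 1))) :=
  h.contMDiff_normal.mdifferentiable (by simp)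

/-- Every point has a coordinate patch centred at it, with the differentials there. -/
theorem exists_patch (h : IsImmersedHypersurface n ι N) (x : M) :
    ∃ (V : Set (EuclideanSpace ℝ (Fin n))) (f ν : EuclideanSpace ℝ (Fin n) → Minkowski (n + 1))
      (u : EuclideanSpace ℝ (Fin n)) (A : EuclideanSpace ℝ (Fin n) ≃L[ℝ] TangentSpace (𝓡 n) x),
      IsHypersurfacePatch V f ν ∧ u ∈ V ∧ f u = ι x ∧ ν u = N x ∧
      (∀ w, tmap ι x (A w) = fderiv ℝ f u w) ∧
      ∀ w, dif (fun y => (N y : Minkowski (n + 1))) x (A w) = fderiv ℝ ν u w := by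
  let e := chartAt (EuclideanSpace ℝ (Fin n)) x
  have he : e ∈ IsManifold.maximalAtlas (𝓡 n) ∞ M := IsManifold.chart_mem_maximalAtlas x
  have hx : x ∈ e.source := mem_chart_source _ x
  have hu := e.map_source hx
  have key := exists_equiv_dif he hu
  rw [e.left_inv hx] at key
  obtain ⟨A, hA⟩ := key
  exact ⟨e.target, _, _, e x, A, h.isHypersurfacePatch he, hu,
    congrArg (fun z => (ι z : Minkowski (n + 1))) (e.left_inv hx),
    congrArg (fun z => (N z : Minkowski (n + 1))) (e.left_inv hx),
    fun w => hA _ (h.mdifferentiable _) w, fun w => hA _ (h.mdifferentiable_normal _) w⟩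

theorem mink_tmap (h : IsImmersedHypersurface n ι N) (x : M) (v : TangentSpace (𝓡 n) x) :
    mink (ι x : Minkowski (n + 1)) (tmap ι x v) = 0 := by
  obtain ⟨V, f, ν, u, A, hp, hu, hf, hν, h1, h2⟩ := h.exists_patch x
  obtain ⟨w, rfl⟩ := A.surjective v
  rw [h1, ← hf, hp.mink_fderiv hu]

theorem mink_normal_dif_normal (h : IsImmersedHypersurface n ι N) (x : M)
    (v : TangentSpace (𝓡 n) x) :
    mink (N x : Minkowski (n + 1)) (dif (fun y => (N y : Minkowski (n + 1))) x v) = 0 := by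
  obtain ⟨V, f, ν, u, A, hp, hu, hf, hν, h1, h2⟩ := h.exists_patch x
  obtain ⟨w, rfl⟩ := A.surjective v
  rw [h2, ← hν, hp.mink_normal_fderiv_normal hu]

theorem mink_dif_normal (h : IsImmersedHypersurface n ι N) (x : M)
    (v : TangentSpace (𝓡 n) x) :
    mink (ι x : Minkowski (n + 1)) (dif (fun y => (N y : Minkowski (n + 1))) x v) = 0 := by
  obtain ⟨V, f, ν, u, A, hp, hu, hf, hν, h1, h2⟩ := h.exists_patch x
  obtain ⟨w, rfl⟩ := A.surjective v
  rw [h2, ← hf, hp.mink_fderiv_normal hu]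

theorem mink_tmap_dif_normal_comm (h : IsImmersedHypersurface n ι N) (x : M)
    (v w : TangentSpace (𝓡 n) x) :
    mink (tmap ι x v) (dif (fun y => (N y : Minkowski (n + 1))) x w) =
      mink (tmap ι x w) (dif (fun y => (N y : Minkowski (n + 1))) x v) := by
  obtain ⟨V, f, ν, u, A, hp, hu, hf, hν, h1, h2⟩ := h.exists_patch x
  obtain ⟨v, rfl⟩ := A.surjective v
  obtain ⟨w, rfl⟩ := A.surjective w
  rw [h2, h2, h1, h1, hp.mink_fderiv_fderiv_normal_comm hu]

theorem mink_self_nonneg (h : IsImmersedHypersurface n ι N) (x : M) (v : TangentSpace (𝓡 n) x) :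
    0 ≤ mink (tmap ι x v) (tmap ι x v) :=
  Hyp.mink_self_nonneg (ι x) _ (h.mink_tmap x v)

theorem eq_zero_of_mink_self (h : IsImmersedHypersurface n ι N) {x : M}
    {v : TangentSpace (𝓡 n) x} (hv : mink (tmap ι x v) (tmap ι x v) = 0) : v = 0 :=
  h.injective_tmap x ((Hyp.eq_zero_of_mink_self (ι x) _ (h.mink_tmap x v) hv).trans
    (map_zero _).symm)

theorem exists_decomposition (h : IsImmersedHypersurface n ι N) (x : M)
    (w : Minkowski (n + 1)) :
    ∃ v : TangentSpace (𝓡 n) x, w = (-mink (ι x : Minkowski (n + 1)) w) • (ι x : Minkowski (n + 1)) +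
      mink (N x : Minkowski (n + 1)) w • (N x : Minkowski (n + 1)) + tmap ι x v :=
  exists_frame_decomposition (finrank_tangentSpace x) (ι x) (h.isUnitNormal.unit x) (N x).2
    (h.injective_tmap x) (h.mink_tmap x) (h.isUnitNormal.normal x) w

theorem covDeriv_normal (h : IsImmersedHypersurface n ι N) (x : M) (v : TangentSpace (𝓡 n) x) :
    covDeriv ι N x v = dif (fun y => (N y : Minkowski (n + 1))) x v := by
  rw [covDeriv, Hyp.proj, mink_comm, h.mink_dif_normal, zero_smul, add_zero]

/-- The Weingarten equation `dι(B v) = -dN(v)`. -/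
theorem tmap_shapeOperator (h : IsImmersedHypersurface n ι N) (x : M)
    (v : TangentSpace (𝓡 n) x) :
    tmap ι x (shapeOperator n ι N x v) = -dif (fun y => (N y : Minkowski (n + 1))) x v := by
  have hex : ∃ B : TangentSpace (𝓡 n) x →ₗ[ℝ] TangentSpace (𝓡 n) x,
      ∀ v, tmap ι x (B v) = -covDeriv ι N x v := by
    have hrange : ∀ v : TangentSpace (𝓡 n) x, -dif (fun y => (N y : Minkowski (n + 1))) x v ∈
        LinearMap.range (tmap (n := n) ι x) := by
      intro v
      obtain ⟨w, hw⟩ := h.exists_decomposition x (-dif (fun y => (N y : Minkowski (n + 1))) x v)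
      rw [mink_neg_right, mink_neg_right, h.mink_dif_normal, h.mink_normal_dif_normal] at hw
      exact ⟨w, by simpa using hw.symm⟩
    let E := LinearEquiv.ofInjective (tmap (n := n) ι x) (h.injective_tmap x)
    refine ⟨E.symm.toLinearMap.comp (LinearMap.codRestrict _
      (-dif (fun y => (N y : Minkowski (n + 1))) x) hrange), fun v => ?_⟩
    have h1 : ∀ y, tmap ι x (E.symm y) = y := fun y =>
      congrArg Subtype.val (E.apply_symm_apply y)
    rw [h.covDeriv_normal]
    exact h1 _
  obtain ⟨B, hB⟩ := hex
  rw [shapeOperator_eq n ι N x (h.injective_tmap x) B hB, hB, h.covDeriv_normal]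

/-- The first fundamental form. -/
def firstForm (ι : M → Hyp (n + 1)) (x : M) :
    TangentSpace (𝓡 n) x →ₗ[ℝ] TangentSpace (𝓡 n) x →ₗ[ℝ] ℝ :=
  LinearMap.mk₂ ℝ (fun v w => mink (tmap ι x v) (tmap ι x w))
    (fun _ _ _ => by rw [map_add, mink_add_left]) (fun _ _ _ => by rw [map_smul, mink_smul_left]; rfl)
    (fun _ _ _ => by rw [map_add, mink_add_right])
    (fun _ _ _ => by rw [map_smul, mink_smul_right]; rfl)

omit [IsManifold (𝓡 n) ∞ M] in
@[simp] theorem firstForm_apply (x : M) (v w : TangentSpace (𝓡 n) x) :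
    firstForm ι x v w = mink (tmap ι x v) (tmap ι x w) := rfl

/-- Principal directions. -/
theorem exists_principal_basis (h : IsImmersedHypersurface n ι N) (x : M) :
    ∃ (b : Module.Basis (Fin n) ℝ (TangentSpace (𝓡 n) x)) (lam : Fin n → ℝ),
      (∀ i, shapeOperator n ι N x (b i) = lam i • b i) ∧
      ∀ i j, mink (tmap ι x (b i)) (tmap ι x (b j)) = if i = j then 1 else 0 := by
  refine exists_orthonormal_eigenbasis (finrank_tangentSpace x) (firstForm ι x)
    (fun v w => mink_comm _ _) (h.mink_self_nonneg x) (fun v hv => h.eq_zero_of_mink_self hv) _ ?_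
  intro v w
  rw [firstForm_apply, firstForm_apply, h.tmap_shapeOperator, h.tmap_shapeOperator, mink_neg_left,
    mink_neg_right, mink_comm, h.mink_tmap_dif_normal_comm]

end IsImmersedHypersurface

end Hypersurface

section Equidistant

theorem bilin_apply_of_diagonal {m : ℕ} {V : Type*} [AddCommGroup V] [Module ℝ V]
    (g : V →ₗ[ℝ] V →ₗ[ℝ] ℝ) (b : Module.Basis (Fin m) ℝ V)
    (hg : ∀ i j, g (b i) (b j) = if i = j then 1 else 0) {S T : V →ₗ[ℝ] V} {σ τ : Fin m → ℝ}
    (hS : ∀ i, S (b i) = σ i • b i) (hT : ∀ i, T (b i) = τ i • b i) (v : V) :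
    g (S v) (T v) = ∑ i, σ i * τ i * (b.repr v i) ^ 2 := by
  conv_lhs => rw [← b.sum_repr v]
  simp only [map_sum, map_smul, hS, hT, LinearMap.sum_apply, LinearMap.smul_apply, hg, smul_eq_mul,
    mul_ite, mul_one, mul_zero, Finset.sum_ite_eq', Finset.mem_univ, if_true]
  refine Finset.sum_congr rfl fun i _ => ?_
  ring

variable {n d : ℕ} {M : Type*} [TopologicalSpace M] [ChartedSpace (EuclideanSpace ℝ (Fin n)) M]

theorem dif_smul_add_smul {f g : M → Minkowski d} {x : M}
    (hf : MDifferentiableAt (𝓡 n) 𝓘(ℝ, Minkowski d) f x)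
    (hg : MDifferentiableAt (𝓡 n) 𝓘(ℝ, Minkowski d) g x) (a b : ℝ) (v : TangentSpace (𝓡 n) x) :
    dif (fun y => a • f y + b • g y) x v = a • dif f x v + b • dif g x v := by
  have h := ((hf.hasMFDerivAt.const_smul a).add (hg.hasMFDerivAt.const_smul b)).mfderiv
  exact DFunLike.congr_fun h v

theorem Hyp.tnorm_smul (t : ℝ) (v : Minkowski d) : Hyp.tnorm (t • v) = |t| * Hyp.tnorm v := by
  rw [Hyp.tnorm, Hyp.tnorm, mink_smul_left, mink_smul_right, ← mul_assoc,
    Real.sqrt_mul (mul_self_nonneg t), Real.sqrt_mul_self_eq_abs]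

theorem contDiff_hyperbolic_combination :
    ContDiff ℝ ∞ fun z : Minkowski d × Minkowski d × ℝ =>
      Real.cosh z.2.2 • z.1 + Real.sinh z.2.2 • z.2.1 :=
  ((Real.contDiff_cosh.comp contDiff_snd.snd).smul contDiff_fst).add
    ((Real.contDiff_sinh.comp contDiff_snd.snd).smul contDiff_snd.fst)

omit [TopologicalSpace M] in
theorem normalExp_coe {ι : M → Hyp d} {N : (x : M) → Hyp.tangent (ι x)}
    (hN : ∀ x, mink (N x : Minkowski d) (N x) = 1) (p : M × ℝ) :
    (normalExp ι N p : Minkowski d) =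
      Real.cosh p.2 • (ι p.1 : Minkowski d) + Real.sinh p.2 • (N p.1 : Minkowski d) := by
  obtain ⟨x, t⟩ := p
  have h1 : Hyp.tnorm (t • (N x : Minkowski d)) = |t| := by
    rw [Hyp.tnorm_smul, Hyp.tnorm, hN, Real.sqrt_one, mul_one]
  simp only [normalExp, Hyp.exp, Submodule.coe_smul, h1, Real.cosh_abs, smul_smul]
  congr 2
  rcases eq_or_ne t 0 with rfl | ht
  · simp
  · rcases abs_choice t with h | h <;> rw [h]
    · field_simp
    · rw [Real.sinh_neg]; field_simp

namespace IsImmersedHypersurface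

variable {ι : M → Hyp (n + 1)} {N : (x : M) → Hyp.tangent (ι x)}

theorem equidistant_coe (h : IsImmersedHypersurface n ι N) (t : ℝ) (x : M) :
    (equidistant ι N t x : Minkowski (n + 1)) =
      Real.cosh t • (ι x : Minkowski (n + 1)) + Real.sinh t • (N x : Minkowski (n + 1)) :=
  normalExp_coe h.isUnitNormal.unit (x, t)

/-- Lorentzian products in the plane spanned by `ι x` and `N x`. -/
theorem mink_plane (h : IsImmersedHypersurface n ι N) (x : M) (a b a' b' : ℝ) :
    mink (a • (ι x : Minkowski (n + 1)) + b • (N x : Minkowski (n + 1)))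
      (a' • (ι x : Minkowski (n + 1)) + b' • (N x : Minkowski (n + 1))) = b * b' - a * a' := by
  have h1 : mink (ι x : Minkowski (n + 1)) (N x) = 0 := (N x).2
  simp only [mink_add_left, mink_add_right, mink_smul_left, mink_smul_right, h1,
    mink_comm (N x : Minkowski (n + 1)) (ι x), (ι x).2.1, h.isUnitNormal.unit]
  ring

/-- The unit normal of `Σ_t` pointing in the direction where `t` increases. -/
def equidistantNormal (h : IsImmersedHypersurface n ι N) (t : ℝ) (x : M) :
    Hyp.tangent (equidistant ι N t x) :=
  ⟨Real.sinh t • (ι x : Minkowski (n + 1)) + Real.cosh t • (N x : Minkowski (n + 1)), by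
    show mink _ _ = 0
    rw [h.equidistant_coe, h.mink_plane]
    ring⟩

theorem hasDerivAt_equidistant (h : IsImmersedHypersurface n ι N) (t : ℝ) (x : M) :
    HasDerivAt (fun s => (equidistant ι N s x : Minkowski (n + 1)))
      (h.equidistantNormal t x : Minkowski (n + 1)) t := by
  simp only [h.equidistant_coe]
  exact ((Real.hasDerivAt_cosh t).smul_const _).add ((Real.hasDerivAt_sinh t).smul_const _)

variable [IsManifold (𝓡 n) ∞ M]

theorem tmap_equidistant (h : IsImmersedHypersurface n ι N) (t : ℝ) (x : M)
    (v : TangentSpace (𝓡 n) x) :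
    tmap (equidistant ι N t) x v = tmap ι x (Real.cosh t • v -
      Real.sinh t • shapeOperator n ι N x v) := by
  have h1 : tmap (equidistant ι N t) x v = dif (fun y => Real.cosh t • (ι y : Minkowski (n + 1)) +
      Real.sinh t • (N y : Minkowski (n + 1))) x v := by
    rw [tmap]
    congr 2
    funext y
    exact h.equidistant_coe t y
  rw [h1, dif_smul_add_smul (h.mdifferentiable x) (h.mdifferentiable_normal x), map_sub, map_smul,
    map_smul, h.tmap_shapeOperator, smul_neg, sub_neg_eq_add]
  rfl

theorem dif_equidistantNormal (h : IsImmersedHypersurface n ι N) (t : ℝ) (x : M)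
    (v : TangentSpace (𝓡 n) x) :
    dif (fun y => (h.equidistantNormal t y : Minkowski (n + 1))) x v =
      tmap ι x (Real.sinh t • v - Real.cosh t • shapeOperator n ι N x v) := by
  have h1 : dif (fun y => (h.equidistantNormal t y : Minkowski (n + 1))) x v =
      dif (fun y => Real.sinh t • (ι y : Minkowski (n + 1)) +
      Real.cosh t • (N y : Minkowski (n + 1))) x v := rfl
  rw [h1, dif_smul_add_smul (h.mdifferentiable x) (h.mdifferentiable_normal x), map_sub, map_smul,
    map_smul, h.tmap_shapeOperator, smul_neg, sub_neg_eq_add]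
  rfl

omit [IsManifold (𝓡 n) ∞ M] in
theorem abs_le_one_of_apply_eq_smul (hs : WeaklySmallCurvature n ι N) {x : M}
    {v : TangentSpace (𝓡 n) x} (hv : v ≠ 0) {c : ℝ} (hc : shapeOperator n ι N x v = c • v) :
    |c| ≤ 1 :=
  hs x c (Module.End.hasEigenvalue_of_hasEigenvector
    ⟨Module.End.mem_eigenspace_iff.2 hc, hv⟩)

omit [IsManifold (𝓡 n) ∞ M] in
theorem eq_zero_of_cosh_smul_eq (hs : WeaklySmallCurvature n ι N) {x : M}
    {v : TangentSpace (𝓡 n) x} {t : ℝ}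
    (hv : Real.cosh t • v = Real.sinh t • shapeOperator n ι N x v) : v = 0 := by
  by_contra hne
  have hc := Real.cosh_pos t
  have hs0 : Real.sinh t ≠ 0 := by
    intro h0
    rw [h0, zero_smul, smul_eq_zero] at hv
    exact hv.elim hc.ne' hne
  have h1 : shapeOperator n ι N x v = (Real.cosh t / Real.sinh t) • v := by
    rw [div_eq_inv_mul, mul_smul, hv, smul_smul, inv_mul_cancel₀ hs0, one_smul]
  have h2 := abs_le_one_of_apply_eq_smul hs hne h1
  rw [abs_div, abs_of_pos hc, div_le_one (abs_pos.2 hs0)] at h2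
  have h3 := Real.cosh_sq t
  have h4 := abs_nonneg (Real.sinh t)
  have h5 := sq_abs (Real.sinh t)
  nlinarith

theorem tmap_equidistant_injective (h : IsImmersedHypersurface n ι N)
    (hs : WeaklySmallCurvature n ι N) (t : ℝ) (x : M) :
    Function.Injective (tmap (n := n) (equidistant ι N t) x) := by
  rw [← LinearMap.ker_eq_bot, LinearMap.ker_eq_bot']
  intro v hv
  rw [h.tmap_equidistant] at hv
  exact eq_zero_of_cosh_smul_eq hs (sub_eq_zero.1 (h.injective_tmap x (hv.trans (map_zero _).symm)))

/-- Equidistant hypersurfaces are immersed. -/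
theorem isImmersedHypersurface_equidistant (h : IsImmersedHypersurface n ι N) (hs : WeaklySmallCurvature n ι N) (t : ℝ) :
    IsImmersedHypersurface n (equidistant ι N t) (h.equidistantNormal t) where
  contMDiff := by
    refine contMDiff_hyp_iff.2 ?_
    simp only [h.equidistant_coe]
    exact (contDiff_hyperbolic_combination (d := n + 1)).contMDiff.comp
      (h.contMDiff_coe.prodMk_space (h.contMDiff_normal.prodMk_space contMDiff_const))
  injective_tmap := h.tmap_equidistant_injective hs t
  isUnitNormal :=
    { continuous := (h.contMDiff_coe.continuous.const_smul (Real.sinh t)).add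
        (h.contMDiff_normal.continuous.const_smul (Real.cosh t))
      unit := fun x => by
        have h1 := Real.cosh_sq t
        simp only [equidistantNormal, h.mink_plane]
        linarith
      normal := fun x v => by
        rw [h.tmap_equidistant]
        simp only [equidistantNormal, mink_add_left, mink_smul_left, h.mink_tmap,
          h.isUnitNormal.normal, mul_zero, add_zero] }

theorem isForwardUnitNormal (h : IsImmersedHypersurface n ι N) (hs : WeaklySmallCurvature n ι N)
    (t : ℝ) : IsForwardUnitNormal n ι N t (h.equidistantNormal t) :=
  ⟨(h.isImmersedHypersurface_equidistant hs t).isUnitNormal, h.hasDerivAt_equidistant t⟩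

/-- The shape operators of `Σ` and `Σ_t` satisfy `(cosh t - sinh t B) B_t = cosh t B - sinh t`. -/
theorem shapeOperator_equidistant (h : IsImmersedHypersurface n ι N)
    (hs : WeaklySmallCurvature n ι N) (t : ℝ) (x : M) (v : TangentSpace (𝓡 n) x) :
    Real.cosh t • shapeOperator n (equidistant ι N t) (h.equidistantNormal t) x v -
      Real.sinh t • shapeOperator n ι N x
        (shapeOperator n (equidistant ι N t) (h.equidistantNormal t) x v) =
      Real.cosh t • shapeOperator n ι N x v - Real.sinh t • v := by
  apply h.injective_tmap x
  rw [← h.tmap_equidistant, (h.isImmersedHypersurface_equidistant hs t).tmap_shapeOperator, h.dif_equidistantNormal,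
    ← map_neg, neg_sub]

/-- Equidistant hypersurfaces have weakly small curvature. -/
theorem weaklySmallCurvature_equidistant (h : IsImmersedHypersurface n ι N)
    (hs : WeaklySmallCurvature n ι N) (t : ℝ) :
    WeaklySmallCurvature n (equidistant ι N t) (h.equidistantNormal t) := by
  intro x μ hμ
  obtain ⟨v, hv, hv0⟩ := hμ.exists_hasEigenvector
  have hv' := Module.End.mem_eigenspace_iff.1 hv
  have h1 := h.shapeOperator_equidistant hs t x v
  rw [hv', map_smul] at h1
  set c := Real.cosh t
  set s := Real.sinh t
  have hcs : c ^ 2 = s ^ 2 + 1 := Real.cosh_sq t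
  have h2 : (c + μ * s) • shapeOperator n ι N x v = (s + μ * c) • v := by
    rw [add_smul, add_smul, ← sub_eq_zero]
    rw [← sub_eq_zero] at h1
    rw [← neg_eq_zero, ← h1]
    module
  have h3 : c + μ * s ≠ 0 := by
    intro h0
    rw [h0, zero_smul, eq_comm, smul_eq_zero] at h2
    have h4 := h2.resolve_right hv0
    have h5 : c * (c + μ * s) - s * (s + μ * c) = 1 := by linarith
    rw [h0, h4] at h5
    simp at h5
  have h4 : shapeOperator n ι N x v = ((s + μ * c) / (c + μ * s)) • v := by
    rw [div_eq_inv_mul, mul_smul, ← h2, smul_smul, inv_mul_cancel₀ h3, one_smul]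
  have h5 := abs_le_one_of_apply_eq_smul hs hv0 h4
  rw [abs_div, div_le_one (abs_pos.2 h3)] at h5
  have h6 := sq_le_sq.2 h5
  rw [← sq_le_one_iff_abs_le_one]
  nlinarith

end IsImmersedHypersurface

end Equidistant

section LocalDiffeomorph

theorem exists_partialDiffeomorph_of_contDiffOn {E F : Type*} [NormedAddCommGroup E]
    [NormedSpace ℝ E] [CompleteSpace E] [NormedAddCommGroup F] [NormedSpace ℝ F] {U : Set E}
    (hU : IsOpen U) {G : E → F} (hG : ContDiffOn ℝ ∞ G U)
    (hG' : ∀ z ∈ U, ∃ A : E ≃L[ℝ] F, HasFDerivAt G (A : E →L[ℝ] F) z) {z : E} (hz : z ∈ U) :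
    ∃ Φ : PartialDiffeomorph 𝓘(ℝ, E) 𝓘(ℝ, F) E F ∞, z ∈ Φ.source ∧ Φ.source ⊆ U ∧
      ∀ y, Φ y = G y := by
  obtain ⟨A, hA⟩ := hG' z hz
  have hGz := hG.contDiffAt (hU.mem_nhds hz)
  let e₀ := hGz.toOpenPartialHomeomorph G hA (by simp)
  have he₀ : ∀ y, e₀ y = G y := fun y => rfl
  let e := e₀.restrOpen U hU
  have hsub : e.source ⊆ U := Set.inter_subset_right
  refine ⟨⟨e.toPartialEquiv, e.open_source, e.open_target, ?_, ?_⟩, ?_, hsub, fun y => rfl⟩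
  · exact (hG.mono hsub).contMDiffOn
  · refine ContDiffOn.contMDiffOn fun y hy => ContDiffAt.contDiffWithinAt ?_
    have h1 := hsub (e.map_target hy)
    obtain ⟨A', hA'⟩ := hG' _ h1
    exact e.contDiffAt_symm hy hA' (hG.contDiffAt (hU.mem_nhds h1))
  · exact ⟨hGz.mem_toOpenPartialHomeomorph_source hA (by simp), hz⟩

variable {n : ℕ} {M : Type*} [TopologicalSpace M] [ChartedSpace (EuclideanSpace ℝ (Fin n)) M]

/-- The product of a chart with the identity of `ℝ`. -/
def chartProdPartialDiffeomorph {e : OpenPartialHomeomorph M (EuclideanSpace ℝ (Fin n))}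
    (he : e ∈ IsManifold.maximalAtlas (𝓡 n) ∞ M) :
    PartialDiffeomorph ((𝓡 n).prod 𝓘(ℝ, ℝ)) 𝓘(ℝ, EuclideanSpace ℝ (Fin n) × ℝ) (M × ℝ)
      (EuclideanSpace ℝ (Fin n) × ℝ) ∞ where
  toPartialEquiv := e.toPartialEquiv.prod (PartialEquiv.refl ℝ)
  open_source := e.open_source.prod isOpen_univ
  open_target := e.open_target.prod isOpen_univ
  contMDiffOn_toFun := by
    refine ContMDiffOn.prodMk_space ?_ contMDiff_snd.contMDiffOn
    exact (contMDiffOn_of_mem_maximalAtlas he).comp contMDiff_fst.contMDiffOn fun p hp => hp.1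
  contMDiffOn_invFun := by
    refine ContMDiffOn.prodMk ?_ contDiff_snd.contMDiff.contMDiffOn
    exact (contMDiffOn_symm_of_mem_maximalAtlas he).comp contDiff_fst.contMDiff.contMDiffOn
      fun p hp => hp.1

namespace IsHypersurfacePatch

variable {V : Set (EuclideanSpace ℝ (Fin n))}
  {f ν : EuclideanSpace ℝ (Fin n) → Minkowski (n + 1)}

/-- The normal exponential map of a patch, in Minkowski space. -/
def expMap (f ν : EuclideanSpace ℝ (Fin n) → Minkowski (n + 1))
    (z : EuclideanSpace ℝ (Fin n) × ℝ) : Minkowski (n + 1) :=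
  Real.cosh z.2 • f z.1 + Real.sinh z.2 • ν z.1

theorem contDiffOn_expMap (h : IsHypersurfacePatch V f ν) :
    ContDiffOn ℝ ∞ (expMap f ν) (V ×ˢ Set.univ) := by
  have h1 : ContDiffOn ℝ ∞ (fun z : EuclideanSpace ℝ (Fin n) × ℝ => f z.1) (V ×ˢ Set.univ) :=
    h.contDiffOn.comp contDiff_fst.contDiffOn fun z hz => hz.1
  have h2 : ContDiffOn ℝ ∞ (fun z : EuclideanSpace ℝ (Fin n) × ℝ => ν z.1) (V ×ˢ Set.univ) :=
    h.contDiffOn_normal.comp contDiff_fst.contDiffOn fun z hz => hz.1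
  exact contDiff_hyperbolic_combination.comp_contDiffOn (h1.prodMk (h2.prodMk contDiffOn_snd))

theorem hasFDerivAt_expMap (h : IsHypersurfacePatch V f ν) {z : EuclideanSpace ℝ (Fin n) × ℝ}
    (hz : z.1 ∈ V) :
    ∃ D : EuclideanSpace ℝ (Fin n) × ℝ →L[ℝ] Minkowski (n + 1), HasFDerivAt (expMap f ν) D z ∧
      ∀ v r, D (v, r) = Real.cosh z.2 • fderiv ℝ f z.1 v + Real.sinh z.2 • fderiv ℝ ν z.1 v +
        r • (Real.sinh z.2 • f z.1 + Real.cosh z.2 • ν z.1) := by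
  have h1 : HasFDerivAt (fun z : EuclideanSpace ℝ (Fin n) × ℝ => f z.1) _ z :=
    (h.hasFDerivAt hz).comp z hasFDerivAt_fst
  have h2 : HasFDerivAt (fun z : EuclideanSpace ℝ (Fin n) × ℝ => ν z.1) _ z :=
    (h.hasFDerivAt_normal hz).comp z hasFDerivAt_fst
  have h3 : HasFDerivAt (fun z : EuclideanSpace ℝ (Fin n) × ℝ => Real.cosh z.2) _ z :=
    hasFDerivAt_snd.cosh
  have h4 : HasFDerivAt (fun z : EuclideanSpace ℝ (Fin n) × ℝ => Real.sinh z.2) _ z :=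
    hasFDerivAt_snd.sinh
  refine ⟨_, (h3.smul h1).add (h4.smul h2), fun v r => ?_⟩
  simp
  module

theorem exists_equiv_hasFDerivAt_expMap_snd (h : IsHypersurfacePatch V f ν)
    {z : EuclideanSpace ℝ (Fin n) × ℝ} (hz : z.1 ∈ V)
    (hreg : ∀ v, Real.cosh z.2 • fderiv ℝ f z.1 v + Real.sinh z.2 • fderiv ℝ ν z.1 v = 0 → v = 0)
    (hfst : expMap f ν z ∈ {w : Minkowski (n + 1) | 0 < w.1}) :
    ∃ A : (EuclideanSpace ℝ (Fin n) × ℝ) ≃L[ℝ] EuclideanSpace ℝ (Fin (n + 1)),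
      HasFDerivAt (fun y => (expMap f ν y).2)
        (A : EuclideanSpace ℝ (Fin n) × ℝ →L[ℝ] EuclideanSpace ℝ (Fin (n + 1))) z := by
  obtain ⟨D, hD, hD'⟩ := h.hasFDerivAt_expMap hz
  have hsnd : HasFDerivAt (fun y => (expMap f ν y).2) _ z := hD.snd
  set D₂ := (ContinuousLinearMap.snd ℝ ℝ (EuclideanSpace ℝ (Fin (n + 1)))).comp D
  have hinj : Function.Injective D₂.toLinearMap := by
    rw [← LinearMap.ker_eq_bot, LinearMap.ker_eq_bot']
    rintro ⟨v, r⟩ hvr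
    have hvr2 : (D (v, r)).2 = 0 := hvr
    have h0 : mink (expMap f ν z) (D (v, r)) = 0 := by
      simp only [hD', expMap, mink_add_left, mink_add_right, mink_smul_left, mink_smul_right,
        h.mink_fderiv hz, h.mink_fderiv_normal hz, h.normal _ hz, h.mink_normal_fderiv_normal hz,
        h.tangent _ hz, mink_comm (ν z.1) (f z.1), (h.mem_hyp _ hz).1, h.unit _ hz]
      ring
    have h1 : (D (v, r)).1 = 0 := by
      rw [mink, hvr2, inner_zero_right, zero_sub, neg_eq_zero, mul_eq_zero] at h0
      exact h0.resolve_left (ne_of_gt hfst)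
    have h2 : D (v, r) = 0 := Prod.ext h1 hvr2
    have h3 : mink (Real.sinh z.2 • f z.1 + Real.cosh z.2 • ν z.1) (D (v, r)) = r := by
      have hcs := Real.cosh_sq z.2
      simp only [hD', mink_add_left, mink_add_right, mink_smul_left, mink_smul_right,
        h.mink_fderiv hz, h.mink_fderiv_normal hz, h.normal _ hz, h.mink_normal_fderiv_normal hz,
        h.tangent _ hz, mink_comm (ν z.1) (f z.1), (h.mem_hyp _ hz).1, h.unit _ hz]
      linear_combination r * hcs
    rw [h2, mink_zero_right] at h3
    subst h3
    rw [hD', zero_smul, add_zero] at h2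
    rw [hreg v h2]
    rfl
  have hdim : Module.finrank ℝ (EuclideanSpace ℝ (Fin n) × ℝ) =
      Module.finrank ℝ (EuclideanSpace ℝ (Fin (n + 1))) := by
    simp [Module.finrank_prod]
  exact ⟨(LinearEquiv.ofInjectiveOfFinrankEq _ hinj hdim).toContinuousLinearEquiv, hsnd⟩

end IsHypersurfacePatch

namespace IsImmersedHypersurface

variable {ι : M → Hyp (n + 1)} {N : (x : M) → Hyp.tangent (ι x)}

/-- The normal exponential map of a hypersurface of weakly small curvature is a local
diffeomorphism. -/
theorem isLocalDiffeomorph_normalExp [IsManifold (𝓡 n) ∞ M] (h : IsImmersedHypersurface n ι N)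
    (hs : WeaklySmallCurvature n ι N) :
    IsLocalDiffeomorph ((𝓡 n).prod 𝓘(ℝ, ℝ)) (𝓡 (n + 1)) ∞ (normalExp ι N) := by
  rintro ⟨x, t⟩
  let e := chartAt (EuclideanSpace ℝ (Fin n)) x
  have he : e ∈ IsManifold.maximalAtlas (𝓡 n) ∞ M := IsManifold.chart_mem_maximalAtlas x
  have hx : x ∈ e.source := mem_chart_source _ x
  have hp := h.isHypersurfacePatch he
  set f := (fun x => (ι x : Minkowski (n + 1))) ∘ e.symm
  set ν := (fun x => (N x : Minkowski (n + 1))) ∘ e.symm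
  have hF : ∀ z : EuclideanSpace ℝ (Fin n) × ℝ, IsHypersurfacePatch.expMap f ν z =
      normalExp ι N (e.symm z.1, z.2) := fun z =>
    (normalExp_coe h.isUnitNormal.unit (e.symm z.1, z.2)).symm
  have hreg : ∀ z ∈ e.target ×ˢ (Set.univ : Set ℝ), ∃ A : (EuclideanSpace ℝ (Fin n) × ℝ) ≃L[ℝ]
      EuclideanSpace ℝ (Fin (n + 1)), HasFDerivAt (fun y => (IsHypersurfacePatch.expMap f ν y).2)
        (A : EuclideanSpace ℝ (Fin n) × ℝ →L[ℝ] EuclideanSpace ℝ (Fin (n + 1))) z := by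
    intro z hz
    refine hp.exists_equiv_hasFDerivAt_expMap_snd hz.1 (fun v hv => ?_) ?_
    · obtain ⟨A, hA⟩ := exists_equiv_dif he hz.1
      rw [← hA _ (h.mdifferentiable _), ← hA _ (h.mdifferentiable_normal _),
        ← dif_smul_add_smul (h.mdifferentiable _) (h.mdifferentiable_normal _)] at hv
      have h1 : tmap (equidistant ι N z.2) (e.symm z.1) (A v) = 0 := by
        rw [← hv, tmap]
        congr 2
        funext y
        exact h.equidistant_coe z.2 y
      exact (map_eq_zero_iff A A.injective).1
        (h.tmap_equidistant_injective hs z.2 _ (h1.trans (map_zero _).symm))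
    · rw [hF]
      exact (normalExp ι N _).2.2
  obtain ⟨Φ, hΦx, hΦsub, hΦ⟩ := exists_partialDiffeomorph_of_contDiffOn
    (e.open_target.prod isOpen_univ) hp.contDiffOn_expMap.snd hreg
    (z := (e x, t)) ⟨e.map_source hx, Set.mem_univ _⟩
  let Ψ : PartialDiffeomorph (𝓡 (n + 1)) (𝓡 (n + 1)) (EuclideanSpace ℝ (Fin (n + 1)))
      (Hyp (n + 1)) ∞ :=
    { (Hyp.chartHomeomorph (n + 1)).symm.toEquiv.toPartialEquiv with
      open_source := isOpen_univ
      open_target := isOpen_univ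
      contMDiffOn_toFun := (Hyp.contMDiff_chartHomeomorph_symm (n + 1)).contMDiffOn
      contMDiffOn_invFun := (Hyp.contMDiff_chartHomeomorph (n + 1)).contMDiffOn }
  refine ⟨((chartProdPartialDiffeomorph he).trans Φ).trans Ψ, ⟨⟨⟨hx, Set.mem_univ _⟩, hΦx⟩,
    Set.mem_univ _⟩, ?_⟩
  rintro ⟨y, s⟩ ⟨⟨⟨hy, -⟩, -⟩, -⟩
  have h1 : (((chartProdPartialDiffeomorph he).trans Φ).trans Ψ) (y, s) =
      (Hyp.chartHomeomorph (n + 1)).symm (Φ (e y, s)) := rfl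
  have h2 : (IsHypersurfacePatch.expMap f ν (e y, s)) = normalExp ι N (y, s) := by
    rw [hF]
    simp only
    rw [e.left_inv hy]
  rw [h1, hΦ, h2]
  exact ((Hyp.chartHomeomorph (n + 1)).symm_apply_apply _).symm

end IsImmersedHypersurface

end LocalDiffeomorph

section InjectiveLocalDiffeomorph

variable {E F H₁ H₂ M N : Type*} [NormedAddCommGroup E] [NormedSpace ℝ E]
  [NormedAddCommGroup F] [NormedSpace ℝ F] [TopologicalSpace H₁] [TopologicalSpace H₂]
  {I : ModelWithCorners ℝ E H₁} {J : ModelWithCorners ℝ F H₂}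
  [TopologicalSpace M] [ChartedSpace H₁ M] [TopologicalSpace N] [ChartedSpace H₂ N]
  {k : WithTop ℕ∞} {f : M → N}

/-- An injective local diffeomorphism is a diffeomorphism onto its image. -/
theorem IsLocalDiffeomorph.exists_diffeomorph_opens (hf : IsLocalDiffeomorph I J ∞ f)
    (hinj : Function.Injective f) :
    ∃ (U : TopologicalSpace.Opens N) (Φ : Diffeomorph I J M U ∞),
      (U : Set N) = Set.range f ∧ ∀ p, (Φ p : N) = f p := by
  let U : TopologicalSpace.Opens N := hf.image
  let ε : M ≃ U := Equiv.ofInjective f hinj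
  have hε : ∀ p, (ε p : N) = f p := fun p => rfl
  refine ⟨U, ⟨ε, ?_, ?_⟩, rfl, hε⟩
  · exact (ContMDiff.subtypeVal_comp_iff U ε).1 hf.contMDiff
  · intro y
    obtain ⟨Φ, hx, hΦ⟩ := hf (ε.symm y)
    have hy : (y : N) ∈ Φ.target := by
      have h2 : f (ε.symm y) = y := by rw [← hε, ε.apply_symm_apply]
      have h3 := hΦ hx
      rw [h2] at h3
      rw [h3]
      exact Φ.map_source hx
    have h1 : ContMDiffAt J I ∞ Φ.symm (y : N) :=
      Φ.symm.contMDiffOn.contMDiffAt (Φ.open_target.mem_nhds hy)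
    have h2 : ContMDiffAt J I ∞ (Φ.symm ∘ ((↑) : U → N)) y :=
      h1.comp y contMDiff_subtype_val.contMDiffAt
    refine h2.congr_of_eventuallyEq ?_
    filter_upwards [continuous_subtype_val.continuousAt.preimage_mem_nhds
      (Φ.open_target.mem_nhds hy)] with z hz
    apply hinj
    have h3 : f (ε.symm z) = z := by rw [← hε, ε.apply_symm_apply]
    have h4 : Φ.symm (z : N) ∈ Φ.source := Φ.map_target hz
    have h5 : f (Φ.symm (z : N)) = Φ (Φ.symm (z : N)) := hΦ h4
    have h6 : Φ (Φ.symm (z : N)) = z := Φ.right_inv hz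
    show f (ε.symm z) = f (Φ.symm (z : N))
    rw [h3, h5, h6]

theorem IsLocalDiffeomorph.exists_diffeomorph (hf : IsLocalDiffeomorph I J k f)
    (hbij : Function.Bijective f) : ∃ Φ : Diffeomorph I J M N k, ∀ p, Φ p = f p :=
  ⟨hf.diffeomorphOfBijective hbij, fun _ => rfl⟩

end InjectiveLocalDiffeomorph

section Slices

variable {n : ℕ} {M : Type*} [TopologicalSpace M] [ChartedSpace (EuclideanSpace ℝ (Fin n)) M]

/-- The slices of a local diffeomorphism `M × ℝ → ℍ^{n+1}` are immersions. -/
theorem isImmersion_slice [IsManifold (𝓡 n) ∞ M] {G : M × ℝ → Hyp (n + 1)}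
    (hG : IsLocalDiffeomorph ((𝓡 n).prod 𝓘(ℝ, ℝ)) (𝓡 (n + 1)) ∞ G) (t : ℝ) :
    Manifold.IsImmersion (𝓡 n) (𝓡 (n + 1)) ∞ fun x => G (x, t) := by
  have hdim : Module.finrank ℝ (EuclideanSpace ℝ (Fin n) × ℝ) =
      Module.finrank ℝ (EuclideanSpace ℝ (Fin (n + 1))) := by
    simp [Module.finrank_prod]
  let A : (EuclideanSpace ℝ (Fin n) × ℝ) ≃L[ℝ] EuclideanSpace ℝ (Fin (n + 1)) :=
    ContinuousLinearEquiv.ofFinrankEq hdim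
  have key : Manifold.IsImmersionOfComplement ℝ (𝓡 n) (𝓡 (n + 1)) ∞ fun x => G (x, t) := by
    intro x
    obtain ⟨Φ, hx, hΦ⟩ := hG (x, t)
    let e := chartAt (EuclideanSpace ℝ (Fin n)) x
    have he : e ∈ IsManifold.maximalAtlas (𝓡 n) ∞ M := IsManifold.chart_mem_maximalAtlas x
    have hxe : x ∈ e.source := mem_chart_source _ x
    let T : PartialDiffeomorph 𝓘(ℝ, EuclideanSpace ℝ (Fin n) × ℝ) (𝓡 (n + 1))
        (EuclideanSpace ℝ (Fin n) × ℝ) (EuclideanSpace ℝ (Fin (n + 1))) ∞ :=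
      { (Equiv.addRight ((0, -t) : EuclideanSpace ℝ (Fin n) × ℝ)).trans
          A.toEquiv |>.toPartialEquiv with
        open_source := isOpen_univ
        open_target := isOpen_univ
        contMDiffOn_toFun := (A.contDiff.comp (contDiff_id.add contDiff_const)).contMDiff.contMDiffOn
        contMDiffOn_invFun := ((contDiff_id.add contDiff_const).comp
          A.symm.contDiff).contMDiff.contMDiffOn }
    let Ψ := (Φ.symm.trans (chartProdPartialDiffeomorph he)).trans T
    let W : Set M := {y | (y, t) ∈ Φ.source}
    have hW : IsOpen W := Φ.open_source.preimage (by fun_prop)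
    have hcont : ContinuousAt (fun x => G (x, t)) x :=
      hG.contMDiff.continuous.continuousAt.comp (f := fun x => (x, t)) (by fun_prop)
    have hGx : G (x, t) ∈ Φ.target := by
      rw [hΦ hx]
      exact Φ.map_source hx
    have hsymm : ∀ y ∈ W, Φ.symm (G (y, t)) = (y, t) := fun y hy => by
      rw [hΦ hy]
      exact Φ.left_inv hy
    have hA : ∀ u : EuclideanSpace ℝ (Fin n), T (u, t) = A (u, 0) := fun u => by
      show A ((u, t) + (0, -t)) = _
      simp
    refine Manifold.IsImmersionAtOfComplement.mk_of_continuousAt hcont A (e.restr W)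
      Ψ.toOpenPartialHomeomorph ⟨hxe, by rwa [hW.interior_eq]⟩ ⟨⟨hGx, ?_⟩, Set.mem_univ _⟩
      (restr_mem_maximalAtlas (contDiffGroupoid ∞ (𝓡 n)) he hW)
      (OpenPartialHomeomorph.mem_maximalAtlas_of_contMDiffOn _ Ψ.contMDiffOn Ψ.symm.contMDiffOn) ?_
    · show Φ.symm (G (x, t)) ∈ (chartProdPartialDiffeomorph he).source
      rw [hsymm x hx]
      exact ⟨hxe, Set.mem_univ _⟩
    · intro u hu
      have hu' : u ∈ e.target ∧ e.symm u ∈ W := by simpa [hW.interior_eq] using hu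
      show T (chartProdPartialDiffeomorph he (Φ.symm (G (e.symm u, t)))) = A (u, 0)
      rw [hsymm _ hu'.2, ← hA]
      show T (e (e.symm u), t) = _
      rw [e.right_inv hu'.1]
  exact key.isImmersion

theorem isSmoothEmbedding_slice [IsManifold (𝓡 n) ∞ M] {G : M × ℝ → Hyp (n + 1)}
    (hG : IsLocalDiffeomorph ((𝓡 n).prod 𝓘(ℝ, ℝ)) (𝓡 (n + 1)) ∞ G)
    (hinj : Function.Injective G) (t : ℝ) :
    Manifold.IsSmoothEmbedding (𝓡 n) (𝓡 (n + 1)) ∞ fun x => G (x, t) :=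
  ⟨isImmersion_slice hG t, (Topology.IsOpenEmbedding.of_continuous_injective_isOpenMap
    hG.contMDiff.continuous hinj hG.isOpenMap).isEmbedding.comp (isEmbedding_prodMkLeft t)⟩

end Slices

section GeodesicConvexity

namespace Hyp

variable {d : ℕ}

theorem mink_neg (x y : Hyp d) : mink (x : Minkowski d) (y : Minkowski d) < 0 := by
  have h1 := real_inner_le_norm x.1.2 y.1.2
  have hx := fst_eq x
  have hy := fst_eq y
  have h2 : ‖x.1.2‖ < x.1.1 := by
    rw [hx]
    exact Real.lt_sqrt_of_sq_lt (by linarith)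
  have h3 : ‖y.1.2‖ < y.1.1 := by
    rw [hy]
    exact Real.lt_sqrt_of_sq_lt (by linarith)
  have h4 := mul_lt_mul'' h2 h3 (norm_nonneg _) (norm_nonneg _)
  simp only [mink]
  linarith

theorem add_mink_smul_mem (x y : Hyp d) :
    (y : Minkowski d) + mink (x : Minkowski d) y • (x : Minkowski d) ∈ tangent x := by
  show mink _ _ = 0
  rw [mink_add_right, mink_smul_right, x.2.1]
  ring

theorem mink_add_mink_smul (x y : Hyp d) :
    mink ((y : Minkowski d) + mink (x : Minkowski d) y • (x : Minkowski d))
      ((y : Minkowski d) + mink (x : Minkowski d) y • (x : Minkowski d)) =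
      mink (x : Minkowski d) y ^ 2 - 1 := by
  simp only [mink_add_left, mink_add_right, mink_smul_left, mink_smul_right, x.2.1, y.2.1,
    mink_comm (y : Minkowski d) x]
  ring

theorem mink_le_neg_one (x y : Hyp d) : mink (x : Minkowski d) (y : Minkowski d) ≤ -1 := by
  have h1 := mink_self_nonneg x _ (add_mink_smul_mem x y)
  rw [mink_add_mink_smul] at h1
  nlinarith [mink_neg x y]

theorem eq_of_mink_eq_neg_one {x y : Hyp d} (h : mink (x : Minkowski d) (y : Minkowski d) = -1) :
    x = y := by
  have h1 := eq_zero_of_mink_self x _ (add_mink_smul_mem x y)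
    (by rw [mink_add_mink_smul, h]; norm_num)
  rw [h, neg_one_smul, ← sub_eq_add_neg, sub_eq_zero] at h1
  exact (Subtype.ext h1).symm

end Hyp

variable {n d : ℕ} {M : Type*} [TopologicalSpace M] [ChartedSpace (EuclideanSpace ℝ (Fin n)) M]

theorem hasDerivAt_comp_curve {f : M → Minkowski d} {γ : ℝ → M} {τ : ℝ}
    (hf : MDifferentiableAt (𝓡 n) 𝓘(ℝ, Minkowski d) f (γ τ))
    (hγ : MDifferentiableAt 𝓘(ℝ, ℝ) (𝓡 n) γ τ) :
    HasDerivAt (fun r => f (γ r)) (dif f (γ τ) (mfderiv 𝓘(ℝ, ℝ) (𝓡 n) γ τ (1 : ℝ))) τ := by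
  let D : ℝ →L[ℝ] Minkowski d :=
    (mfderiv (𝓡 n) 𝓘(ℝ, Minkowski d) f (γ τ)).comp (mfderiv 𝓘(ℝ, ℝ) (𝓡 n) γ τ)
  have h : HasFDerivAt (fun r => f (γ r)) D τ :=
    (hf.hasMFDerivAt.comp τ hγ.hasMFDerivAt).hasFDerivAt
  have h' : HasDerivAt (fun r => f (γ r)) (D 1) τ := h.hasDerivAt
  exact h'

namespace IsImmersedHypersurface

variable {ι : M → Hyp (n + 1)} {N : (x : M) → Hyp.tangent (ι x)} [IsManifold (𝓡 n) ∞ M]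

theorem abs_mink_shapeOperator_le (h : IsImmersedHypersurface n ι N)
    (hs : WeaklySmallCurvature n ι N) (x : M) (v : TangentSpace (𝓡 n) x) :
    |mink (tmap ι x (shapeOperator n ι N x v)) (tmap ι x v)| ≤ mink (tmap ι x v) (tmap ι x v) := by
  obtain ⟨b, lam, hB, hg⟩ := h.exists_principal_basis x
  have h1 := bilin_apply_of_diagonal (firstForm ι x) b hg (S := shapeOperator n ι N x)
    (T := LinearMap.id) hB (τ := fun _ => 1) (by simp) v
  have h2 := bilin_apply_of_diagonal (firstForm ι x) b hg (S := LinearMap.id)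
    (T := LinearMap.id) (σ := fun _ => 1) (by simp) (τ := fun _ => 1) (by simp) v
  simp only [firstForm_apply, LinearMap.id_apply] at h1 h2
  rw [h1, h2]
  refine (Finset.abs_sum_le_sum_abs _ _).trans (Finset.sum_le_sum fun i _ => ?_)
  have h3 := abs_le_one_of_apply_eq_smul hs (b.ne_zero i) (hB i)
  simp only [mul_one]
  rw [abs_mul, abs_of_nonneg (sq_nonneg (b.repr v i))]
  exact mul_le_mul_of_nonneg_right h3 (sq_nonneg _)

/-- The Lorentzian norm in the frame `(ι x, N x, dι)`. -/
theorem exists_mink_self_eq (h : IsImmersedHypersurface n ι N) (x : M) (w : Minkowski (n + 1)) :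
    ∃ q : ℝ, 0 ≤ q ∧ mink w w = -mink (ι x : Minkowski (n + 1)) w ^ 2 +
      mink (N x : Minkowski (n + 1)) w ^ 2 + q := by
  obtain ⟨v, hv⟩ := h.exists_decomposition x w
  refine ⟨_, h.mink_self_nonneg x v, ?_⟩
  set a := mink (ι x : Minkowski (n + 1)) w
  set b := mink (N x : Minkowski (n + 1)) w
  rw [hv, mink_add_left, mink_add_right _ _ (tmap ι x v), h.mink_plane, mink_add_right,
    mink_comm (tmap ι x v) (_ + _)]
  have h0 : mink (-a • (ι x : Minkowski (n + 1)) + b • (N x : Minkowski (n + 1))) (tmap ι x v) = 0 := by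
    rw [mink_add_left, mink_smul_left, mink_smul_left, h.mink_tmap, h.isUnitNormal.normal]
    ring
  have h1 : mink (tmap ι x v) (-a • (ι x : Minkowski (n + 1)) + b • (N x : Minkowski (n + 1))) = 0 := by
    rw [mink_comm, h0]
  simp only [mink_add_right, mink_smul_right] at h0 h1 ⊢
  simp only [mink_add_left, mink_smul_left, h.mink_tmap, h.isUnitNormal.normal] at h0 h1 ⊢
  ring

/-- The acceleration of a geodesic of the first fundamental form. -/
theorem acceleration_eq (h : IsImmersedHypersurface n ι N) {γ : ℝ → M} {s : Set ℝ} (hso : IsOpen s)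
    (hγ : IsGeodesicOn n ι γ s) {τ : ℝ} (hτ : τ ∈ s) :
    ∃ v : TangentSpace (𝓡 n) (γ τ),
      HasDerivAt (fun r => (ι (γ r) : Minkowski (n + 1))) (tmap ι (γ τ) v) τ ∧
      HasDerivAt (deriv fun r => (ι (γ r) : Minkowski (n + 1)))
        (mink (tmap ι (γ τ) v) (tmap ι (γ τ) v) • (ι (γ τ) : Minkowski (n + 1)) +
          mink (tmap ι (γ τ) (shapeOperator n ι N (γ τ) v)) (tmap ι (γ τ) v) •
            (N (γ τ) : Minkowski (n + 1))) τ := by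
  set c := fun r => (ι (γ r) : Minkowski (n + 1)) with hc
  have hγd : ∀ r ∈ s, MDifferentiableAt 𝓘(ℝ, ℝ) (𝓡 n) γ r := fun r hr =>
    (hγ.1.contMDiffAt (hso.mem_nhds hr)).mdifferentiableAt (by simp)
  have hcd : ∀ r ∈ s, HasDerivAt c (tmap ι (γ r) (mfderiv 𝓘(ℝ, ℝ) (𝓡 n) γ r (1 : ℝ))) r :=
    fun r hr => hasDerivAt_comp_curve (h.mdifferentiable _) (hγd r hr)
  have hcs : ContDiffOn ℝ ∞ c s :=
    contMDiffOn_iff_contDiffOn.1 (h.contMDiff_coe.comp_contMDiffOn hγ.1)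
  have hdc : ContDiffOn ℝ ∞ (deriv c) s := hcs.deriv_of_isOpen hso (by simp)
  have hddc : HasDerivAt (deriv c) (deriv (deriv c) τ) τ :=
    ((hdc.contDiffAt (hso.mem_nhds hτ)).differentiableAt (by simp)).hasDerivAt
  refine ⟨mfderiv 𝓘(ℝ, ℝ) (𝓡 n) γ τ (1 : ℝ), hcd τ hτ, ?_⟩
  set v : TangentSpace (𝓡 n) (γ τ) := mfderiv 𝓘(ℝ, ℝ) (𝓡 n) γ τ (1 : ℝ)
  convert hddc using 1
  have hN : HasDerivAt (fun r => (N (γ r) : Minkowski (n + 1)))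
      (-tmap ι (γ τ) (shapeOperator n ι N (γ τ) v)) τ := by
    rw [h.tmap_shapeOperator, neg_neg]
    exact hasDerivAt_comp_curve (f := fun x => (N x : Minkowski (n + 1)))
      (h.mdifferentiable_normal _) (hγd τ hτ)
  have hdcτ : deriv c τ = tmap ι (γ τ) v := (hcd τ hτ).deriv
  have h1 : mink (c τ) (deriv (deriv c) τ) = -mink (tmap ι (γ τ) v) (tmap ι (γ τ) v) := by
    have h2 := (hcd τ hτ).mink hddc
    have h3 : HasDerivAt (fun r => mink (c r) (deriv c r)) 0 τ := by
      refine (hasDerivAt_const τ (0 : ℝ)).congr_of_eventuallyEq ?_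
      filter_upwards [hso.mem_nhds hτ] with r hr
      rw [(hcd r hr).deriv, hc, h.mink_tmap]
    have h4 := h2.unique h3
    rw [hdcτ] at h4
    linarith
  have h2 : mink (N (γ τ) : Minkowski (n + 1)) (deriv (deriv c) τ) =
      mink (tmap ι (γ τ) (shapeOperator n ι N (γ τ) v)) (tmap ι (γ τ) v) := by
    have h2 := hN.mink hddc
    have h3 : HasDerivAt (fun r => mink (N (γ r) : Minkowski (n + 1)) (deriv c r)) 0 τ := by
      refine (hasDerivAt_const τ (0 : ℝ)).congr_of_eventuallyEq ?_
      filter_upwards [hso.mem_nhds hτ] with r hr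
      rw [(hcd r hr).deriv, h.isUnitNormal.normal]
    have h4 := h2.unique h3
    rw [hdcτ, mink_neg_left] at h4
    linarith
  obtain ⟨w, hw⟩ := h.exists_decomposition (γ τ) (deriv (deriv c) τ)
  have h3 : mink (tmap ι (γ τ) w) (tmap ι (γ τ) w) = 0 := by
    have h4 := hγ.2 τ hτ w
    rw [Hyp.proj, mink_add_left, mink_smul_left, h.mink_tmap, mul_zero, add_zero, ← hc, hw,
      mink_add_left, mink_add_left, mink_smul_left, mink_smul_left, h.mink_tmap,
      h.isUnitNormal.normal] at h4
    linarith
  rw [h.eq_zero_of_mink_self h3, map_zero, add_zero] at hw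
  rw [hw, h2, h1, neg_neg]

/-- A geodesically convex hypersurface of weakly small curvature lies outside the two horoballs
tangent to it at any of its points. -/
theorem abs_mink_normal_le (h : IsImmersedHypersurface n ι N) (hs : WeaklySmallCurvature n ι N)
    (hconv : IsGeodesicallyConvex n ι) (x y : M) :
    |mink (ι y : Minkowski (n + 1)) (N x)| ≤ -mink (ι y : Minkowski (n + 1)) (ι x) - 1 := by
  have hxN : mink (ι x : Minkowski (n + 1)) (N x) = 0 := (N x).2
  have key : ∀ ε : ℝ, ε ^ 2 = 1 →
      1 ≤ -mink (ι y : Minkowski (n + 1)) ((ι x : Minkowski (n + 1)) + ε • (N x : Minkowski (n + 1))) := by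
    intro ε hε
    set a := (ι x : Minkowski (n + 1)) + ε • (N x : Minkowski (n + 1)) with ha
    have haa : mink a a = 0 := by
      simp only [ha, mink_add_left, mink_add_right, mink_smul_left, mink_smul_right, hxN,
        mink_comm (N x : Minkowski (n + 1)) (ι x), (ι x).2.1, h.isUnitNormal.unit]
      linarith
    have hpos : ∀ z : M, 0 < -mink (ι z : Minkowski (n + 1)) a := by
      intro z
      obtain ⟨q, hq, hq'⟩ := h.exists_mink_self_eq x (ι z : Minkowski (n + 1))
      rw [(ι z).2.1] at hq'
      have h1 := Hyp.mink_neg (ι x) (ι z)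
      rw [ha, mink_add_right, mink_smul_right, mink_comm _ (ι x : Minkowski (n + 1)),
        mink_comm _ (N x : Minkowski (n + 1))]
      set m := mink (N x : Minkowski (n + 1)) (ι z)
      set C := mink (ι x : Minkowski (n + 1)) (ι z)
      have h2 : (ε * m) ^ 2 < (-C) ^ 2 := by rw [mul_pow, hε]; linarith
      have h3 := (abs_lt_of_sq_lt_sq' h2 (by linarith)).2
      linarith
    have hk : ∀ z : M, |mink (N z : Minkowski (n + 1)) a| ≤ -mink (ι z : Minkowski (n + 1)) a := by
      intro z
      obtain ⟨q, hq, hq'⟩ := h.exists_mink_self_eq z a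
      rw [haa] at hq'
      refine abs_le_of_sq_le_sq ?_ (hpos z).le
      nlinarith
    obtain ⟨γ, s, hso, hIs, hγ, h0, h1⟩ := hconv x y
    have hIcc : ∀ τ ∈ Set.Icc (0 : ℝ) 1, τ ∈ s := fun τ hτ => hIs hτ
    set c := fun r => (ι (γ r) : Minkowski (n + 1)) with hc
    have hd : ∀ τ ∈ s, HasDerivAt (fun r => -mink (c r) a) (-mink (deriv c τ) a) τ := by
      intro τ hτ
      obtain ⟨v, hv, -⟩ := h.acceleration_eq hso hγ hτ
      have := (hv.mink (hasDerivAt_const τ a)).neg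
      rw [mink_zero_right, zero_add] at this
      rw [hv.deriv]
      exact this
    have hdd : ∀ τ ∈ s, ∃ D, 0 ≤ D ∧ HasDerivAt (fun r => -mink (deriv c r) a) D τ := by
      intro τ hτ
      obtain ⟨v, hv, hv'⟩ := h.acceleration_eq hso hγ hτ
      have h2 := (hv'.mink (hasDerivAt_const τ a)).neg
      refine ⟨_, ?_, h2⟩
      rw [mink_zero_right, zero_add, mink_add_left, mink_smul_left, mink_smul_left]
      have h3 := h.abs_mink_shapeOperator_le hs (γ τ) v
      have h4 := hk (γ τ)
      have h5 := mul_le_mul h3 h4 (abs_nonneg _) (h.mink_self_nonneg _ v)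
      rw [← abs_mul] at h5
      have h6 := neg_abs_le (mink (tmap ι (γ τ) (shapeOperator n ι N (γ τ) v)) (tmap ι (γ τ) v) *
        mink (N (γ τ) : Minkowski (n + 1)) a)
      have h7 := le_abs_self (mink (tmap ι (γ τ) (shapeOperator n ι N (γ τ) v)) (tmap ι (γ τ) v) *
        mink (N (γ τ) : Minkowski (n + 1)) a)
      linarith
    have hd0 : -mink (deriv c 0) a = 0 := by
      obtain ⟨v, hv, -⟩ := h.acceleration_eq hso hγ (hIcc 0 (by simp))
      rw [hv.deriv, ha, ← h0, mink_add_right, mink_smul_right, mink_comm _ (ι (γ 0) : Minkowski (n + 1)),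
        mink_comm _ (N (γ 0) : Minkowski (n + 1)), h.mink_tmap, h.isUnitNormal.normal]
      simp
    have hmono1 : MonotoneOn (fun r => -mink (deriv c r) a) (Set.Icc 0 1) := by
      refine monotoneOn_of_deriv_nonneg (convex_Icc 0 1) ?_ ?_ ?_
      · intro τ hτ
        obtain ⟨D, -, hD⟩ := hdd τ (hIcc τ hτ)
        exact hD.continuousAt.continuousWithinAt
      · intro τ hτ
        obtain ⟨D, -, hD⟩ := hdd τ (hIcc τ (interior_subset hτ))
        exact hD.differentiableAt.differentiableWithinAt
      · intro τ hτ
        obtain ⟨D, hD0, hD⟩ := hdd τ (hIcc τ (interior_subset hτ))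
        rwa [hD.deriv]
    have hmono2 : MonotoneOn (fun r => -mink (c r) a) (Set.Icc 0 1) := by
      refine monotoneOn_of_deriv_nonneg (convex_Icc 0 1) ?_ ?_ ?_
      · exact fun τ hτ => (hd τ (hIcc τ hτ)).continuousAt.continuousWithinAt
      · exact fun τ hτ => (hd τ (hIcc τ (interior_subset hτ))).differentiableAt.differentiableWithinAt
      · intro τ hτ
        rw [(hd τ (hIcc τ (interior_subset hτ))).deriv, ← hd0]
        exact hmono1 (by simp) (interior_subset hτ) (interior_subset hτ).1
    have h2 := hmono2 (a := 0) (b := 1) (by simp) (by simp) zero_le_one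
    simp only [hc, h0, h1] at h2
    refine le_trans (le_of_eq ?_) h2
    rw [ha, mink_add_right, mink_smul_right, hxN, (ι x).2.1]
    ring
  have h1 := key 1 (by norm_num)
  have h2 := key (-1) (by norm_num)
  rw [mink_add_right, mink_smul_right] at h1 h2
  rw [abs_le]
  constructor <;> linarith

theorem cosh_lt_of_ne (h : IsImmersedHypersurface n ι N) (hs : WeaklySmallCurvature n ι N)
    (hconv : IsGeodesicallyConvex n ι) {x y : M} (hxy : ι y ≠ ι x) (t : ℝ) :
    Real.cosh t < -mink (ι y : Minkowski (n + 1)) (normalExp ι N (x, t)) := by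
  have h1 := h.abs_mink_normal_le hs hconv x y
  have h2 : mink (ι y : Minkowski (n + 1)) (ι x) < -1 :=
    lt_of_le_of_ne (Hyp.mink_le_neg_one _ _) fun h0 => hxy (Hyp.eq_of_mink_eq_neg_one h0)
  rw [normalExp_coe h.isUnitNormal.unit, mink_add_right, mink_smul_right, mink_smul_right]
  simp only
  set m := mink (ι y : Minkowski (n + 1)) (N x)
  set C := mink (ι y : Minkowski (n + 1)) (ι x)
  have h3 : Real.sinh t * m ≤ |Real.sinh t| * (-C - 1) := by
    refine (le_abs_self _).trans ?_
    rw [abs_mul]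
    exact mul_le_mul_of_nonneg_left h1 (abs_nonneg _)
  have h4 : |Real.sinh t| < Real.cosh t := by
    rw [Real.abs_sinh, ← Real.cosh_abs]
    exact Real.sinh_lt_cosh _
  nlinarith

omit [IsManifold (𝓡 n) ∞ M] in
theorem mink_normalExp (h : IsImmersedHypersurface n ι N) (x : M) (t : ℝ) :
    -mink (ι x : Minkowski (n + 1)) (normalExp ι N (x, t)) = Real.cosh t := by
  rw [normalExp_coe h.isUnitNormal.unit, mink_add_right, mink_smul_right, mink_smul_right,
    (ι x).2.1, show mink (ι x : Minkowski (n + 1)) (N x) = 0 from (N x).2]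
  ring

omit [IsManifold (𝓡 n) ∞ M] in
theorem mink_normal_normalExp (h : IsImmersedHypersurface n ι N) (x : M) (t : ℝ) :
    mink (N x : Minkowski (n + 1)) (normalExp ι N (x, t)) = Real.sinh t := by
  rw [normalExp_coe h.isUnitNormal.unit, mink_add_right, mink_smul_right, mink_smul_right,
    h.isUnitNormal.unit, mink_comm, show mink (ι x : Minkowski (n + 1)) (N x) = 0 from (N x).2]
  ring

theorem injective_normalExp (h : IsImmersedHypersurface n ι N) (hs : WeaklySmallCurvature n ι N)
    (hinj : Function.Injective ι) (hconv : IsGeodesicallyConvex n ι) :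
    Function.Injective (normalExp ι N) := by
  rintro ⟨x, t⟩ ⟨y, r⟩ hxy
  have h1 : x = y := by
    by_contra hne
    have h2 := h.cosh_lt_of_ne hs hconv (fun h0 => hne (hinj h0).symm) (x := x) (y := y) t
    have h3 := h.cosh_lt_of_ne hs hconv (fun h0 => hne (hinj h0)) (x := y) (y := x) r
    rw [← hxy, h.mink_normalExp] at h3
    rw [hxy, h.mink_normalExp] at h2
    linarith
  subst h1
  have h2 := h.mink_normal_normalExp x t
  rw [hxy, h.mink_normal_normalExp] at h2
  rw [Real.sinh_injective h2]

end IsImmersedHypersurface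

end GeodesicConvexity

section PathLifting

open Set Filter

variable {E X : Type*} [TopologicalSpace E] [TopologicalSpace X] [T2Space E] [T2Space X] {p : E → X}

/-- `g` lifts the curve `β` through `p` on the set `s`, starting at `e₀`. -/
structure IsCurveLift (p : E → X) (β : ℝ → X) (e₀ : E) (g : ℝ → E) (s : Set ℝ) : Prop where
  continuousOn : ContinuousOn g s
  map_zero : g 0 = e₀
  lifts : ∀ τ ∈ s, p (g τ) = β τ

omit [TopologicalSpace X] [T2Space E] [T2Space X] in
theorem IsCurveLift.mono {β : ℝ → X} {e₀ : E} {g : ℝ → E} {s t : Set ℝ}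
    (h : IsCurveLift p β e₀ g s) (hts : t ⊆ s) : IsCurveLift p β e₀ g t :=
  ⟨h.continuousOn.mono hts, h.map_zero, fun τ hτ => h.lifts τ (hts hτ)⟩

omit [T2Space X] in
theorem IsCurveLift.eqOn (hp : IsLocalHomeomorph p) {β : ℝ → X} {e₀ : E} {g₁ g₂ : ℝ → E} {s : ℝ}
    (hs : 0 ≤ s) (h₁ : IsCurveLift p β e₀ g₁ (Icc 0 s)) (h₂ : IsCurveLift p β e₀ g₂ (Icc 0 s)) :
    EqOn g₁ g₂ (Icc 0 s) :=
  (T2Space.isSeparatedMap p).eqOn_of_comp_eqOn hp.isLocallyInjective isPreconnected_Icc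
    h₁.continuousOn h₂.continuousOn (fun τ hτ => (h₁.lifts τ hτ).trans (h₂.lifts τ hτ).symm)
    (left_mem_Icc.2 hs) (h₁.map_zero.trans h₂.map_zero.symm)

omit [T2Space E] [T2Space X] in
/-- A lift passing through a point of a sheet of `p` can be continued along the sheet. -/
theorem IsCurveLift.extend {φ : OpenPartialHomeomorph E X} (hφ : p = φ) {β : ℝ → X}
    (hβ : Continuous β) {e₀ : E} {g : ℝ → E} {τ₀ s : ℝ} (hτ₀ : 0 ≤ τ₀)
    (hg : IsCurveLift p β e₀ g (Icc 0 τ₀)) (hgτ₀ : g τ₀ ∈ φ.source)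
    (hs : ∀ τ ∈ Icc τ₀ s, β τ ∈ φ.target) : ∃ g', IsCurveLift p β e₀ g' (Icc 0 s) := by
  have hglue : g τ₀ = φ.symm (β τ₀) := by
    rw [← hg.lifts τ₀ (right_mem_Icc.2 hτ₀), hφ, φ.left_inv hgτ₀]
  let g' : ℝ → E := fun τ => if τ ≤ τ₀ then g τ else φ.symm (β τ)
  have h1 : EqOn g' g (Icc 0 τ₀) := fun τ hτ => if_pos hτ.2
  have h2 : EqOn g' (φ.symm ∘ β) (Icc τ₀ s) := by
    intro τ hτ
    rcases hτ.1.eq_or_lt with rfl | hlt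
    · exact (if_pos le_rfl).trans hglue
    · exact if_neg (not_le.2 hlt)
  have hsub : Icc 0 s ⊆ Icc 0 τ₀ ∪ Icc τ₀ s := fun τ hτ =>
    (le_total τ τ₀).elim (fun h => Or.inl ⟨hτ.1, h⟩) fun h => Or.inr ⟨h, hτ.2⟩
  refine ⟨g', ?_, ?_, ?_⟩
  · refine ContinuousOn.mono ?_ hsub
    exact (hg.continuousOn.congr h1).union_of_isClosed
      ((φ.continuousOn_symm.comp hβ.continuousOn hs).congr h2) isClosed_Icc isClosed_Icc
  · rw [h1 (left_mem_Icc.2 hτ₀), hg.map_zero]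
  · intro τ hτ
    rcases hsub hτ with h | h
    · rw [h1 h, hg.lifts τ h]
    · rw [h2 h, hφ]
      exact φ.right_inv (hs τ h)

/-- A curve lifts through a local homeomorphism as soon as its partial lifts have limit points. -/
theorem IsLocalHomeomorph.exists_isCurveLift (hp : IsLocalHomeomorph p) {β : ℝ → X}
    (hβ : Continuous β) {e₀ : E} (he₀ : p e₀ = β 0)
    (hlim : ∀ s ∈ Ioc (0 : ℝ) 1, ∀ g, IsCurveLift p β e₀ g (Ico 0 s) →
      ∃ e, MapClusterPt e (𝓝[<] s) g) :
    ∃ g, IsCurveLift p β e₀ g (Icc 0 1) := by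
  let S : Set ℝ := {s | s ∈ Icc (0 : ℝ) 1 ∧ ∃ g, IsCurveLift p β e₀ g (Icc 0 s)}
  have h0 : (0 : ℝ) ∈ S := by
    refine ⟨by simp, fun _ => e₀, continuousOn_const, rfl, fun τ hτ => ?_⟩
    rw [Icc_self, mem_singleton_iff] at hτ
    rw [hτ, he₀]
  have hbdd : BddAbove S := ⟨1, fun s hs => hs.1.2⟩
  set σ := sSup S
  have hσ0 : 0 ≤ σ := le_csSup hbdd h0
  have hσ1 : σ ≤ 1 := csSup_le ⟨0, h0⟩ fun s hs => hs.1.2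
  have hdown : ∀ τ ∈ Ico 0 σ, τ ∈ S := by
    intro τ hτ
    obtain ⟨s, hs, hlt⟩ := exists_lt_of_lt_csSup ⟨0, h0⟩ hτ.2
    obtain ⟨g, hg⟩ := hs.2
    exact ⟨⟨hτ.1, hτ.2.le.trans hσ1⟩, g, hg.mono (Icc_subset_Icc_right hlt.le)⟩
  have hlift : ∃ g, IsCurveLift p β e₀ g (Ico 0 σ) := by
    classical
    have : Nonempty (ℝ → E) := ⟨fun _ => e₀⟩
    choose! G hG using fun τ (hτ : τ ∈ Ico 0 σ) => (hdown τ hτ).2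
    let g : ℝ → E := fun τ => if τ ∈ Ico 0 σ then G τ τ else e₀
    have hgG : ∀ s ∈ Ico 0 σ, EqOn g (G s) (Icc 0 s) := by
      intro s hs τ hτ
      have hτ' : τ ∈ Ico 0 σ := ⟨hτ.1, hτ.2.trans_lt hs.2⟩
      rw [show g τ = G τ τ from if_pos hτ']
      exact IsCurveLift.eqOn hp hτ.1 (hG τ hτ') ((hG s hs).mono (Icc_subset_Icc_right hτ.2))
        (right_mem_Icc.2 hτ.1)
    refine ⟨g, fun τ hτ => ?_, ?_, fun τ hτ => ?_⟩
    · obtain ⟨s, hs1, hs2⟩ := exists_between hτ.2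
      have hs : s ∈ Ico 0 σ := ⟨hτ.1.trans hs1.le, hs2⟩
      have h1 : ContinuousWithinAt g (Icc 0 s) τ :=
        ((hG s hs).continuousOn.congr (hgG s hs)) τ ⟨hτ.1, hs1.le⟩
      refine h1.mono_of_mem_nhdsWithin ?_
      filter_upwards [self_mem_nhdsWithin, mem_nhdsWithin_of_mem_nhds (Iio_mem_nhds hs1)] with r hr hr'
      exact ⟨hr.1, le_of_lt hr'⟩
    · by_cases h : (0 : ℝ) ∈ Ico 0 σ
      · rw [hgG 0 h (by simp), (hG 0 h).map_zero]
      · exact if_neg h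
    · rw [hgG τ hτ (right_mem_Icc.2 hτ.1)]
      exact (hG τ hτ).lifts τ (right_mem_Icc.2 hτ.1)
  obtain ⟨g, hg⟩ := hlift
  have hstep : ∃ ε > 0, ∃ g', IsCurveLift p β e₀ g' (Icc 0 (σ + ε)) := by
    rcases hσ0.eq_or_lt with hσ | hσ
    · obtain ⟨φ, hφ, hpφ⟩ := hp e₀
      have h1 : β 0 ∈ φ.target := by
        rw [← he₀, hpφ]
        exact φ.map_source hφ
      obtain ⟨ε, hε, hball⟩ := Metric.mem_nhds_iff.1
        (hβ.continuousAt.preimage_mem_nhds (φ.open_target.mem_nhds h1))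
      refine ⟨ε / 2, half_pos hε, ?_⟩
      rw [← hσ, zero_add]
      have h2 : IsCurveLift p β e₀ (fun _ => e₀) (Icc 0 0) := by
        refine ⟨continuousOn_const, rfl, fun τ hτ => ?_⟩
        rw [Icc_self, mem_singleton_iff] at hτ
        rw [hτ, he₀]
      refine h2.extend hpφ hβ le_rfl hφ fun τ hτ => hball ?_
      rw [Metric.mem_ball, Real.dist_eq, sub_zero, abs_of_nonneg hτ.1]
      linarith [hτ.2]
    · obtain ⟨e, he⟩ := hlim σ ⟨hσ, hσ1⟩ g hg
      obtain ⟨φ, hφ, hpφ⟩ := hp e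
      have hIoo : Ioo 0 σ ∈ 𝓝[<] σ := Ioo_mem_nhdsLT hσ
      have h1 : MapClusterPt (p e) (𝓝[<] σ) (p ∘ g) := he.continuousAt_comp hp.continuous.continuousAt
      have h2 : Tendsto (p ∘ g) (𝓝[<] σ) (𝓝 (β σ)) := by
        refine ((hβ.tendsto σ).mono_left nhdsWithin_le_nhds).congr' ?_
        filter_upwards [hIoo] with τ hτ
        exact (hg.lifts τ ⟨hτ.1.le, hτ.2⟩).symm
      have h3 : p e = β σ := by
        have h4 : ClusterPt (p e) (𝓝 (β σ)) := ClusterPt.mono h1 h2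
        by_contra hne
        exact h4.ne (disjoint_iff.1 (disjoint_nhds_nhds.2 hne))
      have h4 : β σ ∈ φ.target := by
        rw [← h3, hpφ]
        exact φ.map_source hφ
      obtain ⟨ε, hε, hball⟩ := Metric.mem_nhds_iff.1
        (hβ.continuousAt.preimage_mem_nhds (φ.open_target.mem_nhds h4))
      have h5 : ∃ᶠ τ in 𝓝[<] σ, g τ ∈ φ.source := he.frequently (φ.open_source.mem_nhds hφ)
      have h6 : Ioo (max 0 (σ - ε)) σ ∈ 𝓝[<] σ := Ioo_mem_nhdsLT (max_lt hσ (by linarith))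
      obtain ⟨τ₀, hτ₀, hτ₀'⟩ := (h5.and_eventually h6).exists
      have hτ₀0 : 0 ≤ τ₀ := (le_max_left _ _).trans hτ₀'.1.le
      refine ⟨ε / 2, half_pos hε, (hg.mono fun τ hτ => ⟨hτ.1, hτ.2.trans_lt hτ₀'.2⟩ :
        IsCurveLift p β e₀ g (Icc 0 τ₀)).extend hpφ hβ hτ₀0 hτ₀ fun τ hτ => hball ?_⟩
      have h7 := (le_max_right 0 (σ - ε)).trans_lt hτ₀'.1
      rw [Metric.mem_ball, Real.dist_eq, abs_lt]
      constructor <;> linarith [hτ.1, hτ.2]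
  obtain ⟨ε, hε, g', hg'⟩ := hstep
  have hmem : min (σ + ε) 1 ∈ S :=
    ⟨⟨le_min (by linarith) zero_le_one, min_le_right _ _⟩, g',
      hg'.mono (Icc_subset_Icc_right (min_le_left _ _))⟩
  have hle := le_csSup hbdd hmem
  have h1 : min (σ + ε) 1 = 1 := by
    rcases le_total (σ + ε) 1 with h | h
    · rw [min_eq_left h] at hle
      linarith
    · exact min_eq_right h
  rw [h1] at hmem
  exact hmem.2

omit [T2Space X] in
/-- A local homeomorphism from a connected space onto a contractible space along whose contracting
curves one can lift is bijective. -/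
theorem IsLocalHomeomorph.bijective_of_exists_isCurveLift [PreconnectedSpace E]
    (hp : IsLocalHomeomorph p) (e₀ : E) {K : ℝ → X → X}
    (hK : Continuous fun z : ℝ × X => K z.1 z.2) (hK1 : ∀ x, K 1 x = x)
    (hKe : ∀ τ, K τ (p e₀) = p e₀)
    (hlift : ∀ x, ∃ g, IsCurveLift p (fun τ => K τ x) e₀ g (Icc 0 1)) : Function.Bijective p := by
  choose G hG using hlift
  let f : C(unitInterval × X, X) := ⟨fun z => K z.1 z.2,
    hK.comp (f := fun z : unitInterval × X => ((z.1 : ℝ), z.2)) (by fun_prop)⟩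
  let g : unitInterval × X → E := fun z => G z.2 z.1
  have hg : Continuous g := by
    refine hp.continuous_lift (T2Space.isSeparatedMap p) f (g := g) ?_ ?_ ?_
    · exact funext fun z => (hG z.2).lifts z.1 z.1.2
    · have : (fun x => g (0, x)) = fun _ => e₀ := funext fun x => (hG x).map_zero
      rw [this]
      exact continuous_const
    · exact fun x => continuousOn_iff_continuous_domRestrict.1 (hG x).continuousOn
  let σ : X → E := fun x => G x 1
  have hσ : Continuous σ := hg.comp (f := fun x => ((1 : unitInterval), x)) (by fun_prop)
  have hpσ : ∀ x, p (σ x) = x := fun x =>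
    ((hG x).lifts 1 (by simp)).trans (hK1 x)
  have hσe : σ (p e₀) = e₀ := by
    have h1 : IsCurveLift p (fun τ => K τ (p e₀)) e₀ (fun _ => e₀) (Icc 0 1) :=
      ⟨continuousOn_const, rfl, fun τ _ => (hKe τ).symm⟩
    exact IsCurveLift.eqOn hp zero_le_one (hG (p e₀)) h1 (by simp)
  have hσp : ∀ e, σ (p e) = e := fun e =>
    congrFun ((T2Space.isSeparatedMap p).eq_of_comp_eq hp.isLocallyInjective
      (hσ.comp hp.continuous) continuous_id (funext fun e => hpσ (p e)) e₀ hσe) e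
  exact ⟨Function.LeftInverse.injective hσp, fun x => ⟨σ x, hpσ x⟩⟩

end PathLifting

section Completeness

open Set Filter

instance Hyp.instT2Space (d : ℕ) : T2Space (Hyp d) :=
  inferInstanceAs (T2Space {x : Minkowski d // mink x x = -1 ∧ 0 < x.1})

/-- Lifts of smooth curves through a local diffeomorphism are smooth. -/
theorem IsLocalDiffeomorph.contMDiffAt_of_comp {E F H₁ H₂ A B : Type*} [NormedAddCommGroup E]
    [NormedSpace ℝ E] [NormedAddCommGroup F] [NormedSpace ℝ F] [TopologicalSpace H₁]
    [TopologicalSpace H₂] {I : ModelWithCorners ℝ E H₁} {J : ModelWithCorners ℝ F H₂}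
    [TopologicalSpace A] [ChartedSpace H₁ A] [TopologicalSpace B] [ChartedSpace H₂ B]
    {k : WithTop ℕ∞} {f : A → B} (hf : IsLocalDiffeomorph I J k f) {g : ℝ → A} {β : ℝ → B} {τ : ℝ}
    (hβ : ContMDiffAt 𝓘(ℝ, ℝ) J k β τ) (hg : ContinuousAt g τ) (hfg : ∀ᶠ r in 𝓝 τ, f (g r) = β r) :
    ContMDiffAt 𝓘(ℝ, ℝ) I k g τ := by
  obtain ⟨Φ, hx, hΦ⟩ := hf (g τ)
  have hτ : β τ ∈ Φ.target := by
    rw [← hfg.self_of_nhds, hΦ hx]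
    exact Φ.map_source hx
  have h1 : ContMDiffAt J I k Φ.symm (β τ) :=
    Φ.symm.contMDiffOn.contMDiffAt (Φ.open_target.mem_nhds hτ)
  refine (h1.comp τ hβ).congr_of_eventuallyEq ?_
  filter_upwards [hfg, hg.preimage_mem_nhds (Φ.open_source.mem_nhds hx)] with r hr hr'
  show g r = Φ.symm (β r)
  rw [← hr, hΦ hr']
  exact (Φ.left_inv hr').symm

theorem tendsto_of_hasDerivAt_bound {f f' : ℝ → ℝ} {K s : ℝ} (hs : 0 < s)
    (hf : ∀ τ ∈ Ioo 0 s, HasDerivAt f (f' τ) τ) (hK : ∀ τ ∈ Ioo 0 s, |f' τ| ≤ K) :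
    ∃ l, Tendsto f (𝓝[<] s) (𝓝 l) := by
  have hK0 : 0 ≤ K := (abs_nonneg _).trans (hK (s / 2) ⟨by linarith, by linarith⟩)
  have h1 : LipschitzOnWith ⟨K, hK0⟩ f (Ioo 0 s) :=
    (convex_Ioo 0 s).lipschitzOnWith_of_nnnorm_hasDerivWithin_le
      (fun τ hτ => (hf τ hτ).hasDerivWithinAt) fun τ hτ =>
        NNReal.coe_le_coe.1 (hK τ hτ)
  obtain ⟨g, hg, hgf⟩ := h1.extend_real
  refine ⟨g s, ((hg.continuous.tendsto s).mono_left nhdsWithin_le_nhds).congr' ?_⟩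
  filter_upwards [Ioo_mem_nhdsLT hs] with τ hτ
  exact (hgf hτ).symm

theorem bounded_of_tendsto_nhdsLT {f : ℝ → ℝ} {s l : ℝ} (hf : Tendsto f (𝓝[<] s) (𝓝 l)) :
    ∃ a < s, ∀ τ ∈ Ioo a s, |f τ| ≤ |l| + 1 := by
  have h1 : ∀ᶠ τ in 𝓝[<] s, |f τ| < |l| + 1 := hf.abs.eventually_lt_const (by linarith)
  obtain ⟨a, ha, h2⟩ := (mem_nhdsLT_iff_exists_Ioo_subset).1 h1
  exact ⟨a, ha, fun τ hτ => (h2 hτ).le⟩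

variable {n d : ℕ} {M : Type*} [TopologicalSpace M] [ChartedSpace (EuclideanSpace ℝ (Fin n)) M]

theorem enormSMulClass_inducedENorm (ι : M → Hyp d) (x : M) :
    letI := inducedENorm n ι x
    ENormSMulClass ℝ (TangentSpace (𝓡 n) x) := by
  let := inducedENorm n ι x
  refine ⟨fun r v => ?_⟩
  show ENNReal.ofReal (Hyp.tnorm (tmap ι x (r • v))) = ‖r‖ₑ * ENNReal.ofReal (Hyp.tnorm (tmap ι x v))
  rw [map_smul, Hyp.tnorm_smul, ENNReal.ofReal_mul (abs_nonneg r), Real.enorm_eq_ofReal_abs]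

theorem intrinsicEDist_comm (ι : M → Hyp d) (x y : M) :
    intrinsicEDist n ι x y = intrinsicEDist n ι y x :=
  letI : ∀ z : M, ENorm (TangentSpace (𝓡 n) z) := inducedENorm n ι
  haveI : ∀ z : M, ENormSMulClass ℝ (TangentSpace (𝓡 n) z) := enormSMulClass_inducedENorm ι
  Manifold.riemannianEDist_comm

theorem intrinsicEDist_le {ι : M → Hyp d}
    (hι : MDifferentiable (𝓡 n) 𝓘(ℝ, Minkowski d) fun y => (ι y : Minkowski d)) {x : ℝ → M}
    {a b C : ℝ} (hab : a ≤ b) (hC0 : 0 ≤ C)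
    (hx : ∀ τ ∈ Icc a b, ContMDiffAt 𝓘(ℝ, ℝ) (𝓡 n) 1 x τ)
    (hC : ∀ τ ∈ Ioo a b, mink (deriv (fun r => (ι (x r) : Minkowski d)) τ)
      (deriv (fun r => (ι (x r) : Minkowski d)) τ) ≤ C ^ 2) :
    intrinsicEDist n ι (x a) (x b) ≤ ENNReal.ofReal (C * (b - a)) := by
  let _ : ∀ z : M, ENorm (TangentSpace (𝓡 n) z) := inducedENorm n ι
  have _ : ∀ z : M, ENormSMulClass ℝ (TangentSpace (𝓡 n) z) := enormSMulClass_inducedENorm ι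
  have h1 : intrinsicEDist n ι (x a) (x b) ≤ Manifold.pathELength (𝓡 n) x a b :=
    Manifold.riemannianEDist_le_pathELength (fun τ hτ => (hx τ hτ).contMDiffWithinAt) rfl rfl hab
  refine h1.trans ?_
  rw [Manifold.pathELength_eq_lintegral_mfderiv_Ioo, ENNReal.ofReal_mul hC0,
    ← Real.volume_Ioo, ← MeasureTheory.setLIntegral_const]
  refine MeasureTheory.setLIntegral_mono' measurableSet_Ioo fun τ hτ => ?_
  have h2 := hasDerivAt_comp_curve (hι (x τ))
    ((hx τ (Ioo_subset_Icc_self hτ)).mdifferentiableAt (by simp))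
  refine ENNReal.ofReal_le_ofReal ?_
  have h3 := hC τ hτ
  rw [h2.deriv] at h3
  exact Real.sqrt_le_iff.2 ⟨hC0, h3⟩

theorem exp_neg_abs_sq_le {t l : ℝ} (hl : |l| ≤ 1) :
    Real.exp (-|t|) ^ 2 ≤ (Real.cosh t - Real.sinh t * l) ^ 2 := by
  have h1 : Real.exp (-|t|) = Real.cosh t - |Real.sinh t| := by
    rw [← Real.cosh_abs t, Real.abs_sinh, Real.cosh_sub_sinh]
  have h2 : |Real.sinh t * l| ≤ |Real.sinh t| := by
    rw [abs_mul]
    exact mul_le_of_le_one_right (abs_nonneg _) hl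
  refine pow_le_pow_left₀ (Real.exp_pos _).le ?_ 2
  rw [h1]
  linarith [le_abs_self (Real.sinh t * l)]

namespace IsImmersedHypersurface

variable {ι : M → Hyp (n + 1)} {N : (x : M) → Hyp.tangent (ι x)} [IsManifold (𝓡 n) ∞ M]

theorem exp_mul_mink_self_le (h : IsImmersedHypersurface n ι N)
    (hs : WeaklySmallCurvature n ι N) (t : ℝ) (x : M) (v : TangentSpace (𝓡 n) x) :
    Real.exp (-|t|) ^ 2 * mink (tmap ι x v) (tmap ι x v) ≤
      mink (tmap (equidistant ι N t) x v) (tmap (equidistant ι N t) x v) := by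
  obtain ⟨b, lam, hB, hg⟩ := h.exists_principal_basis x
  have h1 := bilin_apply_of_diagonal (firstForm ι x) b hg
    (S := Real.cosh t • LinearMap.id - Real.sinh t • shapeOperator n ι N x)
    (T := Real.cosh t • LinearMap.id - Real.sinh t • shapeOperator n ι N x)
    (σ := fun i => Real.cosh t - Real.sinh t * lam i)
    (τ := fun i => Real.cosh t - Real.sinh t * lam i)
    (fun i => by simp [hB, sub_smul, smul_smul]) (fun i => by simp [hB, sub_smul, smul_smul]) v
  have h2 := bilin_apply_of_diagonal (firstForm ι x) b hg (S := LinearMap.id)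
    (T := LinearMap.id) (σ := fun _ => 1) (by simp) (τ := fun _ => 1) (by simp) v
  simp only [firstForm_apply, LinearMap.id_apply, LinearMap.sub_apply, LinearMap.smul_apply]
    at h1 h2
  rw [h.tmap_equidistant, h1, h2, Finset.mul_sum]
  refine Finset.sum_le_sum fun i _ => ?_
  have h3 := exp_neg_abs_sq_le (t := t) (abs_le_one_of_apply_eq_smul hs (b.ne_zero i) (hB i))
  rw [mul_one, one_mul, ← sq]
  exact mul_le_mul_of_nonneg_right h3 (sq_nonneg _)

/-- The velocity of a curve in normal coordinates controls both components. -/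
theorem exists_velocity (h : IsImmersedHypersurface n ι N) (hs : WeaklySmallCurvature n ι N)
    {g : ℝ → M × ℝ} {τ : ℝ}
    (hg : MDifferentiableAt 𝓘(ℝ, ℝ) ((𝓡 n).prod 𝓘(ℝ, ℝ)) g τ) :
    ∃ w, HasDerivAt (fun r => (normalExp ι N (g r) : Minkowski (n + 1))) w τ ∧
      (∃ t', HasDerivAt (fun r => (g r).2) t' τ ∧ t' ^ 2 ≤ mink w w) ∧
      Real.exp (-|(g τ).2|) ^ 2 * mink (deriv (fun r => (ι (g r).1 : Minkowski (n + 1))) τ)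
        (deriv (fun r => (ι (g r).1 : Minkowski (n + 1))) τ) ≤ mink w w := by
  have hx : MDifferentiableAt 𝓘(ℝ, ℝ) (𝓡 n) (fun r => (g r).1) τ := hg.fst
  have ht : DifferentiableAt ℝ (fun r => (g r).2) τ := hg.snd.differentiableAt
  set v : TangentSpace (𝓡 n) (g τ).1 := mfderiv 𝓘(ℝ, ℝ) (𝓡 n) (fun r => (g r).1) τ (1 : ℝ) with hv
  have h1 : HasDerivAt (fun r => (ι (g r).1 : Minkowski (n + 1))) (tmap ι (g τ).1 v) τ :=
    hasDerivAt_comp_curve (h.mdifferentiable _) hx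
  have h2 : HasDerivAt (fun r => (N (g r).1 : Minkowski (n + 1)))
      (-tmap ι (g τ).1 (shapeOperator n ι N (g τ).1 v)) τ := by
    rw [h.tmap_shapeOperator, neg_neg]
    exact hasDerivAt_comp_curve (f := fun x => (N x : Minkowski (n + 1)))
      (h.mdifferentiable_normal _) hx
  set t := (g τ).2 with htdef
  set t' := deriv (fun r => (g r).2) τ with ht'
  have h3 := (ht.hasDerivAt.cosh.smul h1).add (ht.hasDerivAt.sinh.smul h2)
  have hfun : (fun r => (normalExp ι N (g r) : Minkowski (n + 1))) =
      fun r => Real.cosh (g r).2 • (ι (g r).1 : Minkowski (n + 1)) +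
        Real.sinh (g r).2 • (N (g r).1 : Minkowski (n + 1)) :=
    funext fun r => normalExp_coe h.isUnitNormal.unit (g r)
  set p := (Real.sinh t • (ι (g τ).1 : Minkowski (n + 1)) +
    Real.cosh t • (N (g τ).1 : Minkowski (n + 1))) with hp
  set q := tmap (equidistant ι N t) (g τ).1 v with hq
  have hpp : mink p p = 1 := by
    rw [hp, h.mink_plane]
    linarith [Real.cosh_sq t]
  have hpq : mink p q = 0 := by
    rw [hp, hq, h.tmap_equidistant]
    simp only [mink_add_left, mink_smul_left, h.mink_tmap, h.isUnitNormal.normal, mul_zero, add_zero]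
  have hww : mink (t' • p + q) (t' • p + q) = t' ^ 2 + mink q q := by
    simp only [mink_add_left, mink_add_right, mink_smul_left, mink_smul_right, hpp, hpq,
      mink_comm q p]
    ring
  have hqq := h.exp_mul_mink_self_le hs t (g τ).1 v
  have hq0 : 0 ≤ mink q q := by
    refine le_trans (mul_nonneg (sq_nonneg _) (h.mink_self_nonneg _ _)) hqq
  refine ⟨t' • p + q, ?_, ⟨t', ht.hasDerivAt, ?_⟩, ?_⟩
  · rw [hfun]
    refine HasDerivAt.congr_deriv h3 ?_
    rw [hq, h.tmap_equidistant, map_sub, map_smul, map_smul, hp]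
    module
  · rw [hww]
    linarith
  · rw [hww, h1.deriv]
    linarith [sq_nonneg t']

end IsImmersedHypersurface

end Completeness

section CompleteBijective

open Set Filter

variable {n d : ℕ} {M : Type*} [TopologicalSpace M] [ChartedSpace (EuclideanSpace ℝ (Fin n)) M]
  {ι : M → Hyp (n + 1)} {N : (x : M) → Hyp.tangent (ι x)} [IsManifold (𝓡 n) ∞ M]

namespace IsImmersedHypersurface

/-- If the first fundamental form is complete, the partial lifts of smooth curves through the normal
exponential map have limit points. -/
theorem exists_mapClusterPt_lift (h : IsImmersedHypersurface n ι N)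
    (hs : WeaklySmallCurvature n ι N) (hc : IsCompleteHypersurface n ι) {β : ℝ → Hyp (n + 1)}
    (hβ : ContMDiff 𝓘(ℝ, ℝ) (𝓡 (n + 1)) ∞ β) {e₀ : M × ℝ} {s : ℝ} (hs1 : s ∈ Ioc (0 : ℝ) 1)
    {g : ℝ → M × ℝ} (hg : IsCurveLift (normalExp ι N) β e₀ g (Ico 0 s)) :
    ∃ e, MapClusterPt e (𝓝[<] s) g := by
  have hs0 : 0 < s := hs1.1
  let c : ℝ → Minkowski (n + 1) := fun r => (β r : Minkowski (n + 1))
  have hcd : ContDiff ℝ ∞ c := contMDiff_iff_contDiff.1 ((Hyp.contMDiff_coe (d := n + 1)).comp hβ)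
  have hcd' : Continuous (deriv c) := hcd.continuous_deriv (by simp)
  have hcont : Continuous fun τ => mink (deriv c τ) (deriv c τ) :=
    (contDiff_mink (m := 0)).continuous.comp (hcd'.prodMk hcd')
  obtain ⟨B, hB⟩ := (isCompact_Icc (a := (0 : ℝ)) (b := 1)).exists_bound_of_continuousOn
    hcont.continuousOn
  have hB0 : 0 ≤ B := (norm_nonneg _).trans (hB 0 (by simp))
  have hK : ∀ τ ∈ Icc (0 : ℝ) 1, mink (deriv c τ) (deriv c τ) ≤ (B + 1) ^ 2 := fun τ hτ => by
    have := (le_abs_self _).trans (hB τ hτ)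
    nlinarith
  have hnear : ∀ τ ∈ Ioo 0 s, ∀ᶠ r in 𝓝 τ, normalExp ι N (g r) = β r := fun τ hτ => by
    filter_upwards [isOpen_Ioo.mem_nhds hτ] with r hr
    exact hg.lifts r ⟨hr.1.le, hr.2⟩
  have hgs : ∀ τ ∈ Ioo 0 s, ContMDiffAt 𝓘(ℝ, ℝ) ((𝓡 n).prod 𝓘(ℝ, ℝ)) ∞ g τ := fun τ hτ =>
    (h.isLocalDiffeomorph_normalExp hs).contMDiffAt_of_comp hβ.contMDiffAt
      ((hg.continuousOn.mono Ioo_subset_Ico_self).continuousAt (isOpen_Ioo.mem_nhds hτ))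
      (hnear τ hτ)
  have hvel : ∀ τ ∈ Ioo 0 s, (∃ t', HasDerivAt (fun r => (g r).2) t' τ ∧ t' ^ 2 ≤ (B + 1) ^ 2) ∧
      Real.exp (-|(g τ).2|) ^ 2 * mink (deriv (fun r => (ι (g r).1 : Minkowski (n + 1))) τ)
        (deriv (fun r => (ι (g r).1 : Minkowski (n + 1))) τ) ≤ (B + 1) ^ 2 := fun τ hτ => by
    obtain ⟨w, hw, ⟨t', ht', ht'w⟩, hxw⟩ :=
      h.exists_velocity hs ((hgs τ hτ).mdifferentiableAt (by simp))
    have hw' : deriv c τ = w := by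
      refine (hw.congr_of_eventuallyEq ?_).deriv
      filter_upwards [hnear τ hτ] with r hr
      show (β r : Minkowski (n + 1)) = normalExp ι N (g r)
      rw [hr]
    have h1 := hK τ ⟨hτ.1.le, hτ.2.le.trans hs1.2⟩
    rw [hw'] at h1
    exact ⟨⟨t', ht', ht'w.trans h1⟩, hxw.trans h1⟩
  obtain ⟨l, hl⟩ := tendsto_of_hasDerivAt_bound (f := fun r => (g r).2)
    (f' := deriv fun r => (g r).2) (K := B + 1) hs0
    (fun τ hτ => by
      obtain ⟨t', ht', -⟩ := (hvel τ hτ).1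
      exact ht'.differentiableAt.hasDerivAt)
    (fun τ hτ => by
      obtain ⟨t', ht', hle⟩ := (hvel τ hτ).1
      rw [ht'.deriv]
      exact abs_le_of_sq_le_sq hle (by linarith))
  obtain ⟨a, has, ha⟩ := bounded_of_tendsto_nhdsLT hl
  set R := |l| + 1
  set C := (B + 1) * Real.exp R with hC
  have hC0 : 0 ≤ C := by positivity
  have hspeed : ∀ τ ∈ Ioo (max a 0) s,
      mink (deriv (fun r => (ι (g r).1 : Minkowski (n + 1))) τ)
        (deriv (fun r => (ι (g r).1 : Minkowski (n + 1))) τ) ≤ C ^ 2 := fun τ hτ => by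
    have h1 := (hvel τ ⟨(le_max_right _ _).trans_lt hτ.1, hτ.2⟩).2
    have h2 := ha τ ⟨(le_max_left _ _).trans_lt hτ.1, hτ.2⟩
    set m := mink (deriv (fun r => (ι (g r).1 : Minkowski (n + 1))) τ)
        (deriv (fun r => (ι (g r).1 : Minkowski (n + 1))) τ)
    rcases le_total m 0 with hm | hm
    · exact hm.trans (sq_nonneg _)
    · have h3 : Real.exp (-R) ^ 2 ≤ Real.exp (-|(g τ).2|) ^ 2 :=
        pow_le_pow_left₀ (Real.exp_pos _).le (Real.exp_le_exp.2 (by linarith)) 2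
      have h4 := (mul_le_mul_of_nonneg_right h3 hm).trans h1
      have h5 : m = Real.exp R ^ 2 * (Real.exp (-R) ^ 2 * m) := by
        rw [← mul_assoc, ← mul_pow, ← Real.exp_add, add_neg_cancel, Real.exp_zero]
        ring
      rw [h5, hC, mul_pow, mul_comm ((B + 1) ^ 2)]
      exact mul_le_mul_of_nonneg_left h4 (sq_nonneg _)
  have hdist : ∀ τ₁ ∈ Ioo (max a 0) s, ∀ τ₂ ∈ Ioo (max a 0) s,
      intrinsicEDist n ι (g τ₁).1 (g τ₂).1 ≤ ENNReal.ofReal (C * dist τ₁ τ₂) := by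
    have key : ∀ τ₁ ∈ Ioo (max a 0) s, ∀ τ₂ ∈ Ioo (max a 0) s, τ₁ ≤ τ₂ →
        intrinsicEDist n ι (g τ₁).1 (g τ₂).1 ≤ ENNReal.ofReal (C * (τ₂ - τ₁)) := by
      intro τ₁ h₁ τ₂ h₂ hle
      refine intrinsicEDist_le (x := fun r => (g r).1) h.mdifferentiable hle hC0
        (fun τ hτ => ?_) fun τ hτ => hspeed τ ⟨h₁.1.trans hτ.1, hτ.2.trans h₂.2⟩
      have h3 : τ ∈ Ioo 0 s :=
        ⟨(le_max_right a 0).trans_lt (h₁.1.trans_le hτ.1), hτ.2.trans_lt h₂.2⟩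
      exact ((hgs τ h3).fst).of_le (by exact_mod_cast le_top)
    intro τ₁ h₁ τ₂ h₂
    rcases le_total τ₁ τ₂ with hle | hle
    · rw [dist_comm, Real.dist_eq, abs_of_nonneg (sub_nonneg.2 hle)]
      exact key τ₁ h₁ τ₂ h₂ hle
    · rw [Real.dist_eq, abs_of_nonneg (sub_nonneg.2 hle), intrinsicEDist_comm]
      exact key τ₂ h₂ τ₁ h₁ hle
  obtain ⟨u, -, hu, hus⟩ := exists_seq_strictMono_tendsto' (max_lt has hs0)
  obtain ⟨x, hx⟩ := hc (fun k => (g (u k)).1) fun ε hε => by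
    have h1 : Tendsto (fun r : ℝ => ENNReal.ofReal (C * r)) (𝓝 0) (𝓝 0) := by
      have : Tendsto (fun r : ℝ => ENNReal.ofReal (C * r)) (𝓝 0) (𝓝 (ENNReal.ofReal (C * 0))) :=
        ENNReal.tendsto_ofReal ((continuous_const_mul C).tendsto 0)
      simpa using this
    obtain ⟨δ, hδ, hδε⟩ := Metric.eventually_nhds_iff.1 (h1.eventually_lt_const hε)
    obtain ⟨k, hk⟩ := Metric.cauchySeq_iff.1 hus.cauchySeq δ hδ
    refine ⟨k, fun i hi j hj => (hdist _ (hu i) _ (hu j)).trans_lt (hδε ?_)⟩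
    rw [Real.dist_0_eq_abs, abs_of_nonneg dist_nonneg]
    exact hk i hi j hj
  have hus' : Tendsto u atTop (𝓝[<] s) :=
    tendsto_nhdsWithin_iff.2 ⟨hus, Eventually.of_forall fun k => (hu k).2⟩
  exact ⟨(x, l), MapClusterPt.of_comp hus' (Tendsto.mapClusterPt (hx.prodMk_nhds (hl.comp hus')))⟩

/-- The normal exponential map of a connected complete hypersurface of weakly small curvature is
bijective. -/
theorem bijective_normalExp [ConnectedSpace M] [T2Space M] (h : IsImmersedHypersurface n ι N)
    (hs : WeaklySmallCurvature n ι N) (hc : IsCompleteHypersurface n ι) :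
    Function.Bijective (normalExp ι N) := by
  have hF := h.isLocalDiffeomorph_normalExp hs
  obtain ⟨x₀⟩ := (inferInstance : Nonempty M)
  let e₀ : M × ℝ := (x₀, 0)
  let χ := Hyp.chartHomeomorph (n + 1)
  let K : ℝ → Hyp (n + 1) → Hyp (n + 1) := fun τ y =>
    χ.symm ((1 - τ) • χ (normalExp ι N e₀) + τ • χ y)
  have hK : ∀ y, ContMDiff 𝓘(ℝ, ℝ) (𝓡 (n + 1)) ∞ fun τ => K τ y := fun y =>
    (Hyp.contMDiff_chartHomeomorph_symm (n + 1)).comp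
      (((contDiff_const.sub contDiff_id).smul contDiff_const).add
        (contDiff_id.smul contDiff_const)).contMDiff
  have hK1 : ∀ y, K 1 y = y := fun y => by simp [K]
  refine IsLocalHomeomorph.bijective_of_exists_isCurveLift hF.isLocalHomeomorph e₀ (K := K) ?_ hK1
    (fun τ => ?_) fun y => ?_
  · have := χ.continuous
    have := χ.symm.continuous
    fun_prop
  · have : (1 - τ) • χ (normalExp ι N e₀) + τ • χ (normalExp ι N e₀) = χ (normalExp ι N e₀) := by
      module
    simp only [K, this, χ.symm_apply_apply]
  · refine IsLocalHomeomorph.exists_isCurveLift hF.isLocalHomeomorph (hK y).continuous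
      (by simp [K]) fun s hs1 g hg => h.exists_mapClusterPt_lift hs hc (hK y) hs1 hg

theorem isProperMap_equidistant (h : IsImmersedHypersurface n ι N)
    (hs : WeaklySmallCurvature n ι N) (hbij : Function.Bijective (normalExp ι N)) (t : ℝ) :
    IsProperMap (equidistant ι N t) := by
  have hF := h.isLocalDiffeomorph_normalExp hs
  have h1 : IsHomeomorph (normalExp ι N) := ⟨hF.contMDiff.continuous, hF.isOpenMap, hbij⟩
  have h2 : Topology.IsClosedEmbedding fun x : M => (x, t) :=
    ⟨isEmbedding_prodMkLeft t, by
      have : range (fun x : M => (x, t)) = Prod.snd ⁻¹' {t} := by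
        ext ⟨x, r⟩
        simp [eq_comm]
      rw [this]
      exact isClosed_singleton.preimage continuous_snd⟩
  exact (h1.isClosedEmbedding.comp h2).isProperMap

end IsImmersedHypersurface

end CompleteBijective

section MeanCurvature

theorem LinearMap.trace_eq_sum_of_apply_eq_smul {R V ι : Type*} [CommRing R] [AddCommGroup V]
    [Module R V] [Fintype ι] (b : Module.Basis ι R V) {S : V →ₗ[R] V} {σ : ι → R}
    (hS : ∀ i, S (b i) = σ i • b i) : LinearMap.trace R V S = ∑ i, σ i := by
  classical
  rw [LinearMap.trace_eq_matrix_trace R b, Matrix.trace]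
  refine Finset.sum_congr rfl fun i _ => ?_
  simp [LinearMap.toMatrix_apply, hS]

theorem cosh_sub_sinh_mul_pos {t l : ℝ} (hl : |l| ≤ 1) : 0 < Real.cosh t - Real.sinh t * l := by
  have h1 : Real.sinh t * l ≤ |Real.sinh t| := (le_abs_self _).trans (by
    rw [abs_mul]
    exact mul_le_of_le_one_right (abs_nonneg _) hl)
  have h2 : |Real.sinh t| < Real.cosh t := by
    rw [Real.abs_sinh, ← Real.cosh_abs t]
    exact Real.sinh_lt_cosh _
  linarith

theorem Real.sign_sinh (t : ℝ) : SignType.sign (Real.sinh t) = SignType.sign t := by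
  rcases lt_trichotomy t 0 with h | rfl | h
  · rw [_root_.sign_neg h, _root_.sign_neg (Real.sinh_neg_iff.2 h)]
  · simp
  · rw [_root_.sign_pos h, _root_.sign_pos (Real.sinh_pos_iff.2 h)]

variable {n : ℕ} {M : Type*} [TopologicalSpace M] [ChartedSpace (EuclideanSpace ℝ (Fin n)) M]

namespace IsImmersedHypersurface

variable {ι : M → Hyp (n + 1)} {N : (x : M) → Hyp.tangent (ι x)} [IsManifold (𝓡 n) ∞ M]

theorem shapeOperator_equidistant_apply_eq_smul (h : IsImmersedHypersurface n ι N)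
    (hs : WeaklySmallCurvature n ι N) (t : ℝ) {x : M} {v : TangentSpace (𝓡 n) x} (hv : v ≠ 0)
    {l : ℝ} (hl : shapeOperator n ι N x v = l • v) :
    shapeOperator n (equidistant ι N t) (h.equidistantNormal t) x v =
      (l - Real.sinh t * ((1 - l ^ 2) / (Real.cosh t - Real.sinh t * l))) • v := by
  have hpos := cosh_sub_sinh_mul_pos (t := t) (abs_le_one_of_apply_eq_smul hs hv hl)
  have h1 := h.shapeOperator_equidistant hs t x v
  set w := shapeOperator n (equidistant ι N t) (h.equidistantNormal t) x v
  set c := Real.cosh t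
  set s := Real.sinh t
  set m := l - s * ((1 - l ^ 2) / (c - s * l)) with hm
  have hcs : c ^ 2 = s ^ 2 + 1 := Real.cosh_sq t
  have h2 : m * (c - s * l) = c * l - s := by
    rw [hm, sub_mul, mul_assoc, div_mul_cancel₀ _ hpos.ne']
    ring
  rw [← sub_eq_zero]
  apply eq_zero_of_cosh_smul_eq hs (t := t)
  rw [← sub_eq_zero, map_sub, map_smul, hl]
  have h3 : c • (w - m • v) - s • (shapeOperator n ι N x w - m • l • v) =
      (c • w - s • shapeOperator n ι N x w) - (m * (c - s * l)) • v := by module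
  show c • (w - m • v) - s • (shapeOperator n ι N x w - m • l • v) = 0
  rw [h3, h1, h2, hl]
  module

/-- The mean curvature of the equidistant hypersurfaces of a minimal hypersurface. -/
theorem meanCurvature_equidistant (h : IsImmersedHypersurface n ι N)
    (hs : WeaklySmallCurvature n ι N) (hmin : IsMinimal n ι N) (x : M) {m : ℕ}
    (b : Module.Basis (Fin m) ℝ (TangentSpace (𝓡 n) x)) {lam : Fin m → ℝ}
    (hB : ∀ i, shapeOperator n ι N x (b i) = lam i • b i) (t : ℝ) :
    meanCurvature n (equidistant ι N t) (h.equidistantNormal t) x =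
      -Real.sinh t * ∑ i, (1 - lam i ^ 2) / (Real.cosh t - Real.sinh t * lam i) := by
  have h1 := hmin x
  rw [meanCurvature, LinearMap.trace_eq_sum_of_apply_eq_smul b hB] at h1
  rw [meanCurvature, LinearMap.trace_eq_sum_of_apply_eq_smul b fun i =>
    h.shapeOperator_equidistant_apply_eq_smul hs t (b.ne_zero i) (hB i),
    Finset.sum_sub_distrib, h1, zero_sub, ← Finset.mul_sum, neg_mul]

/-- The points where all principal curvatures are `±1` and both values occur, in terms of the
differentials of `ι + N` and `ι - N`. -/
structure IsDegenerateAt (ι : M → Hyp (n + 1)) (N : (x : M) → Hyp.tangent (ι x)) (x : M) :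
    Prop where
  mink_eq_zero : ∀ v w : TangentSpace (𝓡 n) x,
    mink (tmap ι x v + dif (fun y => (N y : Minkowski (n + 1))) x v)
      (tmap ι x w - dif (fun y => (N y : Minkowski (n + 1))) x w) = 0
  exists_add : ∃ v : TangentSpace (𝓡 n) x, v ≠ 0 ∧
    tmap ι x v + dif (fun y => (N y : Minkowski (n + 1))) x v = 0
  exists_sub : ∃ v : TangentSpace (𝓡 n) x, v ≠ 0 ∧
    tmap ι x v - dif (fun y => (N y : Minkowski (n + 1))) x v = 0

theorem sign_meanCurvature_equidistant (h : IsImmersedHypersurface n ι N) (hn : 1 ≤ n)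
    (hs : WeaklySmallCurvature n ι N) (hmin : IsMinimal n ι N) (t : ℝ) (x : M) :
    SignType.sign (meanCurvature n (equidistant ι N t) (h.equidistantNormal t) x) =
        SignType.sign (-t) ∨
      (meanCurvature n (equidistant ι N t) (h.equidistantNormal t) x = 0 ∧
        IsDegenerateAt ι N x) := by
  obtain ⟨b, lam, hB, hg⟩ := h.exists_principal_basis x
  have hlam : ∀ i, |lam i| ≤ 1 := fun i => abs_le_one_of_apply_eq_smul hs (b.ne_zero i) (hB i)
  have hterm : ∀ i ∈ Finset.univ, 0 ≤ (1 - lam i ^ 2) / (Real.cosh t - Real.sinh t * lam i) :=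
    fun i _ => div_nonneg (sub_nonneg.2 ((sq_le_one_iff_abs_le_one _).2 (hlam i)))
      (cosh_sub_sinh_mul_pos (hlam i)).le
  rw [h.meanCurvature_equidistant hs hmin x b hB t]
  rcases (Finset.sum_nonneg hterm).eq_or_lt with hQ | hQ
  · right
    rw [← hQ, mul_zero]
    refine ⟨rfl, ?_⟩
    have hsq : ∀ i, lam i ^ 2 = 1 := fun i => by
      have h1 := (Finset.sum_eq_zero_iff_of_nonneg hterm).1 hQ.symm i (Finset.mem_univ i)
      rw [div_eq_zero_iff] at h1
      have h2 := h1.resolve_right (cosh_sub_sinh_mul_pos (hlam i)).ne'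
      linarith
    have htr := hmin x
    rw [meanCurvature, LinearMap.trace_eq_sum_of_apply_eq_smul b hB] at htr
    have hcases : ∀ i, lam i = 1 ∨ lam i = -1 := fun i => sq_eq_one_iff.1 (hsq i)
    have hBB : ∀ v, shapeOperator n ι N x (shapeOperator n ι N x v) = v := fun v => by
      have h2 : shapeOperator n ι N x ∘ₗ shapeOperator n ι N x = LinearMap.id :=
        b.ext fun i => by
          rw [LinearMap.comp_apply, hB, map_smul, hB, smul_smul, ← sq, hsq, one_smul,
            LinearMap.id_apply]
      exact LinearMap.congr_fun h2 v
    have hdif : ∀ v, dif (fun y => (N y : Minkowski (n + 1))) x v =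
        -tmap ι x (shapeOperator n ι N x v) := fun v => by rw [h.tmap_shapeOperator, neg_neg]
    refine ⟨fun v w => ?_, ?_, ?_⟩
    · have h3 := h.mink_tmap_dif_normal_comm x v w
      have h4 := h.mink_tmap_dif_normal_comm x (shapeOperator n ι N x v) w
      rw [hdif (shapeOperator n ι N x v), hBB, h.tmap_shapeOperator, mink_neg_left, mink_neg_right]
        at h4
      simp only [mink_add_left, mink_sub_right]
      rw [h3, mink_comm (dif (fun y => (N y : Minkowski (n + 1))) x v) (tmap ι x w),
        mink_comm (tmap ι x v) (tmap ι x w)]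
      linarith
    · obtain ⟨i, hi⟩ : ∃ i, lam i = 1 := by
        by_contra! hne
        have h2 : ∀ i, lam i = -1 := fun i => (hcases i).resolve_left (hne i)
        simp only [h2, Finset.sum_const, Finset.card_univ, Fintype.card_fin, nsmul_eq_mul] at htr
        have : (1 : ℝ) ≤ n := by exact_mod_cast hn
        linarith
      exact ⟨b i, b.ne_zero i, by rw [hdif, hB, hi, one_smul, add_neg_cancel]⟩
    · obtain ⟨i, hi⟩ : ∃ i, lam i = -1 := by
        by_contra! hne
        have h2 : ∀ i, lam i = 1 := fun i => (hcases i).resolve_right (hne i)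
        simp only [h2, Finset.sum_const, Finset.card_univ, Fintype.card_fin, nsmul_eq_mul] at htr
        have : (1 : ℝ) ≤ n := by exact_mod_cast hn
        linarith
      exact ⟨b i, b.ne_zero i, by rw [hdif, hB, hi, neg_one_smul, map_neg, neg_neg, sub_self]⟩
  · left
    rw [sign_mul, sign_pos hQ, mul_one, Left.sign_neg, Left.sign_neg, Real.sign_sinh]

end IsImmersedHypersurface

end MeanCurvature

section ZeroSets

open MeasureTheory Filter Set

variable {E : Type*} [NormedAddCommGroup E] [NormedSpace ℝ E] [FiniteDimensional ℝ E]
  [MeasurableSpace E] [BorelSpace E] {μ : Measure E} [μ.IsAddHaarMeasure] {V : Set E}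

theorem ContinuousOn.measurableSet_inter_preimage {X Y : Type*} [TopologicalSpace X]
    [MeasurableSpace X] [BorelSpace X] [TopologicalSpace Y] {f : X → Y} {s : Set X}
    (hf : ContinuousOn f s) (hs : IsOpen s) {t : Set Y} (ht : IsOpen t) :
    MeasurableSet (s ∩ f ⁻¹' t) :=
  (hf.isOpen_inter_preimage hs ht).measurableSet

/-- The zeros of a function of one variable at which the derivative does not vanish are isolated. -/
theorem countable_zeros_of_deriv_ne_zero {g : ℝ → ℝ} {S : Set ℝ} (hS : ∀ t ∈ S, g t = 0)
    (hg : ∀ t ∈ S, ∃ g' ≠ 0, HasDerivAt g g' t) : S.Countable := by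
  refine (countable_setOfPred_isolated_right_within (s := S)).mono fun t ht => ?_
  refine ⟨ht, ?_⟩
  obtain ⟨g', hg', hd⟩ := hg t ht
  have h1 : ∀ᶠ z in 𝓝[≠] t, g z ≠ 0 := hd.eventually_ne hg'
  have h2 : ∀ᶠ z in 𝓝[S ∩ Ioi t] t, g z ≠ 0 :=
    nhdsWithin_mono t (fun z hz => ne_of_gt hz.2) h1
  have h3 : ∀ᶠ z in 𝓝[S ∩ Ioi t] t, False := by
    filter_upwards [h2, self_mem_nhdsWithin] with z hz hz'
    exact hz (hS z hz'.1)
  simpa using h3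

/-- The differential of a function vanishes almost everywhere on its zero set. -/
theorem ae_fderiv_apply_eq_zero (hV : IsOpen V) {φ : E → ℝ} (hφ : ContDiffOn ℝ 1 φ V) (v : E) :
    ∀ᵐ u ∂μ, u ∈ V → φ u = 0 → fderiv ℝ φ u v = 0 := by
  have hd : ContinuousOn (fun u => fderiv ℝ φ u v) V :=
    (hφ.continuousOn_fderiv_of_isOpen hV le_rfl).clm_apply continuousOn_const
  have hset : {u | u ∈ V → φ u = 0 → fderiv ℝ φ u v = 0} =
      ((V \ (V ∩ φ ⁻¹' {0}ᶜ)) ∩ (V ∩ (fun u => fderiv ℝ φ u v) ⁻¹' {0}ᶜ))ᶜ := by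
    ext u
    simp only [mem_ofPred_eq, mem_compl_iff, mem_inter_iff, Set.mem_sdiff, mem_preimage,
      mem_singleton_iff]
    tauto
  have hmeas : MeasurableSet {u | u ∈ V → φ u = 0 → fderiv ℝ φ u v = 0} := by
    rw [hset]
    exact ((hV.measurableSet.diff
      (hφ.continuousOn.measurableSet_inter_preimage hV isOpen_compl_singleton)).inter
      (hd.measurableSet_inter_preimage hV isOpen_compl_singleton)).compl
  refine ae_mem_of_ae_add_linearMap_mem (LinearMap.toSpanSingleton ℝ E v) volume μ hmeas fun y => ?_
  have hcount : {t : ℝ | ¬ (y + t • v ∈ V → φ (y + t • v) = 0 →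
      fderiv ℝ φ (y + t • v) v = 0)}.Countable := by
    refine countable_zeros_of_deriv_ne_zero (g := fun t => φ (y + t • v)) (fun t ht => ?_)
      fun t ht => ?_
    · simp only [mem_ofPred_eq, Classical.not_imp] at ht
      exact ht.2.1
    · simp only [mem_ofPred_eq, Classical.not_imp] at ht
      refine ⟨_, ht.2.2, ?_⟩
      have h1 : HasFDerivAt φ (fderiv ℝ φ (y + t • v)) (y + t • v) :=
        ((hφ.contDiffAt (hV.mem_nhds ht.1)).differentiableAt (by simp)).hasFDerivAt
      have h2 : HasDerivAt (fun t : ℝ => y + t • v) v t := by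
        simpa using ((hasDerivAt_id t).smul_const v).const_add y
      exact h1.comp_hasDerivAt t h2
  exact hcount.measure_zero volume

theorem ae_hasFDerivAt_zero (hV : IsOpen V) {F : Type*} [NormedAddCommGroup F] [NormedSpace ℝ F]
    [FiniteDimensional ℝ F] {φ : E → F} (hφ : ContDiffOn ℝ 1 φ V) :
    ∀ᵐ u ∂μ, u ∈ V → φ u = 0 → HasFDerivAt φ (0 : E →L[ℝ] F) u := by
  let b := Module.finBasis ℝ F
  let c := Module.finBasis ℝ E
  let L := fun i => LinearMap.toContinuousLinearMap (b.coord i)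
  have h1 : ∀ i j, ∀ᵐ u ∂μ, u ∈ V → L i (φ u) = 0 → fderiv ℝ (fun y => L i (φ y)) u (c j) = 0 :=
    fun i j => ae_fderiv_apply_eq_zero hV ((L i).contDiff.comp_contDiffOn hφ) (c j)
  filter_upwards [ae_all_iff.2 fun i => ae_all_iff.2 (h1 i)] with u hu huV h0
  have hd : HasFDerivAt φ (fderiv ℝ φ u) u :=
    ((hφ.contDiffAt (hV.mem_nhds huV)).differentiableAt (by simp)).hasFDerivAt
  have h2 : fderiv ℝ φ u = 0 := by
    apply ContinuousLinearMap.coe_injective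
    refine c.ext fun j => b.ext_elem fun i => ?_
    have h3 := hu i j huV (by rw [h0, map_zero])
    have h4 : HasFDerivAt (fun y => L i (φ y)) ((L i).comp (fderiv ℝ φ u)) u :=
      (L i).hasFDerivAt.comp u hd
    rw [h4.fderiv] at h3
    simpa [L] using h3
  rwa [h2] at hd

end ZeroSets

section Degenerate

open MeasureTheory

section Pairing

variable {d : ℕ} {E P Q R : Type*} [NormedAddCommGroup E] [NormedSpace ℝ E] [NormedAddCommGroup P]
  [NormedSpace ℝ P] [NormedAddCommGroup Q] [NormedSpace ℝ Q] [NormedAddCommGroup R]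
  [NormedSpace ℝ R] {V : Set E}

theorem HasFDerivAt.clm_apply_const {A : E → P →L[ℝ] Q} {A' : E →L[ℝ] P →L[ℝ] Q} {u : E}
    (hA : HasFDerivAt A A' u) (v : P) : HasFDerivAt (fun y => A y v) (A'.flip v) u :=
  (ContinuousLinearMap.apply ℝ Q v).hasFDerivAt.comp u hA

/-- The derivative of a vanishing Lorentzian product. -/
theorem mink_add_mink_eq_zero {f g : E → Minkowski d} {f' g' : E →L[ℝ] Minkowski d} {u : E}
    (hf : HasFDerivAt f f' u) (hg : HasFDerivAt g g' u)
    (h0 : HasFDerivAt (fun y => mink (f y) (g y)) (0 : E →L[ℝ] ℝ) u) (r : E) :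
    mink (f' r) (g u) + mink (f u) (g' r) = 0 := by
  have h1 := DFunLike.congr_fun ((hf.mink hg).unique h0) r
  have h2 : mink (f u) (g' r) + mink (g u) (f' r) = 0 := by
    have h3 : ((minkL d).flip (g u)) (f' r) = mink (f' r) (g u) := rfl
    rw [mink_comm (g u), ← h3]
    exact h1
  rw [mink_comm (f' r), add_comm, h2]

variable [FiniteDimensional ℝ E] [MeasurableSpace E] [BorelSpace E] {μ : Measure E}
  [μ.IsAddHaarMeasure] [FiniteDimensional ℝ P] [FiniteDimensional ℝ Q] [FiniteDimensional ℝ R]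

/-- At almost every point where the pairing of the ranges of two fields of linear maps vanishes, so
does its derivative. -/
theorem ae_mink_fderiv_add_eq_zero (hV : IsOpen V) {A : E → P →L[ℝ] Minkowski d}
    {B : E → Q →L[ℝ] Minkowski d} (hA : ContDiffOn ℝ 1 A V) (hB : ContDiffOn ℝ 1 B V) :
    ∀ᵐ u ∂μ, u ∈ V → (∀ v w, mink (A u v) (B u w) = 0) →
      ∀ r v w, mink (fderiv ℝ A u r v) (B u w) + mink (A u v) (fderiv ℝ B u r w) = 0 := by
  let b := Module.finBasis ℝ P
  let c := Module.finBasis ℝ Q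
  have h1 : ∀ i j, ∀ᵐ u ∂μ, u ∈ V → mink (A u (b i)) (B u (c j)) = 0 →
      HasFDerivAt (fun y => mink (A y (b i)) (B y (c j))) (0 : E →L[ℝ] ℝ) u := fun i j =>
    ae_hasFDerivAt_zero hV (contDiff_mink.comp_contDiffOn
      ((hA.clm_apply contDiffOn_const).prodMk (hB.clm_apply contDiffOn_const)))
  filter_upwards [ae_all_iff.2 fun i => ae_all_iff.2 (h1 i)] with u hu huV h0 r v w
  have hAd := ((hA.contDiffAt (hV.mem_nhds huV)).differentiableAt (by simp)).hasFDerivAt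
  have hBd := ((hB.contDiffAt (hV.mem_nhds huV)).differentiableAt (by simp)).hasFDerivAt
  let X : P →ₗ[ℝ] Q →ₗ[ℝ] ℝ := LinearMap.mk₂ ℝ
    (fun v w => mink (fderiv ℝ A u r v) (B u w) + mink (A u v) (fderiv ℝ B u r w))
    (fun v₁ v₂ w => by simp only [map_add, mink_add_left]; ring)
    (fun k v w => by simp only [map_smul, mink_smul_left, smul_eq_mul]; ring)
    (fun v w₁ w₂ => by simp only [map_add, mink_add_right]; ring)
    (fun k v w => by simp only [map_smul, mink_smul_right, smul_eq_mul]; ring)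
  have hX : X = 0 := b.ext fun i => c.ext fun j =>
    mink_add_mink_eq_zero (hAd.clm_apply_const (b i)) (hBd.clm_apply_const (c j))
      (hu i j huV (h0 _ _)) r
  exact LinearMap.congr_fun₂ hX v w

theorem ae_mink_fderiv_add_eq_zero₂ (hV : IsOpen V) {D : E → R →L[ℝ] P →L[ℝ] Minkowski d}
    {B : E → Q →L[ℝ] Minkowski d} (hD : ContDiffOn ℝ 1 D V) (hB : ContDiffOn ℝ 1 B V) :
    ∀ᵐ u ∂μ, u ∈ V → (∀ s v w, mink (D u s v) (B u w) = 0) →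
      ∀ r s v w, mink (fderiv ℝ D u r s v) (B u w) + mink (D u s v) (fderiv ℝ B u r w) = 0 := by
  let b := Module.finBasis ℝ R
  filter_upwards [ae_all_iff.2 fun i => ae_mink_fderiv_add_eq_zero (μ := μ) hV
    (hD.clm_apply (contDiffOn_const (c := b i))) hB] with u hu huV h0 r s v w
  have hDd := ((hD.contDiffAt (hV.mem_nhds huV)).differentiableAt (by simp)).hasFDerivAt
  let X : R →ₗ[ℝ] ℝ :=
    { toFun := fun s => mink (fderiv ℝ D u r s v) (B u w) + mink (D u s v) (fderiv ℝ B u r w)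
      map_add' := fun s₁ s₂ => by
        simp only [map_add, add_apply, mink_add_left]; ring
      map_smul' := fun k s => by
        simp only [map_smul, smul_apply, mink_smul_left, smul_eq_mul,
          RingHom.id_apply]; ring }
  have hX : X = 0 := b.ext fun i => by
    have h1 := hu i huV (h0 (b i)) r v w
    rw [(hDd.clm_apply_const (b i)).fderiv] at h1
    exact h1
  exact LinearMap.congr_fun hX s

end Pairing

end Degenerate

section DegeneratePatch

open MeasureTheory

/-- A pair of null vectors `a`, `b` and a pair of linear maps `A`, `B` whose sum spans their
orthogonal complement. -/
structure IsNullFrame {d : ℕ} {E : Type*} [NormedAddCommGroup E] [NormedSpace ℝ E]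
    (a b : Minkowski d) (A B : E →L[ℝ] Minkowski d) : Prop where
  mink_aa : mink a a = 0
  mink_bb : mink b b = 0
  mink_ab : mink a b = -2
  mink_aA : ∀ v, mink a (A v) = 0
  mink_aB : ∀ v, mink a (B v) = 0
  mink_bA : ∀ v, mink b (A v) = 0
  mink_bB : ∀ v, mink b (B v) = 0
  exists_decomposition : ∀ w, ∃ (α β : ℝ) (z : E), w = α • a + β • b + (A z + B z)
  definite : ∀ v, mink (A v + B v) (A v + B v) = 0 → v = 0

namespace IsNullFrame

variable {d : ℕ} {E : Type*} [NormedAddCommGroup E] [NormedSpace ℝ E] {a b : Minkowski d}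
  {A B : E →L[ℝ] Minkowski d}

theorem exists_eq (h : IsNullFrame a b A B) (w : Minkowski d) :
    ∃ z, w = (-(mink b w / 2)) • a + (-(mink a w / 2)) • b + (A z + B z) := by
  obtain ⟨α, β, z, rfl⟩ := h.exists_decomposition w
  refine ⟨z, ?_⟩
  congr 2
  · congr 1
    simp only [mink_add_right, mink_smul_right, mink_comm b a, h.mink_ab, h.mink_bb, h.mink_bA,
      h.mink_bB]
    ring
  · congr 1
    simp only [mink_add_right, mink_smul_right, h.mink_ab, h.mink_aa, h.mink_aA, h.mink_aB]
    ring

theorem exists_eq_add (h : IsNullFrame a b A B) {w : Minkowski d} (ha : mink a w = 0)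
    (hb : mink b w = 0) : ∃ z, w = A z + B z := by
  obtain ⟨z, hz⟩ := h.exists_eq w
  refine ⟨z, ?_⟩
  rw [ha, hb] at hz
  simpa using hz

theorem eq_zero (h : IsNullFrame a b A B) {w : Minkowski d} (ha : mink a w = 0)
    (hb : mink b w = 0) (hw : mink w w = 0) : w = 0 := by
  obtain ⟨z, rfl⟩ := h.exists_eq_add ha hb
  rw [h.definite z hw, map_zero, map_zero, add_zero]

theorem exists_ker_add_ker (h : IsNullFrame a b A B) (h0 : ∀ v w, mink (A v) (B w) = 0) (w : E) :
    ∃ w₁ w₂, w = w₁ + w₂ ∧ A w₁ = 0 ∧ B w₂ = 0 := by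
  obtain ⟨z, hz⟩ := h.exists_eq_add (h.mink_aA w) (h.mink_bA w)
  have h1 : A (w - z) = B z := by rw [map_sub, hz]; abel
  have h2 : B z = 0 := h.eq_zero (h.mink_aB z) (h.mink_bB z) (by rw [← h0 (w - z) z, h1])
  exact ⟨w - z, z, by abel, h1.trans h2, h2⟩

/-- A cubic form that is symmetric and vanishes on one of the two kernels vanishes. -/
theorem mink_eq_zero (h : IsNullFrame a b A B) (h0 : ∀ v w, mink (A v) (B w) = 0)
    {A₂ B₂ : E →L[ℝ] E →L[ℝ] Minkowski d} (hA₂ : ∀ r s, A₂ r s = A₂ s r)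
    (hB₂ : ∀ r s, B₂ r s = B₂ s r)
    (h1 : ∀ r v w, mink (A₂ r v) (B w) + mink (A v) (B₂ r w) = 0) (r v w : E) :
    mink (A₂ r v) (B w) = 0 := by
  obtain ⟨w₁, w₂, rfl, hw₁, hw₂⟩ := h.exists_ker_add_ker h0 w
  have e1 := h1 r v w₁
  have e2 := h1 w₁ v r
  have e3 := h1 v w₁ r
  rw [hB₂ r w₁] at e1
  rw [hA₂ w₁ v] at e2
  rw [hw₁, mink_zero_left] at e3
  rw [map_add, hw₂, add_zero]
  linarith

theorem mink_second_derivatives (h : IsNullFrame a b A B) (h0 : ∀ v w, mink (A v) (B w) = 0)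
    {A₂ B₂ : E →L[ℝ] E →L[ℝ] Minkowski d}
    (haA : ∀ r v, mink (A r) (A v) + mink a (A₂ r v) = 0)
    (haB : ∀ r v, mink (A r) (B v) + mink a (B₂ r v) = 0)
    (hbB : ∀ r v, mink (B r) (B v) + mink b (B₂ r v) = 0)
    (hT : ∀ r v w, mink (A₂ r v) (B w) = 0) (hS : ∀ r v w, mink (A v) (B₂ r w) = 0)
    (s v r w : E) :
    mink (A₂ s v) (B₂ r w) = -(mink (A s) (A v) * mink (B r) (B w) / 2) := by
  obtain ⟨z, hz⟩ := h.exists_eq (B₂ r w)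
  have e1 := haB r w
  rw [h0, zero_add] at e1
  have e2 := hbB r w
  have e3 := haA s v
  rw [e1] at hz
  have e4 : A z = 0 := by
    refine h.eq_zero (h.mink_aA z) (h.mink_bA z) ?_
    have e5 := hS r z w
    rw [hz] at e5
    simp only [mink_add_right, mink_smul_right, mink_comm (A z) a, mink_comm (A z) b, h.mink_aA,
      h.mink_bA, h0] at e5
    linarith
  rw [hz, e4]
  simp only [mink_add_right, mink_smul_right, hT, mink_zero_right, mink_comm (A₂ s v) a]
  rw [show mink b (B₂ r w) = -mink (B r) (B w) by linarith,
    show mink a (A₂ s v) = -mink (A s) (A v) by linarith]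
  ring

theorem not_symmetric (h : IsNullFrame a b A B) (h0 : ∀ v w, mink (A v) (B w) = 0)
    {A₂ B₂ : E →L[ℝ] E →L[ℝ] Minkowski d}
    (haA : ∀ r v, mink (A r) (A v) + mink a (A₂ r v) = 0)
    (haB : ∀ r v, mink (A r) (B v) + mink a (B₂ r v) = 0)
    (hbB : ∀ r v, mink (B r) (B v) + mink b (B₂ r v) = 0)
    (hT : ∀ r v w, mink (A₂ r v) (B w) = 0) (hS : ∀ r v w, mink (A v) (B₂ r w) = 0)
    (hsymm : ∀ r s v w, mink (A₂ s v) (B₂ r w) = mink (A₂ r v) (B₂ s w))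
    {p q : E} (hp : B p = 0) (hp0 : p ≠ 0) (hq : A q = 0) (hq0 : q ≠ 0) : False := by
  have e1 := hsymm q p p q
  rw [h.mink_second_derivatives h0 haA haB hbB hT hS,
    h.mink_second_derivatives h0 haA haB hbB hT hS, hp, hq, mink_zero_left] at e1
  have e2 : mink (A p) (A p) ≠ 0 := fun e => hp0 (h.definite p (by rw [hp, add_zero, e]))
  have e3 : mink (B q) (B q) ≠ 0 := fun e => hq0 (h.definite q (by rw [hq, zero_add, e]))
  have e4 : mink (A p) (A p) * mink (B q) (B q) = 0 := by linarith
  exact (mul_ne_zero e2 e3) e4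

end IsNullFrame

theorem ContDiffOn.fderiv_fderiv_comm {E F : Type*} [NormedAddCommGroup E] [NormedSpace ℝ E]
    [NormedAddCommGroup F] [NormedSpace ℝ F] {V : Set E} (hV : IsOpen V) {f : E → F}
    (hf : ContDiffOn ℝ ∞ f V) {u : E} (hu : u ∈ V) (r s : E) :
    fderiv ℝ (fderiv ℝ f) u r s = fderiv ℝ (fderiv ℝ f) u s r := by
  have h1 : IsSymmSndFDerivAt ℝ f u := (hf.contDiffAt (hV.mem_nhds hu)).isSymmSndFDerivAt (by
    rw [minSmoothness_of_isRCLikeNormedField]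
    exact WithTop.coe_le_coe.2 (le_top : (2 : ℕ∞) ≤ ⊤))
  exact h1 r s

namespace IsHypersurfacePatch

variable {n : ℕ} {V : Set (EuclideanSpace ℝ (Fin n))}
  {f ν : EuclideanSpace ℝ (Fin n) → Minkowski (n + 1)} {u : EuclideanSpace ℝ (Fin n)}

theorem isNullFrame (h : IsHypersurfacePatch V f ν) (hu : u ∈ V) :
    IsNullFrame (f u + ν u) (f u - ν u) (fderiv ℝ (fun y => f y + ν y) u)
      (fderiv ℝ (fun y => f y - ν y) u) := by
  have hA : ∀ v, fderiv ℝ (fun y => f y + ν y) u v = fderiv ℝ f u v + fderiv ℝ ν u v := fun v =>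
    DFunLike.congr_fun ((h.hasFDerivAt hu).add (h.hasFDerivAt_normal hu)).fderiv v
  have hB : ∀ v, fderiv ℝ (fun y => f y - ν y) u v = fderiv ℝ f u v - fderiv ℝ ν u v := fun v =>
    DFunLike.congr_fun ((h.hasFDerivAt hu).sub (h.hasFDerivAt_normal hu)).fderiv v
  have hsum : ∀ v, fderiv ℝ (fun y => f y + ν y) u v + fderiv ℝ (fun y => f y - ν y) u v =
      (2 : ℝ) • fderiv ℝ f u v := fun v => by rw [hA, hB]; module
  have h1 := (h.mem_hyp u hu).1
  have h2 := h.unit u hu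
  have h3 := h.tangent u hu
  have h3' := (mink_comm (ν u) (f u)).trans h3
  have h4 := h.mink_fderiv hu
  have h5 := h.mink_fderiv_normal hu
  have h6 := h.normal u hu
  have h7 := h.mink_normal_fderiv_normal hu
  constructor
  case exists_decomposition =>
    intro w
    obtain ⟨v, hv⟩ := h.exists_decomposition hu w
    refine ⟨(-mink (f u) w + mink (ν u) w) / 2, (-mink (f u) w - mink (ν u) w) / 2,
      (2⁻¹ : ℝ) • v, ?_⟩
    rw [hsum, map_smul, smul_smul]
    conv_lhs => rw [hv]
    module
  case definite =>
    intro v hv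
    rw [hsum, mink_smul_left, mink_smul_right] at hv
    exact h.eq_zero_of_mink_self hu (by linarith)
  all_goals
    try intro v
    simp only [hA, hB, mink_add_left, mink_add_right, mink_sub_left, mink_sub_right, h1, h2, h3,
      h3', h4, h5, h6, h7]
    norm_num

/-- The degenerate points of a coordinate patch form a null set. -/
theorem volume_degenerate (h : IsHypersurfacePatch V f ν) :
    volume {u | u ∈ V ∧
      (∀ v w, mink (fderiv ℝ (fun y => f y + ν y) u v) (fderiv ℝ (fun y => f y - ν y) u w) = 0) ∧
      (∃ q ≠ 0, fderiv ℝ (fun y => f y + ν y) u q = 0) ∧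
      ∃ p ≠ 0, fderiv ℝ (fun y => f y - ν y) u p = 0} = 0 := by
  set a := fun y => f y + ν y with ha
  set b := fun y => f y - ν y with hb
  have has : ContDiffOn ℝ ∞ a V := h.contDiffOn.add h.contDiffOn_normal
  have hbs : ContDiffOn ℝ ∞ b V := h.contDiffOn.sub h.contDiffOn_normal
  have hAs : ContDiffOn ℝ ∞ (fderiv ℝ a) V := has.fderiv_of_isOpen h.isOpen (by simp)
  have hBs : ContDiffOn ℝ ∞ (fderiv ℝ b) V := hbs.fderiv_of_isOpen h.isOpen (by simp)
  have hDs : ContDiffOn ℝ ∞ (fderiv ℝ (fderiv ℝ a)) V := hAs.fderiv_of_isOpen h.isOpen (by simp)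
  have h1 : (1 : WithTop ℕ∞) ≤ (∞ : WithTop ℕ∞) := WithTop.coe_le_coe.2 (le_top : (1 : ℕ∞) ≤ ⊤)
  have key : ∀ᵐ u, ¬ (u ∈ V ∧ (∀ v w, mink (fderiv ℝ a u v) (fderiv ℝ b u w) = 0) ∧
      (∃ q ≠ 0, fderiv ℝ a u q = 0) ∧ ∃ p ≠ 0, fderiv ℝ b u p = 0) := by
    filter_upwards [ae_mink_fderiv_add_eq_zero (μ := volume) h.isOpen (hAs.of_le h1) (hBs.of_le h1),
      ae_mink_fderiv_add_eq_zero₂ (μ := volume) h.isOpen (hDs.of_le h1) (hBs.of_le h1)]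
      with u hu₁ hu₂
    rintro ⟨hu, h0, ⟨q, hq0, hq⟩, p, hp0, hp⟩
    have hfr := h.isNullFrame hu
    have hderiv : ∀ {g : EuclideanSpace ℝ (Fin n) → Minkowski (n + 1)}
        {G : EuclideanSpace ℝ (Fin n) → EuclideanSpace ℝ (Fin n) →L[ℝ] Minkowski (n + 1)}
        (hg : ContDiffOn ℝ ∞ g V) (hG : ContDiffOn ℝ ∞ G V)
        (h0 : ∀ y ∈ V, ∀ v, mink (g y) (G y v) = 0) (r v : EuclideanSpace ℝ (Fin n)),
        mink (fderiv ℝ g u r) (G u v) + mink (g u) (fderiv ℝ G u r v) = 0 := by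
      intro g G hg hG h0 r v
      have hV := h.isOpen.mem_nhds hu
      have e1 := ((hg.contDiffAt hV).differentiableAt (by simp)).hasFDerivAt
      have e2 := ((hG.contDiffAt hV).differentiableAt (by simp)).hasFDerivAt
      refine mink_add_mink_eq_zero e1 (e2.clm_apply_const v) ?_ r
      refine (hasFDerivAt_const (0 : ℝ) u).congr_of_eventuallyEq ?_
      filter_upwards [hV] with y hy using h0 y hy v
    have hA₂ := fun r s => has.fderiv_fderiv_comm h.isOpen hu r s
    have hB₂ := fun r s => hbs.fderiv_fderiv_comm h.isOpen hu r s
    have hA₃ := fun r s => hAs.fderiv_fderiv_comm h.isOpen hu r s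
    have e1 := hu₁ hu h0
    have hT := hfr.mink_eq_zero h0 hA₂ hB₂ e1
    have e2 := hu₂ hu hT
    refine hfr.not_symmetric h0 (A₂ := fderiv ℝ (fderiv ℝ a) u) (B₂ := fderiv ℝ (fderiv ℝ b) u)
      (hderiv has hAs fun y hy => (h.isNullFrame hy).mink_aA)
      (hderiv has hBs fun y hy => (h.isNullFrame hy).mink_aB)
      (hderiv hbs hBs fun y hy => (h.isNullFrame hy).mink_bB) hT (fun r v w => ?_)
      (fun r s v w => ?_) hp hp0 hq hq0
    · have := e1 r v w
      rw [hT] at this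
      linarith
    · have e3 := e2 r s v w
      have e4 := e2 s r v w
      rw [hA₃ r s] at e3
      linarith
  exact measure_eq_zero_iff_ae_notMem.2 key

end IsHypersurfacePatch

end DegeneratePatch

section MainTheorem

variable {n : ℕ} {M : Type*} [TopologicalSpace M] [ChartedSpace (EuclideanSpace ℝ (Fin n)) M]

namespace IsImmersedHypersurface

variable {ι : M → Hyp (n + 1)} {N : (x : M) → Hyp.tangent (ι x)} [IsManifold (𝓡 n) ∞ M]

theorem isNullSet_isDegenerateAt (h : IsImmersedHypersurface n ι N) :
    IsNullSet n {x | IsDegenerateAt ι N x} := by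
  intro e he
  have hp := h.isHypersurfacePatch he
  refine MeasureTheory.measure_mono_null ?_ hp.volume_degenerate
  rintro _ ⟨x, ⟨hx, hxe⟩, rfl⟩
  have hu := e.map_source hxe
  have hx' : IsDegenerateAt ι N (e.symm (e x)) := by rwa [e.left_inv hxe]
  obtain ⟨A, hA⟩ := exists_equiv_dif he hu
  set f := (fun x => (ι x : Minkowski (n + 1))) ∘ e.symm
  set ν := (fun x => (N x : Minkowski (n + 1))) ∘ e.symm
  have h1 : ∀ w, tmap ι (e.symm (e x)) (A w) = fderiv ℝ f (e x) w :=
    hA _ (h.mdifferentiable _)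
  have h2 : ∀ w, dif (fun y => (N y : Minkowski (n + 1))) (e.symm (e x)) (A w) =
      fderiv ℝ ν (e x) w := hA _ (h.mdifferentiable_normal _)
  have h3 : ∀ w, fderiv ℝ (fun y => f y + ν y) (e x) w =
      tmap ι (e.symm (e x)) (A w) +
        dif (fun y => (N y : Minkowski (n + 1))) (e.symm (e x)) (A w) := fun w => by
    rw [h1, h2]
    exact DFunLike.congr_fun ((hp.hasFDerivAt hu).add (hp.hasFDerivAt_normal hu)).fderiv w
  have h4 : ∀ w, fderiv ℝ (fun y => f y - ν y) (e x) w =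
      tmap ι (e.symm (e x)) (A w) -
        dif (fun y => (N y : Minkowski (n + 1))) (e.symm (e x)) (A w) := fun w => by
    rw [h1, h2]
    exact DFunLike.congr_fun ((hp.hasFDerivAt hu).sub (hp.hasFDerivAt_normal hu)).fderiv w
  refine ⟨hu, fun v w => ?_, ?_, ?_⟩
  · rw [h3, h4]
    exact hx'.mink_eq_zero _ _
  · obtain ⟨v, hv0, hv⟩ := hx'.exists_add
    obtain ⟨w, rfl⟩ := A.surjective v
    exact ⟨w, fun hw => hv0 (by rw [hw, map_zero]), (h3 w).trans hv⟩
  · obtain ⟨v, hv0, hv⟩ := hx'.exists_sub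
    obtain ⟨w, rfl⟩ := A.surjective v
    exact ⟨w, fun hw => hv0 (by rw [hw, map_zero]), (h4 w).trans hv⟩

theorem isNullSet_sign_meanCurvature_ne (h : IsImmersedHypersurface n ι N) (hn : 1 ≤ n)
    (hs : WeaklySmallCurvature n ι N) (hmin : IsMinimal n ι N) (t : ℝ) :
    IsNullSet n {x | SignType.sign (meanCurvature n (equidistant ι N t) (h.equidistantNormal t) x) ≠
      SignType.sign (-t)} := fun e he =>
  MeasureTheory.measure_mono_null (Set.image_mono (Set.inter_subset_inter_left _ fun x hx =>
    ((h.sign_meanCurvature_equidistant hn hs hmin t x).resolve_left hx).2))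
    (h.isNullSet_isDegenerateAt e he)

end IsImmersedHypersurface

end MainTheorem

end

theorem mainTheorem12 (n : ℕ) (hn : 1 ≤ n) {M : Type*} [TopologicalSpace M]
    [ChartedSpace (EuclideanSpace ℝ (Fin n)) M] [IsManifold (𝓡 n) ∞ M]
    (ι : M → Hyp (n + 1)) (hι : Manifold.IsSmoothEmbedding (𝓡 n) (𝓡 (n + 1)) ∞ ι)
    (N : (x : M) → Hyp.tangent (ι x)) (hN : IsUnitNormal n ι N)
    (hsmall : WeaklySmallCurvature n ι N) :
    (IsGeodesicallyConvex n ι →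
      (∃ (U : TopologicalSpace.Opens (Hyp (n + 1)))
        (Φ : Diffeomorph ((𝓡 n).prod 𝓘(ℝ, ℝ)) (𝓡 (n + 1)) (M × ℝ) U ∞),
        (U : Set (Hyp (n + 1))) = Set.range (normalExp ι N) ∧
        ∀ p, (Φ p : Hyp (n + 1)) = normalExp ι N p) ∧
      ∀ t : ℝ, Manifold.IsSmoothEmbedding (𝓡 n) (𝓡 (n + 1)) ∞ (equidistant ι N t) ∧
        ∃ N', IsForwardUnitNormal n ι N t N' ∧ WeaklySmallCurvature n (equidistant ι N t) N') ∧
    (IsCompleteHypersurface n ι → ConnectedSpace M →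
      (∃ Φ : Diffeomorph ((𝓡 n).prod 𝓘(ℝ, ℝ)) (𝓡 (n + 1)) (M × ℝ) (Hyp (n + 1)) ∞,
        ∀ p, Φ p = normalExp ι N p) ∧
      ∀ t : ℝ, Manifold.IsSmoothEmbedding (𝓡 n) (𝓡 (n + 1)) ∞ (equidistant ι N t) ∧
        IsProperMap (equidistant ι N t) ∧
        ∃ N', IsForwardUnitNormal n ι N t N' ∧ WeaklySmallCurvature n (equidistant ι N t) N') ∧
    (IsMinimal n ι N → ∀ t : ℝ, ∃ N', IsForwardUnitNormal n ι N t N' ∧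
      (∀ x, meanCurvature n (equidistant ι N t) N' x = 0 ∨
        SignType.sign (meanCurvature n (equidistant ι N t) N' x) = SignType.sign (-t)) ∧
      IsNullSet n {x | SignType.sign (meanCurvature n (equidistant ι N t) N' x) ≠
        SignType.sign (-t)}) := by
  have h : IsImmersedHypersurface n ι N :=
    ⟨hι.contMDiff, tmap_injective_of_isImmersion hι.isImmersion, hN⟩
  have hF := h.isLocalDiffeomorph_normalExp hsmall
  refine ⟨fun hconv => ?_, fun hc _ => ?_, fun hmin t => ?_⟩
  · have hinj := h.injective_normalExp hsmall hι.isEmbedding.injective hconv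
    exact ⟨hF.exists_diffeomorph_opens hinj, fun t => ⟨isSmoothEmbedding_slice hF hinj t,
      h.equidistantNormal t, h.isForwardUnitNormal hsmall t,
      h.weaklySmallCurvature_equidistant hsmall t⟩⟩
  · have : T2Space M := hι.isEmbedding.t2Space
    have hbij := h.bijective_normalExp hsmall hc
    exact ⟨hF.exists_diffeomorph hbij, fun t => ⟨isSmoothEmbedding_slice hF hbij.injective t,
      h.isProperMap_equidistant hsmall hbij t, h.equidistantNormal t,
      h.isForwardUnitNormal hsmall t, h.weaklySmallCurvature_equidistant hsmall t⟩⟩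
  · exact ⟨h.equidistantNormal t, h.isForwardUnitNormal hsmall t, fun x =>
      (h.sign_meanCurvature_equidistant hn hsmall hmin t x).symm.imp And.left id,
      h.isNullSet_sign_meanCurvature_ne hn hsmall hmin t⟩
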